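/- Let $n\ge 1$ be an integer, and write $p'=p/(p-1)$ for $1<p<\infty$. All functions are real-valued, and $\|g\|_{L^{p,\infty}}=\sup_{t>0}t\,|\{x:|g(x)|>t\}|^{1/p}$. For an operator $S$, $\|S\|_{L^p\to L^{p,\infty}}$ denotes the least $C\in[0,\infty]$ such that $\|Sf\|_{L^{p,\infty}}\le C\|f\|_{L^p}$ for all $f\in L^p$ in the domain of $S$. A Calderón–Zygmund operator on $\mathbb R^n$ is a linear operator $T$ bounded on $L^2(\mathbb R^n)$ for which there is a kernel $K:\{(x,y)\in\mathbb R^n\times\mathbb R^n: x\ne y\}\to\mathbb R$ with $Tf(x)=\int K(x,y)f(y)\,dy$ for a.e. $x\notin\operatorname{supp}f$, for every $f\in C_c^\infty(\mathbb R^n)$, and such that, for some constants $C<\infty$ and $\delta>0$, $|K(x,y)|\le C|x-y|^{-n}$ for $x\neq y$ and $$|K(x,y)-K(x',y)|+|K(y,x)-K(y,x')|\le C\Big(\frac{|x-x'|}{|x-y|}\Big)^{\delta}\frac1{|x-y|^n}\qquad\text{whenever }x\ne y,\ |x-x'|\le\tfrac12|x-y|.$$ A function $b$ is in $BMO(\mathbb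 R^n)$ if it is locally integrable and $\sup_Q\frac1{|Q|}\int_Q|b-b_Q|<\infty$, the supremum being over the cubes $Q$ with sides parallel to the axes, where $b_Q=\frac1{|Q|}\int_Q b$. The commutator is $[b,S]f=b\,Sf-S(bf)$. Let $Mf(x)=\sup_{Q\ni x}\frac1{|Q|}\int_Q|f|$, and let $M^k$ be its $k$-fold iterate, with domain all measurable functions. Let $Hf(x)=\mathrm{p.v.}\int_{\mathbb R}\frac{f(y)}{x-y}\,dy$ be the Hilbert transform. The domain of $T$ and of $H$ is $L^2$, and the domain of $[b,T]$ and of $[b,H]$ is $\{f\in L^2: bf\in L^2\}$. **Lemma.** Let $T$ be a Calderón–Zygmund operator on $\mathbb R^n$, let $b\in BMO(\mathbb R^n)$, and let $k\ge1$ be an integer. Then there exist constants $c_1,c_2,c_3,c_4>0$, where $c_1$ depends only on $n,T$, $c_2$ only on $n,T,b$, and $c_3,c_4$ only on $n,k$, such that for all $1<p<\infty$ $$\|T\|_{L^p\to L^{p,\infty}}\le c_1\,p,\qquad \|[b,T]\|_{L^p\to L^{p,\infty}}\le c_2\,p'\,p^2,\qquad c_3\,(p')^{k-1}\le\|M^k\|_{L^p\to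 L^{p,\infty}}\le c_4\,(p')^{k-1}.$$ Moreover there exist absolute constants $c_5,c_6>0$ such that, on $\mathbb R$ and with $b(x)=\log|x|$, for all $1<p<\infty$ $$c_5\,p\le\|H\|_{L^p\to L^{p,\infty}},\qquad c_6\max\{p',p^2\}\le\|[b,H]\|_{L^p\to L^{p,\infty}}.$$ -/

import Mathlib

open MeasureTheory Filter Topology
open scoped ENNReal NNReal

noncomputable section

/-! ### Weak Lebesgue spaces and weak-type operator norms -/

/-- The quasi-norm of weak `L^p` with respect to Lebesgue measure,
`‖g‖_{L^{p,∞}} = sup_{t > 0} t |{x : |g x| > t}|^{1/p}`.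
(The value `t = 0`, which is allowed below, contributes `0`.) -/
def weakLpNorm {X ε : Type*} [MeasureSpace X] [ENorm ε] (p : ℝ) (g : X → ε) : ℝ≥0∞ :=
  ⨆ t : ℝ≥0, (t : ℝ≥0∞) * volume {x | (t : ℝ≥0∞) < ‖g x‖ₑ} ^ (1 / p)

/-- The operator norm `‖S‖_{L^p → L^{p,∞}}` of an operator `S` with domain `D`: the least
`C ∈ [0, ∞]` with `‖S f‖_{L^{p,∞}} ≤ C ‖f‖_{L^p}` for all `f ∈ L^p` in the domain. -/
def weakOpNorm {X ε : Type*} [MeasureSpace X] [ENorm ε]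
    (D : Set (X → ℝ)) (S : (X → ℝ) → X → ε) (p : ℝ) : ℝ≥0∞ :=
  sInf {C : ℝ≥0∞ | ∀ f ∈ D, MemLp f (ENNReal.ofReal p) →
    weakLpNorm p (S f) ≤ C * eLpNorm f (ENNReal.ofReal p)}

/-- The functions in `L²`: the natural domain of an operator bounded on `L²`. -/
def domL2 (X : Type*) [MeasureSpace X] : Set (X → ℝ) :=
  {f | MemLp f 2}

/-! ### Commutators -/

/-- The commutator `[b, S] f = b · S f - S (b f)`. -/
def opCommutator {X : Type*} (b : X → ℝ) (S : (X → ℝ) → X → ℝ) (f : X → ℝ) : X → ℝ :=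
  fun x => b x * S f x - S (fun y => b y * f y) x

/-- The natural domain of `[b, S]` for `S` bounded on `L²`: both `f` and `b f` are in `L²`.
For `b ∈ BMO` it contains all bounded functions with compact support. -/
def domCommutator {X : Type*} [MeasureSpace X] (b : X → ℝ) : Set (X → ℝ) :=
  {f | MemLp f 2 ∧ MemLp (fun y => b y * f y) 2}

/-! ### Cubes, the maximal function and `BMO` in `ℝⁿ` -/

/-- The open cube with centre `c`, side length `2 r` and sides parallel to the axes. -/
def cube {n : ℕ} (c : EuclideanSpace ℝ (Fin n)) (r : ℝ) : Set (EuclideanSpace ℝ (Fin n)) :=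
  {y | ∀ i, |y i - c i| < r}

/-- The (uncentred) Hardy–Littlewood maximal operator over cubes, on functions with values
in `[0, ∞]`: `M g x = sup_{Q ∋ x} |Q|⁻¹ ∫_Q g`. -/
def maximalOp {n : ℕ} (g : EuclideanSpace ℝ (Fin n) → ℝ≥0∞) (x : EuclideanSpace ℝ (Fin n)) :
    ℝ≥0∞ :=
  ⨆ (c : EuclideanSpace ℝ (Fin n)) (r : ℝ) (_ : 0 < r) (_ : x ∈ cube c r),
    (volume (cube c r))⁻¹ * ∫⁻ y in cube c r, g y

/-- The `k`-fold iterate `M^k f = M (M (⋯ M f))`, with `M f = M |f|`. -/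
def iterMaximal {n : ℕ} (k : ℕ) (f : EuclideanSpace ℝ (Fin n) → ℝ) :
    EuclideanSpace ℝ (Fin n) → ℝ≥0∞ :=
  maximalOp^[k] (fun x => ‖f x‖ₑ)

/-- `‖b‖_{BMO} = sup_Q |Q|⁻¹ ∫_Q |b - b_Q|`, where `b_Q` is the average of `b` over `Q`. -/
def bmoNorm {n : ℕ} (b : EuclideanSpace ℝ (Fin n) → ℝ) : ℝ≥0∞ :=
  ⨆ (c : EuclideanSpace ℝ (Fin n)) (r : ℝ) (_ : 0 < r),
    (volume (cube c r))⁻¹ * ∫⁻ x in cube c r, ‖b x - ⨍ y in cube c r, b y‖ₑ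

/-- `b ∈ BMO`: `b` is locally integrable and `‖b‖_{BMO} < ∞`. -/
def MemBMO {n : ℕ} (b : EuclideanSpace ℝ (Fin n) → ℝ) : Prop :=
  LocallyIntegrable b ∧ bmoNorm b < ⊤

/-! ### Calderón–Zygmund operators in `ℝⁿ` -/

/-- A standard kernel on `ℝⁿ × ℝⁿ` off the diagonal: size estimate, and Hölder regularity in
each of the two variables. -/
structure IsStandardKernel {n : ℕ}
    (K : EuclideanSpace ℝ (Fin n) → EuclideanSpace ℝ (Fin n) → ℝ) : Prop where
  size : ∃ C : ℝ, ∀ x y, x ≠ y → |K x y| ≤ C / ‖x - y‖ ^ n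
  regularity : ∃ C δ : ℝ, 0 < δ ∧ ∀ x x' y, x ≠ y → ‖x - x'‖ ≤ (1 / 2) * ‖x - y‖ →
    |K x y - K x' y| ≤ C * (‖x - x'‖ / ‖x - y‖) ^ δ * (1 / ‖x - y‖ ^ n) ∧
    |K y x - K y x'| ≤ C * (‖x - x'‖ / ‖x - y‖) ^ δ * (1 / ‖x - y‖ ^ n)

/-- A bounded linear operator on (real) `L²(ℝⁿ)`. -/
abbrev L2Operator (n : ℕ) : Type :=
  Lp ℝ 2 (volume : Measure (EuclideanSpace ℝ (Fin n))) →L[ℝ]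
    Lp ℝ 2 (volume : Measure (EuclideanSpace ℝ (Fin n)))

open Classical in
/-- The action of an operator on `L²` on a function `f` (a representative of the class `T f`);
the value for `f ∉ L²` is never used. -/
def L2Operator.onFun {n : ℕ} (T : L2Operator n) (f : EuclideanSpace ℝ (Fin n) → ℝ) :
    EuclideanSpace ℝ (Fin n) → ℝ :=
  if h : MemLp f 2 then T (h.toLp f) else 0

/-- `T`, bounded on `L²`, is a Calderón–Zygmund operator: there is a standard kernel `K` with
`T f x = ∫ K x y f y dy` for (almost) all `x ∉ supp f`, for every `f ∈ C_c^∞`. -/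
def IsCalderonZygmund {n : ℕ} (T : L2Operator n) : Prop :=
  ∃ K : EuclideanSpace ℝ (Fin n) → EuclideanSpace ℝ (Fin n) → ℝ, IsStandardKernel K ∧
    ∀ f : EuclideanSpace ℝ (Fin n) → ℝ, ContDiff ℝ ((⊤ : ℕ∞) : WithTop ℕ∞) f → HasCompactSupport f →
      ∀ᵐ x, x ∉ tsupport f → T.onFun f x = ∫ y, K x y * f y

/-! ### The Hilbert transform -/

/-- The Hilbert transform `H f x = p.v. ∫ f y / (x - y) dy` on the line, the limit as `ε → 0+`
of the integrals over `|x - y| > ε` (it exists for almost every `x` when `f ∈ L^p`,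
`1 ≤ p < ∞`). -/
def hilbertTransform (f : ℝ → ℝ) (x : ℝ) : ℝ :=
  limUnder (𝓝[>] (0 : ℝ)) (fun ε : ℝ => ∫ y in {y : ℝ | ε < |x - y|}, f y / (x - y))

end

/-! Upper bounds for `T` and `[b, T]`. The core is the range 1 < p ≤ 2, where a Calderón–Zygmund
decomposition gives `T` the weak type (p, p) with a constant independent of p (`CZBound.weak_type`)
and gives the commutator the constant p' (`CZBound.weak_type_opCommutator`). On an atom h living on
a cube Q one writes [b, T]h = (b - b_Q) T h - T((b - b_Q) h). The first term is summable away from Q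
because the kernel decay 2^(-δj) beats the growth, linear in j, of the oscillation of b over the
j-th dilate of Q. The second falls under the weak (1, 1) inequality for `T` and Hölder's inequality
on Q; the John–Nirenberg bound, that the mean of |b - b_Q|^q over Q is at most (C q)^q, taken with q
= p', is the only source of the factor p'.

The good part of the decomposition needs a weak (2, 2) bound for [b, T]. For bounded b the best
constant in it is finite, and a good-λ inequality between [b, T]f and the maximal functions of |f|²
and |Tf|² (`CZBound.volume_lt_opCommutator_le`) bounds it by itself times 1/2 plus a quantity
depending only on the oscillation of b. Absorbing gives a constant that does not see the sup norm of
b, so truncating b reaches all of BMO.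

Large p follows by duality (`WeakTypeBounds.dual`): `T` has an adjoint of the same kind, and the
adjoint of [b, T] is -[b, T*]. Pairing with the sign of Sf on a level set E reduces matters to the
L^{p'} norm of S'g with |g| ≤ 1_E. If S' has weak type (r, r) with constant C (r')^k on (1, 2],
interpolation between r = (1 + p')/2 and r = 2 costs (2p)^k for the constant and one more factor p
for the integral of the level sets near 0. With k = 0 for `T` and k = 1 for [b, T] these are the
powers p and p². The gap 2 < p < 4 is filled by interpolation.

For the iterated maximal function, k - 1 applications are estimated in strong type, each costing p',
and the last one only in weak type, which costs 5^n for every p. Conversely, `M^j` of the indicator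
of a unit cube has integral at least c·binom(m, j) over the concentric cube dilated by 2^m
(`choose_le_lintegral_iterMaximal`); taking m comparable to p' makes this sharp.

For the Hilbert transform and b = log|x|, indicators of intervals suffice: the logarithmic
singularity at an endpoint gives p, the decay (log x)/x at infinity gives p', and the product of
both logarithms near the origin gives p². -/

noncomputable section

/-! ### Axis-parallel cubes and Lebesgue differentiation along them. -/

section Cubes

variable {n : ℕ}

theorem cube_eq_preimage_ball (c : EuclideanSpace ℝ (Fin n)) {r : ℝ} (hr : 0 < r) :
    cube c r = WithLp.ofLp ⁻¹' Metric.ball (WithLp.ofLp c) r := by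
  ext y
  simp [cube, dist_pi_lt_iff hr, Real.dist_eq]

theorem isOpen_cube (c : EuclideanSpace ℝ (Fin n)) (r : ℝ) : IsOpen (cube c r) := by
  have : cube c r = ⋂ i, {y : EuclideanSpace ℝ (Fin n) | |y i - c i| < r} := by
    ext y; simp [cube]
  rw [this]
  exact isOpen_iInter_of_finite fun i => isOpen_lt (by fun_prop) continuous_const

theorem measurableSet_cube (c : EuclideanSpace ℝ (Fin n)) (r : ℝ) : MeasurableSet (cube c r) :=
  (isOpen_cube c r).measurableSet

theorem volume_cube (c : EuclideanSpace ℝ (Fin n)) {r : ℝ} (hr : 0 < r) :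
    volume (cube c r) = ENNReal.ofReal ((2 * r) ^ n) := by
  rw [cube_eq_preimage_ball c hr,
    (PiLp.volume_preserving_ofLp (Fin n)).measure_preimage
      measurableSet_ball.nullMeasurableSet, Real.volume_pi_ball _ hr]
  simp

theorem volume_cube_ne_zero (c : EuclideanSpace ℝ (Fin n)) {r : ℝ} (hr : 0 < r) :
    volume (cube c r) ≠ 0 := by
  rw [volume_cube c hr]; simp; positivity

theorem volume_cube_ne_top (c : EuclideanSpace ℝ (Fin n)) {r : ℝ} (hr : 0 < r) :
    volume (cube c r) ≠ ∞ := by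
  rw [volume_cube c hr]; simp

theorem cube_subset_cube (c : EuclideanSpace ℝ (Fin n)) {r r' : ℝ} (h : r ≤ r') :
    cube c r ⊆ cube c r' := fun _ hy i => (hy i).trans_le h

theorem mem_cube_self (c : EuclideanSpace ℝ (Fin n)) {r : ℝ} (hr : 0 < r) : c ∈ cube c r := by
  intro i; simpa using hr

theorem abs_coord_sub_le (x c : EuclideanSpace ℝ (Fin n)) (i : Fin n) : |x i - c i| ≤ ‖x - c‖ := by
  have := PiLp.norm_apply_le (x - c) i
  simpa using this

theorem norm_sub_le_of_forall_abs {x c : EuclideanSpace ℝ (Fin n)} {r : ℝ} (hr : 0 ≤ r)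
    (h : ∀ i, |x i - c i| ≤ r) : ‖x - c‖ ≤ n * r := by
  rw [EuclideanSpace.norm_eq]
  have h1 : ∑ i, ‖(x - c) i‖ ^ 2 ≤ n * r ^ 2 := by
    calc ∑ i, ‖(x - c) i‖ ^ 2 ≤ ∑ _i : Fin n, r ^ 2 := by
          gcongr with i
          simpa using h i
      _ = n * r ^ 2 := by simp
  rw [Real.sqrt_le_left (by positivity)]
  refine h1.trans ?_
  rw [mul_pow]
  gcongr
  rcases Nat.eq_zero_or_pos n with h | h
  · simp [h]
  · have : (1 : ℝ) ≤ n := by exact_mod_cast h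
    nlinarith

theorem isBounded_cube (c : EuclideanSpace ℝ (Fin n)) (r : ℝ) : Bornology.IsBounded (cube c r) := by
  refine (Metric.isBounded_closedBall (x := c) (r := n * |r|)).subset fun y hy => ?_
  rw [Metric.mem_closedBall, dist_eq_norm]
  exact norm_sub_le_of_forall_abs (abs_nonneg r) fun i => (hy i).le.trans (le_abs_self r)

theorem ball_subset_cube (c : EuclideanSpace ℝ (Fin n)) (r : ℝ) : Metric.ball c r ⊆ cube c r := by
  intro y hy i
  rw [Metric.mem_ball, dist_eq_norm] at hy
  exact (abs_coord_sub_le y c i).trans_lt hy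

/-- Cubes are the balls of the sup metric on `Fin n → ℝ`, and the identification with Euclidean
space preserves measure, so the differentiation theorem for doubling measures applies there. The
cubes need not be centred at the point: dyadic cubes shrinking to it must be allowed. -/
theorem ae_tendsto_cube_average {v : EuclideanSpace ℝ (Fin n) → ℝ} (hv : LocallyIntegrable v) :
    ∀ᵐ x, ∀ (c : ℕ → EuclideanSpace ℝ (Fin n)) (r : ℕ → ℝ), (∀ k, 0 < r k) →
      Tendsto r atTop (𝓝 0) → (∀ k i, |x i - c k i| ≤ r k) →
      Tendsto (fun k => (volume (cube (c k) (r k)))⁻¹ * ∫⁻ y in cube (c k) (r k), ‖v y‖ₑ) atTop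
        (𝓝 ‖v x‖ₑ) := by
  have hmp := PiLp.volume_preserving_toLp (Fin n)
  have hemb : MeasurableEmbedding (WithLp.toLp 2 : (Fin n → ℝ) → EuclideanSpace ℝ (Fin n)) :=
    (MeasurableEquiv.toLp 2 (Fin n → ℝ)).measurableEmbedding
  have hw : LocallyIntegrable (fun z : Fin n → ℝ => |v (WithLp.toLp 2 z)|) := by
    rw [locallyIntegrable_iff]
    intro k hk
    have hk' : IsCompact (WithLp.toLp 2 '' k : Set (EuclideanSpace ℝ (Fin n))) :=
      hk.image (PiLp.continuous_toLp 2 _)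
    have h1 := (hmp.integrableOn_image hemb).1 (hv.integrableOn_isCompact hk')
    exact h1.norm
  -- The dilation factor 1 says that the point may lie anywhere in the closed ball itself.
  have key := IsUnifLocDoublingMeasure.ae_tendsto_average volume hw 1
  have key2 := (PiLp.volume_preserving_ofLp (Fin n)).quasiMeasurePreserving.ae key
  filter_upwards [key2] with x hx c r hr hr0 hxc
  have h1 := hx (fun k => WithLp.ofLp (c k)) r
    (tendsto_nhdsWithin_iff.2 ⟨hr0, Eventually.of_forall hr⟩)
    (Eventually.of_forall fun k => by
      rw [one_mul, Metric.mem_closedBall, dist_pi_le_iff (hr k).le]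
      intro i; simpa [Real.dist_eq] using hxc k i)
  have h2 := (ENNReal.continuous_ofReal.tendsto _).comp h1
  have h3 : ENNReal.ofReal |v (WithLp.toLp 2 (WithLp.ofLp x))| = ‖v x‖ₑ := by
    simp [Real.enorm_eq_ofReal_abs]
  rw [h3] at h2
  refine h2.congr fun k => ?_
  simp only [Function.comp]
  have hae : (Metric.closedBall (WithLp.ofLp (c k)) (r k) : Set (Fin n → ℝ)) =ᵐ[volume]
      Metric.ball (WithLp.ofLp (c k)) (r k) := by
    refine (ae_eq_of_subset_of_measure_ge Metric.ball_subset_closedBall ?_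
      measurableSet_ball.nullMeasurableSet ?_).symm
    · rw [Real.volume_pi_ball _ (hr k), Real.volume_pi_closedBall _ (hr k).le]
    · rw [Real.volume_pi_closedBall _ (hr k).le]; simp
  have hpre : (WithLp.toLp 2 ⁻¹' cube (c k) (r k) : Set (Fin n → ℝ)) =
      Metric.ball (WithLp.ofLp (c k)) (r k) := by
    rw [cube_eq_preimage_ball _ (hr k)]; ext; simp
  rw [setAverage_congr hae, setAverage_eq, ← hpre, smul_eq_mul,
    hmp.setIntegral_preimage_emb hemb (fun y => |v y|), measureReal_def,
    hmp.measure_preimage (measurableSet_cube _ _).nullMeasurableSet,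
    ENNReal.ofReal_mul (by positivity), ENNReal.ofReal_inv_of_pos, ENNReal.ofReal_toReal]
  · congr 1
    rw [← ofReal_integral_norm_eq_lintegral_enorm]
    · rfl
    · exact (hv.integrableOn_isCompact ((isBounded_cube _ _).isCompact_closure)).mono_set
        subset_closure
  · exact volume_cube_ne_top _ (hr k)
  · exact ENNReal.toReal_pos (volume_cube_ne_zero _ (hr k)) (volume_cube_ne_top _ (hr k))

end Cubes

/-! ### Dyadic grids -/

section Dyadic

variable {n : ℕ}

/-- The half-open cube with side `s` and index `m` in the grid with origin `a`. -/
def gridCube (a : EuclideanSpace ℝ (Fin n)) (s : ℝ) (m : Fin n → ℤ) :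
    Set (EuclideanSpace ℝ (Fin n)) :=
  {y | ∀ i, ⌊(y i - a i) / s⌋ = m i}

/-- The centre of a grid cube. -/
def gridCenter (a : EuclideanSpace ℝ (Fin n)) (s : ℝ) (m : Fin n → ℤ) :
    EuclideanSpace ℝ (Fin n) :=
  WithLp.toLp 2 fun i => a i + s * (m i + 1 / 2)

/-- The index of the cube of the grid containing `x`. -/
def gridIndex (a : EuclideanSpace ℝ (Fin n)) (s : ℝ) (x : EuclideanSpace ℝ (Fin n)) :
    Fin n → ℤ :=
  fun i => ⌊(x i - a i) / s⌋

theorem mem_gridCube_iff {a : EuclideanSpace ℝ (Fin n)} {s : ℝ} {m : Fin n → ℤ}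
    {y : EuclideanSpace ℝ (Fin n)} : y ∈ gridCube a s m ↔ gridIndex a s y = m := by
  simp [gridCube, gridIndex, funext_iff]

theorem mem_gridCube_gridIndex (a : EuclideanSpace ℝ (Fin n)) (s : ℝ)
    (x : EuclideanSpace ℝ (Fin n)) : x ∈ gridCube a s (gridIndex a s x) :=
  mem_gridCube_iff.2 rfl

theorem mem_gridCube_iff_le {a : EuclideanSpace ℝ (Fin n)} {s : ℝ} (hs : 0 < s) {m : Fin n → ℤ}
    {y : EuclideanSpace ℝ (Fin n)} :
    y ∈ gridCube a s m ↔ ∀ i, a i + s * m i ≤ y i ∧ y i < a i + s * (m i + 1) := by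
  simp only [gridCube, Set.mem_ofPred_eq, Int.floor_eq_iff, le_div_iff₀ hs, div_lt_iff₀ hs]
  refine forall_congr' fun i => ?_
  constructor <;> rintro ⟨h1, h2⟩ <;> constructor <;> linarith

theorem measurableSet_gridCube (a : EuclideanSpace ℝ (Fin n)) (s : ℝ) (m : Fin n → ℤ) :
    MeasurableSet (gridCube a s m) := by
  have : gridCube a s m = ⋂ i, {y : EuclideanSpace ℝ (Fin n) | ⌊(y i - a i) / s⌋ = m i} := by
    ext y; simp [gridCube]
  rw [this]
  refine MeasurableSet.iInter fun i => ?_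
  have h : Measurable fun y : EuclideanSpace ℝ (Fin n) => ⌊(y i - a i) / s⌋ :=
    Int.measurable_floor.comp (by fun_prop)
  exact h (measurableSet_singleton _)

theorem abs_sub_gridCenter_le {a : EuclideanSpace ℝ (Fin n)} {s : ℝ} (hs : 0 < s) {m : Fin n → ℤ}
    {y : EuclideanSpace ℝ (Fin n)} (hy : y ∈ gridCube a s m) (i : Fin n) :
    |y i - gridCenter a s m i| ≤ s / 2 := by
  have := (mem_gridCube_iff_le hs).1 hy i
  simp only [gridCenter]
  rw [abs_le]
  constructor <;> linarith [this.1, this.2]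

theorem cube_subset_gridCube (a : EuclideanSpace ℝ (Fin n)) {s : ℝ} (hs : 0 < s)
    (m : Fin n → ℤ) : cube (gridCenter a s m) (s / 2) ⊆ gridCube a s m := by
  intro y hy
  rw [mem_gridCube_iff_le hs]
  intro i
  have := abs_lt.1 (hy i)
  simp only [gridCenter] at this
  constructor <;> linarith [this.1, this.2]

theorem volume_gridCube (a : EuclideanSpace ℝ (Fin n)) {s : ℝ} (hs : 0 < s) (m : Fin n → ℤ) :
    volume (gridCube a s m) = ENNReal.ofReal (s ^ n) := by
  have hsub : gridCube a s m ⊆ WithLp.ofLp ⁻¹'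
      Metric.closedBall (WithLp.ofLp (gridCenter a s m)) (s / 2) := by
    intro y hy
    rw [Set.mem_preimage, Metric.mem_closedBall, dist_pi_le_iff (by positivity)]
    exact fun i => by simpa [Real.dist_eq] using abs_sub_gridCenter_le hs hy i
  apply le_antisymm
  · refine (measure_mono hsub).trans ?_
    rw [(PiLp.volume_preserving_ofLp (Fin n)).measure_preimage
      measurableSet_closedBall.nullMeasurableSet, Real.volume_pi_closedBall _ (by positivity)]
    simp [mul_div_cancel₀]
  · refine le_trans ?_ (measure_mono (cube_subset_gridCube a hs m))
    rw [volume_cube _ (by positivity), mul_div_cancel₀ _ two_ne_zero]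

/-- Half-open cubes are needed to tile space exactly, open ones for the maximal function and BMO;
since they agree up to null sets, averages pass freely from one kind to the other. -/
theorem gridCube_ae_eq_cube (a : EuclideanSpace ℝ (Fin n)) {s : ℝ} (hs : 0 < s) (m : Fin n → ℤ) :
    gridCube a s m =ᵐ[volume] cube (gridCenter a s m) (s / 2) := by
  refine (ae_eq_of_subset_of_measure_ge (cube_subset_gridCube a hs m) ?_
      (measurableSet_cube _ _).nullMeasurableSet ?_).symm
  · rw [volume_gridCube a hs, volume_cube _ (by positivity), mul_div_cancel₀ _ two_ne_zero]
  · rw [volume_gridCube a hs]; simp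

theorem volume_gridCube_ne_zero (a : EuclideanSpace ℝ (Fin n)) {s : ℝ} (hs : 0 < s)
    (m : Fin n → ℤ) : volume (gridCube a s m) ≠ 0 := by
  rw [volume_gridCube a hs]; simp; positivity

theorem volume_gridCube_ne_top (a : EuclideanSpace ℝ (Fin n)) {s : ℝ} (hs : 0 < s)
    (m : Fin n → ℤ) : volume (gridCube a s m) ≠ ∞ := by
  rw [volume_gridCube a hs]; simp

theorem gridCube_nonempty (a : EuclideanSpace ℝ (Fin n)) {s : ℝ} (hs : 0 < s) (m : Fin n → ℤ) :
    (gridCube a s m).Nonempty :=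
  ⟨_, cube_subset_gridCube a hs m (mem_cube_self _ (by positivity))⟩

theorem gridIndex_half {a : EuclideanSpace ℝ (Fin n)} {s : ℝ} (x : EuclideanSpace ℝ (Fin n)) :
    gridIndex a s x = fun i => gridIndex a (s / 2) x i / 2 := by
  funext i
  simp only [gridIndex]
  have h : (x i - a i) / (s / 2) = (x i - a i) / s * ((2 : ℕ) : ℝ) := by
    push_cast; rw [div_div_eq_mul_div, mul_div_right_comm]
  rw [h]
  exact (Int.mul_natCast_floor_div_cancel two_ne_zero _).symm

/-- Nestedness of dyadic cubes: the coarser index is the finer one divided by 2 in the integers, so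
it is determined by it. -/
theorem gridIndex_coarser {a : EuclideanSpace ℝ (Fin n)} {s : ℝ} {j k : ℕ} (hjk : j ≤ k)
    {x y : EuclideanSpace ℝ (Fin n)} (h : gridIndex a (s / 2 ^ k) x = gridIndex a (s / 2 ^ k) y) :
    gridIndex a (s / 2 ^ j) x = gridIndex a (s / 2 ^ j) y := by
  induction k, hjk using Nat.le_induction with
  | base => exact h
  | succ k _ ih =>
    refine ih ?_
    have e : s / 2 ^ (k + 1) = s / 2 ^ k / 2 := by rw [pow_succ, div_div]
    rw [e] at h
    rw [gridIndex_half x, gridIndex_half y, h]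

/-- Calderón–Zygmund stopping cubes: if all averages of `|v|` over the top-level cubes of a dyadic
grid are at most `t`, the maximal cubes over which the average exceeds `t` are disjoint, the
averages over them are at most `2 ^ n * t`, and `|v| ≤ t` almost everywhere off their union. -/
theorem exists_stopping_cubes {v : EuclideanSpace ℝ (Fin n) → ℝ} (hv : LocallyIntegrable v)
    (a : EuclideanSpace ℝ (Fin n)) {s : ℝ} (hs : 0 < s) (t : ℝ≥0∞)
    (htop : ∀ m, ∫⁻ y in gridCube a s m, ‖v y‖ₑ ≤ t * volume (gridCube a s m)) :
    ∃ S : Set (ℕ × (Fin n → ℤ)),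
      S.PairwiseDisjoint (fun q => gridCube a (s / 2 ^ q.1) q.2) ∧
      (∀ q ∈ S, t * volume (gridCube a (s / 2 ^ q.1) q.2) <
        ∫⁻ y in gridCube a (s / 2 ^ q.1) q.2, ‖v y‖ₑ) ∧
      (∀ q ∈ S, ∫⁻ y in gridCube a (s / 2 ^ q.1) q.2, ‖v y‖ₑ ≤
        2 ^ n * t * volume (gridCube a (s / 2 ^ q.1) q.2)) ∧
      ∀ᵐ x, x ∉ ⋃ q ∈ S, gridCube a (s / 2 ^ q.1) q.2 → ‖v x‖ₑ ≤ t := by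
  have hsk : ∀ k : ℕ, 0 < s / 2 ^ k := fun k => by positivity
  let good : ℕ → (Fin n → ℤ) → Prop := fun k m =>
    ∫⁻ y in gridCube a (s / 2 ^ k) m, ‖v y‖ₑ ≤ t * volume (gridCube a (s / 2 ^ k) m)
  -- Maximal bad cubes: bad, with every strict ancestor good. The ancestor of generation `j` is
  -- addressed through an arbitrary point of the cube.
  let S : Set (ℕ × (Fin n → ℤ)) := {q | ¬ good q.1 q.2 ∧
    ∀ j < q.1, ∀ x ∈ gridCube a (s / 2 ^ q.1) q.2, good j (gridIndex a (s / 2 ^ j) x)}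
  refine ⟨S, ?_, fun q hq => not_le.1 hq.1, ?_, ?_⟩
  · rintro ⟨k, m⟩ hq ⟨k', m'⟩ hq' hne
    rw [Function.onFun, Set.disjoint_left]
    intro x hx hx'
    simp only at hx hx'
    rw [mem_gridCube_iff] at hx hx'
    rcases lt_trichotomy k k' with h | h | h
    · have := hq'.2 k h x (mem_gridCube_iff.2 hx')
      rw [hx] at this
      exact hq.1 this
    · subst h
      exact hne (by rw [← hx, ← hx'])
    · have := hq.2 k' h x (mem_gridCube_iff.2 hx)
      rw [hx'] at this
      exact hq'.1 this
  · rintro ⟨k, m⟩ hq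
    -- Generation 0 cannot occur because `htop` makes all top cubes good; every other stopping cube
    -- has a good parent, whose measure is `2 ^ n` times larger.
    rcases k with _ | k
    · refine absurd ?_ hq.1
      simp only [good, pow_zero, div_one]
      exact htop m
    · obtain ⟨x, hx⟩ := gridCube_nonempty a (hsk (k + 1)) m
      have h1 := hq.2 k (Nat.lt_succ_self k) x hx
      have hsub : gridCube a (s / 2 ^ (k + 1)) m ⊆
          gridCube a (s / 2 ^ k) (gridIndex a (s / 2 ^ k) x) := by
        intro y hy
        rw [mem_gridCube_iff] at hy hx ⊢
        exact gridIndex_coarser (Nat.le_succ k) (hy.trans hx.symm)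
      refine (lintegral_mono_set hsub).trans (h1.trans ?_)
      rw [volume_gridCube a (hsk k), volume_gridCube a (hsk (k + 1))]
      have e : s / 2 ^ k = 2 * (s / 2 ^ (k + 1)) := by field_simp; ring
      rw [e, mul_pow, ENNReal.ofReal_mul (by positivity), ENNReal.ofReal_pow (by norm_num)]
      simp only [ENNReal.ofReal_ofNat]
      rw [← mul_assoc, mul_comm t]
  · have hr0 : Tendsto (fun k : ℕ => s / 2 ^ k / 2) atTop (𝓝 0) := by
      have h2 : Tendsto (fun k : ℕ => s / 2 * (1 / 2 : ℝ) ^ k) atTop (𝓝 0) := by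
        simpa using (tendsto_pow_atTop_nhds_zero_of_lt_one (by norm_num : (0 : ℝ) ≤ 1 / 2)
          (by norm_num)).const_mul (s / 2)
      refine h2.congr fun k => ?_
      rw [one_div, inv_pow]; field_simp
    filter_upwards [ae_tendsto_cube_average hv] with x hx hxS
    -- A first bad cube around `x` would be a stopping cube, and `x` lies in none.
    have hgood : ∀ k, good k (gridIndex a (s / 2 ^ k) x) := by
      intro k
      induction k using Nat.strong_induction_on with
      | _ k ih =>
        by_contra hbad
        refine hxS (Set.mem_iUnion₂.2 ⟨(k, gridIndex a (s / 2 ^ k) x), ⟨hbad, ?_⟩,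
          mem_gridCube_gridIndex _ _ _⟩)
        intro j hj y hy
        have := gridIndex_coarser hj.le (mem_gridCube_iff.1 hy)
        rw [this]
        exact ih j hj
    have hlim := hx (fun k => gridCenter a (s / 2 ^ k) (gridIndex a (s / 2 ^ k) x))
      (fun k => s / 2 ^ k / 2) (fun k => by have := hsk k; positivity) hr0
      (fun k i => abs_sub_gridCenter_le (hsk k) (mem_gridCube_gridIndex _ _ _) i)
    refine le_of_tendsto' hlim fun k => ?_
    have h1 := hgood k
    simp only [good] at h1
    rw [← setLIntegral_congr (gridCube_ae_eq_cube a (hsk k) _),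
      ← measure_congr (gridCube_ae_eq_cube a (hsk k) _)]
    have h0 := volume_gridCube_ne_zero a (hsk k) (gridIndex a (s / 2 ^ k) x)
    have hT := volume_gridCube_ne_top a (hsk k) (gridIndex a (s / 2 ^ k) x)
    calc _ ≤ (volume (gridCube a (s / 2 ^ k) (gridIndex a (s / 2 ^ k) x)))⁻¹ *
          (t * volume (gridCube a (s / 2 ^ k) (gridIndex a (s / 2 ^ k) x))) := by gcongr
      _ = t := by rw [mul_comm t, ← mul_assoc, ENNReal.inv_mul_cancel h0 hT, one_mul]

end Dyadic

/-! ### Weak norms -/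

section WeakNorms

variable {X ε : Type*} [MeasureSpace X] [ENorm ε]

theorem le_weakLpNorm {p : ℝ} {g : X → ε} (t : ℝ≥0) :
    (t : ℝ≥0∞) * volume {x | (t : ℝ≥0∞) < ‖g x‖ₑ} ^ (1 / p) ≤ weakLpNorm p g :=
  le_iSup (fun t : ℝ≥0 => (t : ℝ≥0∞) * volume {x | (t : ℝ≥0∞) < ‖g x‖ₑ} ^ (1 / p)) t

theorem weakLpNorm_le {p : ℝ} {g : X → ε} {B : ℝ≥0∞}
    (h : ∀ t : ℝ≥0, t ≠ 0 → (t : ℝ≥0∞) * volume {x | (t : ℝ≥0∞) < ‖g x‖ₑ} ^ (1 / p) ≤ B) :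
    weakLpNorm p g ≤ B := by
  refine iSup_le fun t => ?_
  rcases eq_or_ne t 0 with rfl | ht
  · simp
  · exact h t ht

theorem weakOpNorm_le {D : Set (X → ℝ)} {S : (X → ℝ) → X → ε} {p : ℝ} {C : ℝ≥0∞}
    (h : ∀ f ∈ D, MemLp f (ENNReal.ofReal p) →
      weakLpNorm p (S f) ≤ C * eLpNorm f (ENNReal.ofReal p)) : weakOpNorm D S p ≤ C :=
  sInf_le h

/-- Testing on a single function; an upper bound `N` for its norm is enough, which spares computing
`L^p` norms of the examples. -/
theorem le_weakOpNorm {D : Set (X → ℝ)} {S : (X → ℝ) → X → ε} {p : ℝ} {B N : ℝ≥0∞}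
    {f : X → ℝ} (hfD : f ∈ D) (hf : MemLp f (ENNReal.ofReal p)) (hN0 : N ≠ 0) (hN : N ≠ ∞)
    (hfN : eLpNorm f (ENNReal.ofReal p) ≤ N) (h : B * N ≤ weakLpNorm p (S f)) :
    B ≤ weakOpNorm D S p := by
  refine le_sInf fun C hC => ?_
  have h1 : B * N ≤ C * N := h.trans ((hC f hfD hf).trans (by gcongr))
  exact (ENNReal.mul_le_mul_iff_left hN0 hN).1 h1

end WeakNorms

/-- Jensen's inequality for powers, without normalisation. -/
theorem lintegral_rpow_le_measure_rpow_mul {X : Type*} [MeasurableSpace X] {μ : Measure X}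
    {g : X → ℝ≥0∞} (hg : AEMeasurable g μ) {p : ℝ} (hp : 1 ≤ p) :
    (∫⁻ x, g x ∂μ) ^ p ≤ μ Set.univ ^ (p - 1) * ∫⁻ x, g x ^ p ∂μ := by
  rcases eq_or_lt_of_le hp with rfl | hp
  · simp
  have hpq : p.HolderConjugate (p / (p - 1)) := Real.HolderConjugate.conjExponent hp
  have h := ENNReal.lintegral_mul_le_Lp_mul_Lq μ hpq hg (aemeasurable_const (b := (1 : ℝ≥0∞)))
  simp only [Pi.mul_apply, mul_one, ENNReal.one_rpow, lintegral_one] at h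
  have h2 := ENNReal.rpow_le_rpow h (by linarith : 0 ≤ p)
  refine h2.trans (le_of_eq ?_)
  rw [ENNReal.mul_rpow_of_nonneg _ _ (by linarith), ← ENNReal.rpow_mul, ← ENNReal.rpow_mul,
    mul_comm]
  congr 2
  · have : p ≠ 0 := by linarith
    have : p - 1 ≠ 0 := by linarith
    field_simp
  · rw [one_div, inv_mul_cancel₀ (by linarith), ENNReal.rpow_one]

/-! ### The maximal operator and its iterates: upper and lower bounds. -/

section Maximal

variable {n : ℕ}

theorem average_le_maximalOp (g : EuclideanSpace ℝ (Fin n) → ℝ≥0∞)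
    {c x : EuclideanSpace ℝ (Fin n)} {r : ℝ} (hr : 0 < r) (hx : x ∈ cube c r) :
    (volume (cube c r))⁻¹ * ∫⁻ y in cube c r, g y ≤ maximalOp g x :=
  le_iSup_of_le c <| le_iSup_of_le r <| le_iSup_of_le hr <| le_iSup_of_le hx le_rfl

theorem setLIntegral_le_volume_mul_maximalOp (g : EuclideanSpace ℝ (Fin n) → ℝ≥0∞)
    {c x : EuclideanSpace ℝ (Fin n)} {r : ℝ} (hr : 0 < r) (hx : x ∈ cube c r) :
    ∫⁻ y in cube c r, g y ≤ volume (cube c r) * maximalOp g x := by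
  refine le_trans ?_ (mul_le_mul_right (average_le_maximalOp g hr hx) _)
  rw [← mul_assoc, ENNReal.mul_inv_cancel (volume_cube_ne_zero c hr) (volume_cube_ne_top c hr),
    one_mul]

theorem lt_maximalOp_iff {g : EuclideanSpace ℝ (Fin n) → ℝ≥0∞} {t : ℝ≥0∞}
    {x : EuclideanSpace ℝ (Fin n)} :
    t < maximalOp g x ↔ ∃ c r, 0 < r ∧ x ∈ cube c r ∧
      t * volume (cube c r) < ∫⁻ y in cube c r, g y := by
  simp only [maximalOp, lt_iSup_iff]
  refine exists_congr fun c => exists_congr fun r => ?_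
  constructor
  · rintro ⟨hr, hx, h⟩
    refine ⟨hr, hx, ?_⟩
    rw [mul_comm, ← div_eq_mul_inv] at h
    rwa [ENNReal.lt_div_iff_mul_lt (Or.inl (volume_cube_ne_zero c hr))
      (Or.inl (volume_cube_ne_top c hr))] at h
  · rintro ⟨hr, hx, h⟩
    refine ⟨hr, hx, ?_⟩
    rw [mul_comm, ← div_eq_mul_inv]
    rwa [ENNReal.lt_div_iff_mul_lt (Or.inl (volume_cube_ne_zero c hr))
      (Or.inl (volume_cube_ne_top c hr))]

theorem isOpen_lt_maximalOp (g : EuclideanSpace ℝ (Fin n) → ℝ≥0∞) (t : ℝ≥0∞) :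
    IsOpen {x | t < maximalOp g x} := by
  refine isOpen_iff_forall_mem_open.2 fun x hx => ?_
  obtain ⟨c, r, hr, hxc, h⟩ := lt_maximalOp_iff.1 hx
  exact ⟨cube c r, fun y hy => lt_maximalOp_iff.2 ⟨c, r, hr, hy, h⟩, isOpen_cube c r, hxc⟩

theorem measurable_maximalOp (g : EuclideanSpace ℝ (Fin n) → ℝ≥0∞) : Measurable (maximalOp g) :=
  measurable_of_Ioi fun t => (isOpen_lt_maximalOp g t).measurableSet

theorem maximalOp_congr {g h : EuclideanSpace ℝ (Fin n) → ℝ≥0∞} (hgh : g =ᵐ[volume] h) :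
    maximalOp g = maximalOp h := by
  funext x
  unfold maximalOp
  refine iSup_congr fun c => iSup_congr fun r => iSup_congr fun _ => iSup_congr fun _ => ?_
  rw [lintegral_congr_ae (ae_restrict_of_ae hgh)]

/-- The weak type (1,1) inequality for the maximal operator over cubes. -/
theorem maximalOp_weak_one (hn : 1 ≤ n) (g : EuclideanSpace ℝ (Fin n) → ℝ≥0∞) (t : ℝ≥0∞) :
    t * volume {x | t < maximalOp g x} ≤ 5 ^ n * ∫⁻ x, g x := by
  rcases eq_or_ne t 0 with rfl | ht0
  · simp
  rcases eq_or_ne (∫⁻ x, g x) ∞ with hI | hI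
  · rw [hI, ENNReal.mul_top (by positivity)]; exact le_top
  let A : Set (EuclideanSpace ℝ (Fin n) × ℝ) :=
    {q | 0 < q.2 ∧ t * volume (cube q.1 q.2) < ∫⁻ y in cube q.1 q.2, g y}
  -- Vitali's lemma needs bounded radii. Beyond 1/2 the side `2 * r` exceeds 1, so `r` is at most
  -- the volume, which is controlled by the integral of `g`.
  have hR : ∀ q ∈ A, q.2 ≤ max (1 / 2) ((∫⁻ x, g x) / t).toReal := by
    rintro ⟨c, r⟩ ⟨hr, h⟩
    simp only at hr h ⊢
    by_contra! hlt
    obtain ⟨h1, h2⟩ := max_lt_iff.1 hlt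
    have h3 : ENNReal.ofReal r * t ≤ ∫⁻ x, g x := by
      refine le_trans ?_ (h.le.trans (setLIntegral_le_lintegral _ _))
      rw [volume_cube c hr, mul_comm]
      gcongr
      calc r ≤ 2 * r := by linarith
        _ ≤ (2 * r) ^ n := le_self_pow₀ (by linarith) (by omega)
    have h4 := ENNReal.le_div_iff_mul_le (Or.inl ht0) (Or.inr hI) |>.2 h3
    have h5 : r ≤ ((∫⁻ x, g x) / t).toReal := by
      rw [← ENNReal.ofReal_le_iff_le_toReal (ENNReal.div_ne_top hI ht0)]
      exact h4
    linarith
  -- With comparison factor 2, each cube lies in the dilate of a selected one by 1 + 2·2 = 5.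
  obtain ⟨u, huA, hdisj, hcov⟩ := Vitali.exists_disjoint_subfamily_covering_enlargement
    (fun q : EuclideanSpace ℝ (Fin n) × ℝ => cube q.1 q.2) A (fun q => q.2) 2 (by norm_num)
    (fun q hq => hq.1.le) _ hR (fun q hq => ⟨q.1, mem_cube_self _ hq.1⟩)
  have hucount : u.Countable := hdisj.countable_of_isOpen (fun q _ => isOpen_cube _ _)
    (fun q hq => ⟨q.1, mem_cube_self _ (huA hq).1⟩)
  have hsub : {x | t < maximalOp g x} ⊆ ⋃ q ∈ u, cube q.1 (5 * q.2) := by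
    intro x hx
    obtain ⟨c, r, hr, hxc, h⟩ := lt_maximalOp_iff.1 hx
    obtain ⟨q, hq, ⟨z, hz1, hz2⟩, hle⟩ := hcov (c, r) ⟨hr, h⟩
    refine Set.mem_iUnion₂.2 ⟨q, hq, fun i => ?_⟩
    have a1 := hxc i
    have a2 := hz1 i
    have a3 := hz2 i
    simp only at a2 a3 hle
    rw [abs_lt] at *
    constructor <;> linarith [a1.1, a1.2, a2.1, a2.2, a3.1, a3.2]
  have := hucount.to_subtype
  calc t * volume {x | t < maximalOp g x}
      ≤ t * ∑' q : u, volume (cube q.1.1 (5 * q.1.2)) := by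
        gcongr
        refine (measure_mono hsub).trans ?_
        exact measure_biUnion_le _ hucount _
    _ = 5 ^ n * ∑' q : u, t * volume (cube q.1.1 q.1.2) := by
        rw [← ENNReal.tsum_mul_left, ← ENNReal.tsum_mul_left]
        refine tsum_congr fun q => ?_
        have h0 := (huA q.2).1
        rw [volume_cube _ (by positivity), volume_cube _ h0, show 2 * (5 * q.1.2) = 5 * (2 * q.1.2) by
          ring, mul_pow, ENNReal.ofReal_mul (by positivity), ENNReal.ofReal_pow (by norm_num)]
        simp only [ENNReal.ofReal_ofNat]
        ring
    _ ≤ 5 ^ n * ∑' q : u, ∫⁻ y in cube q.1.1 q.1.2, g y := by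
        gcongr with q
        exact (huA q.2).2.le
    _ = 5 ^ n * ∫⁻ y in ⋃ q ∈ u, cube q.1 q.2, g y := by
        rw [lintegral_biUnion hucount (fun q _ => measurableSet_cube _ _) hdisj]
    _ ≤ 5 ^ n * ∫⁻ x, g x := by
        gcongr
        exact Measure.restrict_le_self

theorem maximalOp_rpow_le {g : EuclideanSpace ℝ (Fin n) → ℝ≥0∞} (hg : AEMeasurable g) {p : ℝ}
    (hp : 1 ≤ p) (x : EuclideanSpace ℝ (Fin n)) :
    maximalOp g x ^ p ≤ maximalOp (fun y => g y ^ p) x := by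
  have hp0 : 0 < p := by linarith
  rw [← ENNReal.le_rpow_inv_iff hp0]
  refine iSup_le fun c => iSup_le fun r => iSup_le fun hr => iSup_le fun hx => ?_
  rw [ENNReal.le_rpow_inv_iff hp0]
  refine le_trans ?_ (average_le_maximalOp _ hr hx)
  have h := lintegral_rpow_le_measure_rpow_mul (μ := volume.restrict (cube c r)) hg.restrict hp
  rw [ENNReal.mul_rpow_of_nonneg _ _ hp0.le]
  rw [Measure.restrict_apply_univ] at h
  have h0 := volume_cube_ne_zero c hr
  have hT := volume_cube_ne_top c hr
  calc (volume (cube c r))⁻¹ ^ p * (∫⁻ y in cube c r, g y) ^ p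
      ≤ (volume (cube c r))⁻¹ ^ p *
        (volume (cube c r) ^ (p - 1) * ∫⁻ y in cube c r, g y ^ p) := by gcongr
    _ = (volume (cube c r))⁻¹ * ∫⁻ y in cube c r, g y ^ p := by
      rw [← mul_assoc, ENNReal.inv_rpow, ← ENNReal.rpow_neg, ← ENNReal.rpow_add _ _ h0 hT,
        ← ENNReal.rpow_neg_one]
      congr 2
      ring

/-- By Jensen on each cube, (Mg)^p ≤ M(g^p), so the weak (1, 1) inequality for g^p applies. The
constant does not deteriorate as p → 1, unlike that of the strong type. -/
theorem maximalOp_weak (hn : 1 ≤ n) {g : EuclideanSpace ℝ (Fin n) → ℝ≥0∞} (hg : AEMeasurable g)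
    {p : ℝ} (hp : 1 ≤ p) (t : ℝ≥0∞) :
    t ^ p * volume {x | t < maximalOp g x} ≤ 5 ^ n * ∫⁻ x, g x ^ p := by
  refine le_trans ?_ (maximalOp_weak_one hn (fun x => g x ^ p) (t ^ p))
  refine mul_le_mul_right (measure_mono fun x h => ?_) _
  exact (ENNReal.rpow_lt_rpow h (by linarith)).trans_le (maximalOp_rpow_le hg hp x)

theorem weakLpNorm_maximalOp_le (hn : 1 ≤ n) {g : EuclideanSpace ℝ (Fin n) → ℝ≥0∞}
    (hg : AEMeasurable g) {p : ℝ} (hp : 1 ≤ p) :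
    weakLpNorm p (maximalOp g) ≤ 5 ^ n * (∫⁻ x, g x ^ p) ^ (1 / p) := by
  have hp0 : 0 < p := by linarith
  refine weakLpNorm_le fun t _ => ?_
  have h := ENNReal.rpow_le_rpow (maximalOp_weak hn hg hp t) (by positivity : 0 ≤ 1 / p)
  rw [ENNReal.mul_rpow_of_nonneg _ _ (by positivity), ENNReal.mul_rpow_of_nonneg _ _ (by positivity),
    ← ENNReal.rpow_mul, mul_one_div_cancel hp0.ne', ENNReal.rpow_one] at h
  refine h.trans ?_
  gcongr
  calc ((5 : ℝ≥0∞) ^ n) ^ (1 / p) ≤ (5 ^ n) ^ (1 : ℝ) := by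
        apply ENNReal.rpow_le_rpow_of_exponent_le
        · exact one_le_pow₀ (by norm_num)
        · rw [div_le_one hp0]; exact hp
    _ = 5 ^ n := ENNReal.rpow_one _

/-- Values of `g` below `t` contribute at most `t` to any average, so an average above `2 * t`
leaves more than `t` for the truncation from below. -/
theorem maximalOp_weak_truncated (hn : 1 ≤ n) {g : EuclideanSpace ℝ (Fin n) → ℝ≥0∞} {t : ℝ≥0∞} :
    t * volume {x | 2 * t < maximalOp g x} ≤ 5 ^ n * ∫⁻ x, {x | t < g x}.indicator g x := by
  refine le_trans ?_ (maximalOp_weak_one hn _ t)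
  refine mul_le_mul_right (measure_mono fun x h => ?_) _
  obtain ⟨c, r, hr, hx, h⟩ := lt_maximalOp_iff.1 h
  refine lt_maximalOp_iff.2 ⟨c, r, hr, hx, ?_⟩
  have h1 : ∫⁻ y in cube c r, g y ≤
      (∫⁻ y in cube c r, {x | t < g x}.indicator g y) + t * volume (cube c r) := by
    rw [← setLIntegral_const, ← lintegral_add_right _ measurable_const]
    gcongr with y
    by_cases hy : t < g y
    · rw [Set.indicator_of_mem (by exact hy)]; exact le_self_add
    · exact (not_lt.1 hy).trans le_add_self
  rw [two_mul, add_mul] at h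
  by_contra! hcon
  exact absurd (h.trans_le (h1.trans (add_le_add_left hcon _))) (lt_irrefl _)

theorem setLIntegral_Ioo_rpow {a p : ℝ} (ha : 0 ≤ a) (hp : 1 < p) :
    ∫⁻ t in Set.Ioo 0 a, ENNReal.ofReal (t ^ (p - 2)) = ENNReal.ofReal (a ^ (p - 1) / (p - 1)) := by
  have hi : IntervalIntegrable (fun t : ℝ => t ^ (p - 2)) volume 0 a :=
    intervalIntegral.intervalIntegrable_rpow' (by linarith)
  rw [intervalIntegrable_iff_integrableOn_Ioo_of_le ha] at hi
  rw [← ofReal_integral_eq_lintegral_ofReal hi]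
  · rw [← integral_Ioc_eq_integral_Ioo, ← intervalIntegral.integral_of_le ha,
      integral_rpow (Or.inl (by linarith)), Real.zero_rpow (by linarith)]
    congr 2
    · rw [sub_zero]; congr 1; ring
    · ring
  · filter_upwards [ae_restrict_mem measurableSet_Ioo] with t ht
    exact Real.rpow_nonneg ht.1.le _

/-- The strong type inequality for the maximal operator, with the sharp growth as `p → 1`. -/
theorem lintegral_maximalOp_rpow_le (hn : 1 ≤ n) {g : EuclideanSpace ℝ (Fin n) → ℝ≥0∞}
    (hg : Measurable g) {p : ℝ} (hp : 1 < p) (hgp : ∫⁻ x, g x ^ p ≠ ∞) :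
    ∫⁻ x, maximalOp g x ^ p ≤
      ENNReal.ofReal (2 * 5 ^ n * 2 ^ (p - 1) * (p / (p - 1))) * ∫⁻ x, g x ^ p := by
  have hp0 : 0 < p := by linarith
  have hM := measurable_maximalOp g
  -- Finiteness lets the layer cake formula be used for the real-valued version of `maximalOp g`.
  have hfin : ∀ᵐ x, maximalOp g x ≠ ∞ := by
    have h1 : ∀ k : ℕ, (k : ℝ≥0∞) ^ p * volume {x | maximalOp g x = ∞} ≤ 5 ^ n * ∫⁻ x, g x ^ p := by
      intro k
      refine le_trans ?_ (maximalOp_weak hn hg.aemeasurable hp.le (k : ℝ≥0∞))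
      refine mul_le_mul_right (measure_mono fun x h => ?_) _
      rw [Set.mem_ofPred_eq] at h ⊢
      rw [h]; exact ENNReal.natCast_lt_top k
    have hB : 5 ^ n * ∫⁻ x, g x ^ p ≠ ∞ := ENNReal.mul_ne_top (by finiteness) hgp
    by_contra hne
    have hpos : volume {x | maximalOp g x = ∞} ≠ 0 := by
      intro h0
      apply hne
      rw [ae_iff]
      simpa using h0
    have h2 : Tendsto (fun k : ℕ => (k : ℝ≥0∞) ^ p * volume {x | maximalOp g x = ∞}) atTop
        (𝓝 (∞ ^ p * volume {x | maximalOp g x = ∞})) := by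
      refine ENNReal.Tendsto.mul_const ?_ (Or.inl ?_)
      · exact (ENNReal.continuous_rpow_const.tendsto _).comp ENNReal.tendsto_nat_nhds_top
      · rw [ENNReal.top_rpow_of_pos hp0]; exact ENNReal.top_ne_zero
    have h3 := le_of_tendsto' h2 h1
    rw [ENNReal.top_rpow_of_pos hp0, ENNReal.top_mul hpos] at h3
    exact hB (top_le_iff.1 h3)
  have e1 : ∫⁻ x, maximalOp g x ^ p = ∫⁻ x, ENNReal.ofReal ((maximalOp g x).toReal ^ p) := by
    refine lintegral_congr_ae (hfin.mono fun x hx => ?_)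
    simp only
    rw [← ENNReal.ofReal_rpow_of_nonneg ENNReal.toReal_nonneg hp0.le, ENNReal.ofReal_toReal hx]
  rw [e1, lintegral_rpow_eq_lintegral_meas_lt_mul volume
    (Eventually.of_forall fun x => ENNReal.toReal_nonneg) hM.ennreal_toReal.aemeasurable hp0]
  have hbd : ∀ t ∈ Set.Ioi (0 : ℝ), volume {x | t < (maximalOp g x).toReal} *
      ENNReal.ofReal (t ^ (p - 1)) ≤ 2 * 5 ^ n * ∫⁻ x,
        (ENNReal.ofReal (t ^ (p - 2)) * {x | ENNReal.ofReal (t / 2) < g x}.indicator g x) := by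
    intro t ht
    have ht0 : 0 < t := ht
    have h1 := maximalOp_weak_truncated hn (g := g) (t := ENNReal.ofReal (t / 2))
    have h2 : volume {x | t < (maximalOp g x).toReal} ≤
        volume {x | 2 * ENNReal.ofReal (t / 2) < maximalOp g x} := by
      refine measure_mono fun x hx => ?_
      rw [Set.mem_ofPred_eq] at hx ⊢
      rw [show (2 : ℝ≥0∞) = ENNReal.ofReal 2 by simp, ← ENNReal.ofReal_mul (by norm_num),
        mul_div_cancel₀ _ two_ne_zero]
      exact (ENNReal.ofReal_lt_iff_lt_toReal ht0.le
        (fun h => by rw [h] at hx; simp at hx; linarith)).2 hx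
    -- One factor `t / 2` is split off, to be consumed by the weak type inequality at that height.
    have h3 : ENNReal.ofReal (t ^ (p - 1)) =
        2 * ENNReal.ofReal (t ^ (p - 2)) * ENNReal.ofReal (t / 2) := by
      rw [show (2 : ℝ≥0∞) = ENNReal.ofReal 2 by simp, ← ENNReal.ofReal_mul (by norm_num),
        ← ENNReal.ofReal_mul (by positivity)]
      congr 1
      rw [show p - 1 = p - 2 + 1 by ring, Real.rpow_add_one ht0.ne']
      ring
    rw [lintegral_const_mul' _ _ ENNReal.ofReal_ne_top, h3]
    calc _ ≤ volume {x | 2 * ENNReal.ofReal (t / 2) < maximalOp g x} *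
          (2 * ENNReal.ofReal (t ^ (p - 2)) * ENNReal.ofReal (t / 2)) := by gcongr
      _ = 2 * ENNReal.ofReal (t ^ (p - 2)) * (ENNReal.ofReal (t / 2) *
          volume {x | 2 * ENNReal.ofReal (t / 2) < maximalOp g x}) := by ring
      _ ≤ 2 * ENNReal.ofReal (t ^ (p - 2)) * _ := mul_le_mul_right h1 _
      _ = _ := by ring
  have hmeas : Measurable (Function.uncurry fun (t : ℝ) (x : EuclideanSpace ℝ (Fin n)) =>
      ENNReal.ofReal (t ^ (p - 2)) * {x | ENNReal.ofReal (t / 2) < g x}.indicator g x) := by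
    have e : (Function.uncurry fun (t : ℝ) (x : EuclideanSpace ℝ (Fin n)) =>
      ENNReal.ofReal (t ^ (p - 2)) * {x | ENNReal.ofReal (t / 2) < g x}.indicator g x) =
      fun z : ℝ × EuclideanSpace ℝ (Fin n) => ENNReal.ofReal (z.1 ^ (p - 2)) *
        {z : ℝ × EuclideanSpace ℝ (Fin n) | ENNReal.ofReal (z.1 / 2) < g z.2}.indicator
          (fun z => g z.2) z := by
      funext z; rfl
    rw [e]
    refine Measurable.mul (by fun_prop) (Measurable.indicator (by fun_prop) ?_)
    exact measurableSet_lt (by fun_prop) (by fun_prop)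
  calc _ ≤ ENNReal.ofReal p * ∫⁻ t in Set.Ioi (0 : ℝ), 2 * 5 ^ n * ∫⁻ x,
        (ENNReal.ofReal (t ^ (p - 2)) * {x | ENNReal.ofReal (t / 2) < g x}.indicator g x) := by
        gcongr 1
        exact setLIntegral_mono' measurableSet_Ioi hbd
    _ = ENNReal.ofReal p * (2 * 5 ^ n * ∫⁻ x, ∫⁻ t in Set.Ioi (0 : ℝ),
        (ENNReal.ofReal (t ^ (p - 2)) * {x | ENNReal.ofReal (t / 2) < g x}.indicator g x)) := by
        rw [lintegral_const_mul' _ _ (by finiteness), lintegral_lintegral_swap hmeas.aemeasurable]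
    -- For fixed `x` only `0 < t < 2 g(x)` matters; the integral of `t ^ (p - 2)` over that range
    -- produces the factor `1 / (p - 1)`.
    _ ≤ ENNReal.ofReal p * (2 * 5 ^ n * ∫⁻ x, ENNReal.ofReal (2 ^ (p - 1) / (p - 1)) * g x ^ p) := by
        gcongr with x
        have hind : ∀ t : ℝ, ENNReal.ofReal (t ^ (p - 2)) *
            {x | ENNReal.ofReal (t / 2) < g x}.indicator g x =
            {t : ℝ | ENNReal.ofReal (t / 2) < g x}.indicator
              (fun t => ENNReal.ofReal (t ^ (p - 2)) * g x) t := by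
          intro t
          by_cases h : ENNReal.ofReal (t / 2) < g x
          · rw [Set.indicator_of_mem (by exact h), Set.indicator_of_mem (by exact h)]
          · rw [Set.indicator_of_notMem (by exact h), Set.indicator_of_notMem (by exact h), mul_zero]
        have hset : MeasurableSet {t : ℝ | ENNReal.ofReal (t / 2) < g x} :=
          measurableSet_lt (by fun_prop) measurable_const
        simp_rw [hind]
        rw [lintegral_indicator hset, Measure.restrict_restrict hset]
        by_cases hx : g x = ∞
        · rw [hx, ENNReal.top_rpow_of_pos hp0, ENNReal.mul_top]
          · exact le_top
          · simp only [ne_eq, ENNReal.ofReal_eq_zero, not_le]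
            have : 0 < p - 1 := by linarith
            positivity
        · have hs : {t : ℝ | ENNReal.ofReal (t / 2) < g x} ∩ Set.Ioi 0 =
              Set.Ioo 0 (2 * (g x).toReal) := by
            ext t
            simp only [Set.mem_inter_iff, Set.mem_ofPred_eq, Set.mem_Ioi, Set.mem_Ioo]
            constructor
            · rintro ⟨h1, h2⟩
              rw [ENNReal.ofReal_lt_iff_lt_toReal (by positivity) hx] at h1
              exact ⟨h2, by linarith⟩
            · rintro ⟨h1, h2⟩
              rw [ENNReal.ofReal_lt_iff_lt_toReal (by positivity) hx]
              exact ⟨by linarith, h1⟩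
          rw [hs, lintegral_mul_const' _ _ hx, setLIntegral_Ioo_rpow (by positivity) hp]
          refine le_of_eq ?_
          obtain ⟨y, hy⟩ : ∃ y, y = (g x).toReal := ⟨_, rfl⟩
          have hy0 : 0 ≤ y := hy ▸ ENNReal.toReal_nonneg
          have hgy : g x = ENNReal.ofReal y := by rw [hy, ENNReal.ofReal_toReal hx]
          rw [← hy, hgy, ENNReal.ofReal_rpow_of_nonneg hy0 hp0.le,
            ← ENNReal.ofReal_mul' hy0,
            ← ENNReal.ofReal_mul (div_nonneg (by positivity) (by linarith)),
            Real.mul_rpow (by norm_num) hy0]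
          congr 1
          rcases hy0.eq_or_lt with h | h
          · rw [← h, Real.zero_rpow hp0.ne']; simp
          · rw [Real.rpow_sub_one h.ne' p]; field_simp
    _ = _ := by
        rw [lintegral_const_mul' _ _ ENNReal.ofReal_ne_top, ← mul_assoc, ← mul_assoc]
        congr 1
        have : 0 < p - 1 := by linarith
        rw [show (2 : ℝ≥0∞) * 5 ^ n = ENNReal.ofReal (2 * 5 ^ n) by
            rw [ENNReal.ofReal_mul (by norm_num), ENNReal.ofReal_pow (by norm_num)]; simp,
          ← ENNReal.ofReal_mul hp0.le, ← ENNReal.ofReal_mul (by positivity)]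
        congr 1
        ring

/-- The p-th root may be dropped from the constant: `2 ^ (p - 1)` is absorbed by `2 ^ p`, and the
remaining factor is at least 1, hence at most its own p-th power. -/
theorem lintegral_maximalOp_rpow_rpow_le (hn : 1 ≤ n) {g : EuclideanSpace ℝ (Fin n) → ℝ≥0∞}
    (hg : AEMeasurable g) {p : ℝ} (hp : 1 < p) (hgp : ∫⁻ x, g x ^ p ≠ ∞) :
    (∫⁻ x, maximalOp g x ^ p) ^ (1 / p) ≤
      ENNReal.ofReal (4 * 5 ^ n * (p / (p - 1))) * (∫⁻ x, g x ^ p) ^ (1 / p) := by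
  have hp0 : 0 < p := by linarith
  have hp1 : 0 < p - 1 := by linarith
  have hae : (fun x => g x ^ p) =ᵐ[volume] fun x => hg.mk g x ^ p :=
    hg.ae_eq_mk.mono fun x hx => by simp only [hx]
  rw [maximalOp_congr hg.ae_eq_mk, lintegral_congr_ae hae]
  rw [lintegral_congr_ae hae] at hgp
  have h := ENNReal.rpow_le_rpow (lintegral_maximalOp_rpow_le hn hg.measurable_mk hp hgp)
    (by positivity : 0 ≤ 1 / p)
  refine h.trans ?_
  rw [ENNReal.mul_rpow_of_nonneg _ _ (by positivity)]
  gcongr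
  rw [one_div, ENNReal.rpow_inv_le_iff hp0, ENNReal.ofReal_rpow_of_nonneg (by positivity) hp0.le]
  apply ENNReal.ofReal_le_ofReal
  have hq : 1 ≤ p / (p - 1) := by rw [le_div_iff₀ hp1]; linarith
  have h5 : (1 : ℝ) ≤ 5 ^ n := one_le_pow₀ (by norm_num)
  rw [show 4 * 5 ^ n * (p / (p - 1)) = 2 * (2 * 5 ^ n * (p / (p - 1))) by ring,
    Real.mul_rpow (by norm_num) (by positivity)]
  calc 2 * 5 ^ n * 2 ^ (p - 1) * (p / (p - 1)) = 2 ^ (p - 1) * (2 * 5 ^ n * (p / (p - 1))) := by ring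
    _ ≤ 2 ^ p * (2 * 5 ^ n * (p / (p - 1))) ^ p := by
      gcongr
      · norm_num
      · linarith
      · exact Real.self_le_rpow_of_one_le (by nlinarith) hp.le

theorem aemeasurable_iterMaximal (k : ℕ) {f : EuclideanSpace ℝ (Fin n) → ℝ}
    (hf : AEStronglyMeasurable f) : AEMeasurable (iterMaximal k f) := by
  cases k with
  | zero => exact hf.enorm
  | succ k =>
    rw [iterMaximal, Function.iterate_succ_apply']
    exact (measurable_maximalOp _).aemeasurable

theorem lintegral_iterMaximal_le (hn : 1 ≤ n) (k : ℕ) {f : EuclideanSpace ℝ (Fin n) → ℝ}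
    {p : ℝ} (hp : 1 < p) (hf : MemLp f (ENNReal.ofReal p)) :
    (∫⁻ x, iterMaximal k f x ^ p) ^ (1 / p) ≤
      ENNReal.ofReal (4 * 5 ^ n * (p / (p - 1))) ^ k * eLpNorm f (ENNReal.ofReal p) := by
  have hp0 : 0 < p := by linarith
  induction k with
  | zero =>
    rw [eLpNorm_eq_lintegral_rpow_enorm_toReal (by simpa using hp0) ENNReal.ofReal_ne_top,
      ENNReal.toReal_ofReal hp0.le]
    simp [iterMaximal]
  | succ k ih =>
    have hfin : ∫⁻ x, iterMaximal k f x ^ p ≠ ∞ := by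
      intro h
      rw [h, ENNReal.top_rpow_of_pos (by positivity)] at ih
      exact (ENNReal.mul_ne_top (by finiteness) hf.2.ne) (top_le_iff.1 ih)
    rw [pow_succ', mul_assoc]
    have e : iterMaximal (k + 1) f = maximalOp (iterMaximal k f) := by
      rw [iterMaximal, Function.iterate_succ_apply']; rfl
    rw [e]
    refine (lintegral_maximalOp_rpow_rpow_le hn (aemeasurable_iterMaximal k hf.1) hp hfin).trans ?_
    gcongr

/-- The outermost maximal function is estimated in weak type at a cost independent of p; only the `k
- 1` inner ones pay p'. -/
theorem weakOpNorm_iterMaximal_le (hn : 1 ≤ n) {k : ℕ} (hk : 1 ≤ k) {p : ℝ} (hp : 1 < p) :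
    weakOpNorm Set.univ (iterMaximal (n := n) k) p ≤
      ENNReal.ofReal (5 ^ n * (4 * 5 ^ n) ^ (k - 1) * (p / (p - 1)) ^ (k - 1)) := by
  refine weakOpNorm_le fun f _ hf => ?_
  obtain ⟨j, rfl⟩ : ∃ j, k = j + 1 := ⟨k - 1, by omega⟩
  have hp1 : 0 < p - 1 := by linarith
  have e : iterMaximal (j + 1) f = maximalOp (iterMaximal j f) := by
    rw [iterMaximal, Function.iterate_succ_apply']; rfl
  rw [e]
  refine (weakLpNorm_maximalOp_le hn (aemeasurable_iterMaximal j hf.1) hp.le).trans ?_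
  refine (mul_le_mul_right (lintegral_iterMaximal_le hn j hp hf) _).trans (le_of_eq ?_)
  rw [← mul_assoc]
  congr 1
  rw [← ENNReal.ofReal_pow (by positivity), show (5 : ℝ≥0∞) ^ n = ENNReal.ofReal (5 ^ n) by
    rw [ENNReal.ofReal_pow (by norm_num)]; simp, ← ENNReal.ofReal_mul (by positivity)]
  congr 1
  rw [mul_pow, Nat.add_sub_cancel]
  ring

/-- On the shell between two consecutive cubes, the next iterate is at least the average of the
current one over the larger cube. Writing a(j, m) for the integral on the right, this gives a(j+1,
m+1) ≥ a(j+1, m) + 2^(-n) a(j, m+1), which is Pascal's rule up to the powers of 2^(-n). -/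
theorem choose_le_lintegral_iterMaximal (hn : 1 ≤ n) (j m : ℕ) :
    ENNReal.ofReal ((2 ^ n)⁻¹ ^ j * (m.choose j : ℝ)) ≤
      ∫⁻ x in cube (0 : EuclideanSpace ℝ (Fin n)) (2 ^ m),
        iterMaximal j ((cube 0 1).indicator fun _ => 1) x := by
  set f : EuclideanSpace ℝ (Fin n) → ℝ := (cube 0 1).indicator fun _ => 1
  have hiter : ∀ j, iterMaximal (j + 1) f = maximalOp (iterMaximal j f) := fun j => by
    rw [iterMaximal, Function.iterate_succ_apply']; rfl
  induction j generalizing m with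
  | zero =>
    have hsub : cube (0 : EuclideanSpace ℝ (Fin n)) 1 ⊆ cube 0 (2 ^ m) :=
      cube_subset_cube _ (one_le_pow₀ (by norm_num))
    refine le_trans ?_ (lintegral_mono_set hsub)
    have : ∀ x ∈ cube (0 : EuclideanSpace ℝ (Fin n)) 1, iterMaximal 0 f x = 1 := by
      intro x hx
      simp [iterMaximal, f, Set.indicator_of_mem hx]
    rw [setLIntegral_congr_fun (measurableSet_cube _ _) this, setLIntegral_const, one_mul,
      volume_cube _ one_pos]
    apply ENNReal.ofReal_le_ofReal
    simp only [pow_zero, Nat.choose_zero_right, Nat.cast_one, mul_one]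
    exact one_le_pow₀ (by norm_num)
  | succ j ihj =>
    induction m with
    | zero => simp
    | succ m ihm =>
      set I := ∫⁻ x in cube (0 : EuclideanSpace ℝ (Fin n)) (2 ^ (m + 1)), iterMaximal j f x with hI
      have hsub : cube (0 : EuclideanSpace ℝ (Fin n)) (2 ^ m) ⊆ cube 0 (2 ^ (m + 1)) :=
        cube_subset_cube _ (pow_le_pow_right₀ (by norm_num) (by omega))
      have hV : volume (cube (0 : EuclideanSpace ℝ (Fin n)) (2 ^ (m + 1))) =
          ENNReal.ofReal ((2 ^ n) * (2 ^ (m + 1)) ^ n) := by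
        rw [volume_cube _ (by positivity), mul_pow]
      -- The shell carries at least the fraction `2 ^ (-n)` of the larger cube, since `2 ^ n - 1 ≥
      -- 1`; this is where `n ≥ 1` enters.
      have hshell : ENNReal.ofReal ((2 ^ (m + 1)) ^ n) ≤
          volume (cube (0 : EuclideanSpace ℝ (Fin n)) (2 ^ (m + 1)) \ cube 0 (2 ^ m)) := by
        rw [measure_sdiff hsub (measurableSet_cube _ _).nullMeasurableSet
          (volume_cube_ne_top _ (by positivity)), hV, volume_cube _ (by positivity),
          ← ENNReal.ofReal_sub _ (by positivity)]
        apply ENNReal.ofReal_le_ofReal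
        have h2 : (2 : ℝ) ≤ 2 ^ n := by
          calc (2 : ℝ) = 2 ^ 1 := by norm_num
            _ ≤ 2 ^ n := pow_le_pow_right₀ (by norm_num) hn
        have h3 : (2 * 2 ^ m : ℝ) ^ n = (2 ^ (m + 1)) ^ n := by rw [pow_succ']
        rw [h3]
        nlinarith [show (0 : ℝ) < (2 ^ (m + 1)) ^ n by positivity]
      have hpt : ∀ x ∈ cube (0 : EuclideanSpace ℝ (Fin n)) (2 ^ (m + 1)) \ cube 0 (2 ^ m),
          (ENNReal.ofReal ((2 ^ n) * (2 ^ (m + 1)) ^ n))⁻¹ * I ≤ iterMaximal (j + 1) f x := by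
        intro x hx
        rw [hiter, ← hV]
        exact average_le_maximalOp _ (by positivity) hx.1
      have hI2 : ENNReal.ofReal ((2 ^ n)⁻¹) * I ≤
          ∫⁻ x in cube (0 : EuclideanSpace ℝ (Fin n)) (2 ^ (m + 1)) \ cube 0 (2 ^ m),
            iterMaximal (j + 1) f x := by
        refine le_trans ?_ (setLIntegral_mono' ((measurableSet_cube _ _).diff
          (measurableSet_cube _ _)) hpt)
        rw [setLIntegral_const]
        refine le_trans (le_of_eq ?_) (mul_le_mul_right hshell _)
        rw [← ENNReal.ofReal_inv_of_pos (by positivity), mul_right_comm,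
          ← ENNReal.ofReal_mul (by positivity)]
        congr 2
        field_simp
      have hsplit := lintegral_inter_add_sdiff (μ := volume) (iterMaximal (j + 1) f)
        (cube (0 : EuclideanSpace ℝ (Fin n)) (2 ^ (m + 1)))
        (measurableSet_cube (0 : EuclideanSpace ℝ (Fin n)) (2 ^ m))
      rw [Set.inter_eq_self_of_subset_right hsub] at hsplit
      rw [← hsplit]
      refine le_trans ?_ (add_le_add ihm
        (le_trans (mul_le_mul_right (ihj (m + 1)) _) hI2))
      rw [← ENNReal.ofReal_mul (by positivity), ← ENNReal.ofReal_add (by positivity) (by positivity)]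
      apply ENNReal.ofReal_le_ofReal
      rw [Nat.choose_succ_succ' m j]
      have hc : (m.choose j : ℝ) ≤ (m + 1).choose j := by
        exact_mod_cast Nat.choose_le_succ m j
      push_cast
      have hp : (0 : ℝ) ≤ (2 ^ n)⁻¹ ^ (j + 1) := by positivity
      calc (2 ^ n : ℝ)⁻¹ ^ (j + 1) * (m.choose j + m.choose (j + 1))
          ≤ (2 ^ n : ℝ)⁻¹ ^ (j + 1) * ((m + 1).choose j + m.choose (j + 1)) := by gcongr
        _ = _ := by ring

/-- For the indicator of a unit-scale cube, `M^k` is at least c·m^(k-1)·2^(-mn) throughout the cube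
dilated by `2 ^ m`. Its contribution to the weak norm is m^(k-1)·2^(-mn/p') up to constants, and m
comparable to p' balances the two factors. -/
theorem exists_le_weakOpNorm_iterMaximal (hn : 1 ≤ n) {k : ℕ} (hk : 1 ≤ k) :
    ∃ c : ℝ, 0 < c ∧ ∀ p : ℝ, 1 < p → ENNReal.ofReal (c * (p / (p - 1)) ^ (k - 1)) ≤
      weakOpNorm Set.univ (iterMaximal (n := n) k) p := by
  obtain ⟨j, rfl⟩ : ∃ j, k = j + 1 := ⟨k - 1, by omega⟩
  rw [Nat.add_sub_cancel]
  refine ⟨(2 ^ n)⁻¹ * (2⁻¹ * ((2 ^ n)⁻¹ * (2 ^ n)⁻¹ ^ j * (j.factorial : ℝ)⁻¹ *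
    ((2 ^ n)⁻¹ ^ (j + 2)))), by positivity, fun p hp => ?_⟩
  have hp0 : 0 < p := by linarith
  have hp1 : 0 < p - 1 := by linarith
  set q := p / (p - 1) with hq
  have hq1 : 1 ≤ q := by rw [hq, le_div_iff₀ hp1]; linarith
  set f : EuclideanSpace ℝ (Fin n) → ℝ := (cube 0 1).indicator fun _ => 1
  -- The lower bound makes the binomial coefficient at least `q ^ j / j!`; the upper one keeps `m /
  -- q` bounded, so that `2 ^ (-m n / q)` stays away from 0.
  obtain ⟨m, hm1, hm2⟩ : ∃ m : ℕ, q + j ≤ m ∧ (m : ℝ) ≤ (j + 2) * q := by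
    refine ⟨⌈q⌉₊ + j, ?_, ?_⟩
    · push_cast; linarith [Nat.le_ceil q]
    · push_cast
      have := (Nat.ceil_lt_add_one (by linarith : 0 ≤ q)).le
      nlinarith [show (0 : ℝ) ≤ j by positivity]
  have hchoose : q ^ j * (j.factorial : ℝ)⁻¹ ≤ m.choose j := by
    have h1 : ((m + 1 - j : ℕ) : ℝ) ^ j ≤ j.factorial * m.choose j := by
      exact_mod_cast Nat.pow_sub_le_descFactorial m j |>.trans
        (Nat.descFactorial_eq_factorial_mul_choose m j).le
    have hjm : j ≤ m + 1 := by
      have : (j : ℝ) ≤ m := by linarith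
      have : j ≤ m := by exact_mod_cast this
      omega
    rw [Nat.cast_sub hjm] at h1
    push_cast at h1
    rw [mul_inv_le_iff₀ (by positivity), mul_comm]
    refine le_trans ?_ h1
    gcongr
    linarith
  have hfm : MemLp f (ENNReal.ofReal p) :=
    memLp_indicator_const _ (measurableSet_cube _ _) _ (Or.inr (volume_cube_ne_top _ one_pos))
  have hnorm : eLpNorm f (ENNReal.ofReal p) ≤ ENNReal.ofReal (2 ^ n) := by
    simp only [f]
    rw [eLpNorm_indicator_const (measurableSet_cube _ _) (by simpa using hp0) ENNReal.ofReal_ne_top,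
      volume_cube _ one_pos, ENNReal.toReal_ofReal hp0.le]
    simp only [enorm_one, one_mul, mul_one]
    calc ENNReal.ofReal (2 ^ n) ^ (1 / p) ≤ ENNReal.ofReal (2 ^ n) ^ (1 : ℝ) := by
          apply ENNReal.rpow_le_rpow_of_exponent_le
          · rw [ENNReal.one_le_ofReal]; exact one_le_pow₀ (by norm_num)
          · rw [div_le_one hp0]; exact hp.le
      _ = _ := ENNReal.rpow_one _
  refine le_weakOpNorm (N := ENNReal.ofReal (2 ^ n)) (Set.mem_univ f) hfm (by simp)
    ENNReal.ofReal_ne_top hnorm ?_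
  -- Half of the pointwise lower bound: level sets are defined by strict inequality.
  set τ : ℝ := 2⁻¹ * ((2 ^ n)⁻¹ * (2 ^ n)⁻¹ ^ j * (q ^ j * (j.factorial : ℝ)⁻¹) *
    (2 ^ (m * n) : ℝ)⁻¹) with hτ
  have hτ0 : 0 < τ := by positivity
  have hbig : cube (0 : EuclideanSpace ℝ (Fin n)) (2 ^ m) ⊆
      {x | ((Real.toNNReal τ : ℝ≥0) : ℝ≥0∞) < ‖iterMaximal (j + 1) f x‖ₑ} := by
    intro x hx
    have e : iterMaximal (j + 1) f = maximalOp (iterMaximal j f) := by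
      rw [iterMaximal, Function.iterate_succ_apply']; rfl
    have h1 := average_le_maximalOp (iterMaximal j f) (by positivity) hx
    have h2 := choose_le_lintegral_iterMaximal hn j m
    simp only [Set.mem_ofPred_eq, e, enorm_eq_self]
    refine lt_of_lt_of_le ?_ (le_trans (mul_le_mul_right h2 _) h1)
    rw [volume_cube _ (by positivity), ← ENNReal.ofReal_inv_of_pos (by positivity),
      ← ENNReal.ofReal_mul (by positivity)]
    change ENNReal.ofReal τ < _
    rw [ENNReal.ofReal_lt_ofReal_iff_of_nonneg hτ0.le]
    have h3 : (2 * 2 ^ m : ℝ) ^ n = 2 ^ n * 2 ^ (m * n) := by rw [mul_pow, ← pow_mul]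
    rw [h3, hτ, mul_inv]
    have h4 : (2 ^ n : ℝ)⁻¹ * (2 ^ n)⁻¹ ^ j * (q ^ j * (j.factorial : ℝ)⁻¹) * (2 ^ (m * n))⁻¹ ≤
      (2 ^ n : ℝ)⁻¹ * (2 ^ n)⁻¹ ^ j * m.choose j * (2 ^ (m * n))⁻¹ := by gcongr
    have h5 : 0 < (2 ^ n : ℝ)⁻¹ * (2 ^ n)⁻¹ ^ j * (q ^ j * (j.factorial : ℝ)⁻¹) *
      (2 ^ (m * n))⁻¹ := by positivity
    linarith
  refine le_trans ?_ (le_weakLpNorm (Real.toNNReal τ))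
  refine le_trans ?_ (mul_le_mul_right (ENNReal.rpow_le_rpow (measure_mono hbig) (by positivity)) _)
  rw [volume_cube _ (by positivity), ENNReal.ofReal_rpow_of_nonneg (by positivity) (by positivity)]
  change _ ≤ ENNReal.ofReal τ * _
  rw [← ENNReal.ofReal_mul (by positivity), ← ENNReal.ofReal_mul (by positivity)]
  apply ENNReal.ofReal_le_ofReal
  have hkey : (2 ^ n : ℝ)⁻¹ ^ (j + 2) ≤ (2 ^ (m * n) : ℝ)⁻¹ * ((2 * 2 ^ m) ^ n) ^ (1 / p) := by
    have h1 : ((2 : ℝ) ^ (m * n)) ^ (1 / p) ≤ ((2 * 2 ^ m) ^ n) ^ (1 / p) := by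
      apply Real.rpow_le_rpow (by positivity) _ (by positivity)
      rw [pow_mul]
      gcongr
      linarith [show (0 : ℝ) < 2 ^ m by positivity]
    refine le_trans ?_ (mul_le_mul_of_nonneg_left h1 (by positivity))
    rw [← Real.rpow_natCast 2 (m * n), ← Real.rpow_mul (by norm_num), ← Real.rpow_neg (by norm_num),
      ← Real.rpow_add (by norm_num), ← inv_pow, ← pow_mul, inv_pow, ← Real.rpow_natCast,
      ← Real.rpow_neg (by norm_num)]
    apply Real.rpow_le_rpow_of_exponent_le (by norm_num)
    have e1 : -((m * n : ℕ) : ℝ) + ((m * n : ℕ) : ℝ) * (1 / p) = -(n * (m / q)) := by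
      rw [hq]; push_cast; field_simp; ring
    rw [e1]
    push_cast
    have : (m : ℝ) / q ≤ j + 2 := by rw [div_le_iff₀ (by linarith)]; exact hm2
    nlinarith [show (0 : ℝ) ≤ n by positivity]
  calc _ = 2⁻¹ * ((2 ^ n)⁻¹ * (2 ^ n)⁻¹ ^ j * (q ^ j * (j.factorial : ℝ)⁻¹) *
        ((2 ^ n)⁻¹ ^ (j + 2))) := by field_simp
    _ ≤ 2⁻¹ * ((2 ^ n)⁻¹ * (2 ^ n)⁻¹ ^ j * (q ^ j * (j.factorial : ℝ)⁻¹) *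
        ((2 ^ (m * n) : ℝ)⁻¹ * ((2 * 2 ^ m) ^ n) ^ (1 / p))) := by gcongr
    _ = _ := by rw [hτ]; ring

end Maximal

/-! ### Lower bounds for the Hilbert transform and its commutator -/

/-- At positive distance from the support the truncated integrals are eventually constant, so no
principal value is involved. All the test points below are of this kind. -/
theorem hilbertTransform_eq_integral {f : ℝ → ℝ} {x δ : ℝ} (hδ : 0 < δ)
    (hf : ∀ y, |x - y| ≤ δ → f y = 0) : hilbertTransform f x = ∫ y, f y / (x - y) := by
  refine Tendsto.limUnder_eq (tendsto_const_nhds.congr' ?_)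
  filter_upwards [Ioo_mem_nhdsGT hδ] with ε hε
  refine (setIntegral_eq_integral_of_forall_compl_eq_zero fun y hy => ?_).symm
  rw [hf y ((not_lt.1 hy).trans hε.2.le), zero_div]

theorem memLp_indicator_Icc_of_continuousOn {a b : ℝ} {g : ℝ → ℝ}
    (hg : ContinuousOn g (Set.Icc a b)) (p : ℝ≥0∞) : MemLp ((Set.Icc a b).indicator g) p := by
  rw [memLp_indicator_iff_restrict measurableSet_Icc]
  obtain ⟨C, hC⟩ := isCompact_Icc.exists_bound_of_continuousOn hg
  exact MemLp.of_bound (hg.aestronglyMeasurable measurableSet_Icc) C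
    ((ae_restrict_mem measurableSet_Icc).mono hC)

theorem eLpNorm_indicator_Icc_one_le {a b p : ℝ} (hp : 0 < p) (hab : b - a ≤ 1) :
    eLpNorm ((Set.Icc a b).indicator fun _ => (1 : ℝ)) (ENNReal.ofReal p) ≤ 1 := by
  rw [eLpNorm_indicator_const measurableSet_Icc (by simpa using hp) ENNReal.ofReal_ne_top,
    Real.volume_Icc]
  simp only [enorm_one, one_mul]
  apply ENNReal.rpow_le_one
  · rw [ENNReal.ofReal_le_one]; exact hab
  · positivity

theorem exists_abs_sub_le_indicator_Icc_eq_zero {a b x : ℝ} (hx : x ∉ Set.Icc a b) (g : ℝ → ℝ) :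
    ∃ δ > 0, ∀ y, |x - y| ≤ δ → (Set.Icc a b).indicator g y = 0 := by
  obtain ⟨δ, hδ, h⟩ := Metric.isOpen_iff.1 (isClosed_Icc (a := a) (b := b)).isOpen_compl x hx
  refine ⟨δ / 2, by positivity, fun y hy => Set.indicator_of_notMem (h ?_) _⟩
  rw [Metric.mem_ball, dist_comm, Real.dist_eq]
  linarith

theorem hilbertTransform_indicator_Icc {a b x : ℝ} (hx : x ∉ Set.Icc a b) (g : ℝ → ℝ) :
    hilbertTransform ((Set.Icc a b).indicator g) x = ∫ y in Set.Icc a b, g y / (x - y) := by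
  obtain ⟨δ, hδ, h⟩ := exists_abs_sub_le_indicator_Icc_eq_zero hx g
  rw [hilbertTransform_eq_integral hδ h, ← integral_indicator measurableSet_Icc]
  congr 1
  funext y
  by_cases hy : y ∈ Set.Icc a b <;> simp [hy]

theorem integrableOn_div_sub_Icc {a b x : ℝ} (hx : x ∉ Set.Icc a b) {g : ℝ → ℝ}
    (hg : ContinuousOn g (Set.Icc a b)) :
    IntegrableOn (fun y => g y / (x - y)) (Set.Icc a b) := by
  refine ContinuousOn.integrableOn_Icc (hg.div (by fun_prop) fun y hy h => hx ?_)
  rwa [sub_eq_zero.1 h]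

theorem opCommutator_log_hilbertTransform {a b x : ℝ} (ha : 0 < a) (hx : x ∉ Set.Icc a b) :
    opCommutator (fun x : ℝ => Real.log |x|) hilbertTransform
        ((Set.Icc a b).indicator fun _ => 1) x =
      ∫ y in Set.Icc a b, (Real.log |x| - Real.log y) / (x - y) := by
  have hlog : ContinuousOn Real.log (Set.Icc a b) :=
    Real.continuousOn_log.mono fun y hy => (ha.trans_le hy.1).ne'
  have e : (fun y : ℝ => Real.log |y| * (Set.Icc a b).indicator (fun _ => (1 : ℝ)) y) =
      (Set.Icc a b).indicator Real.log := by
    funext y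
    by_cases hy : y ∈ Set.Icc a b
    · simp [hy]
    · simp [hy]
  rw [opCommutator, e, hilbertTransform_indicator_Icc hx, hilbertTransform_indicator_Icc hx,
    ← integral_const_mul, ← integral_sub]
  · congr 1; funext y; ring
  · exact (integrableOn_div_sub_Icc hx continuousOn_const).const_mul _
  · exact integrableOn_div_sub_Icc hx hlog

theorem indicator_Icc_mem_domCommutator_log {a b : ℝ} (ha : 0 < a) :
    (Set.Icc a b).indicator (fun _ => (1 : ℝ)) ∈ domCommutator fun x : ℝ => Real.log |x| := by
  have hlog : ContinuousOn Real.log (Set.Icc a b) :=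
    Real.continuousOn_log.mono fun y hy => (ha.trans_le hy.1).ne'
  refine ⟨memLp_indicator_Icc_of_continuousOn continuousOn_const _, ?_⟩
  have e : (fun y : ℝ => Real.log |y| * (Set.Icc a b).indicator (fun _ => (1 : ℝ)) y) =
      (Set.Icc a b).indicator Real.log := by
    funext y
    by_cases hy : y ∈ Set.Icc a b
    · simp [hy]
    · simp [hy]
  rw [e]
  exact memLp_indicator_Icc_of_continuousOn hlog _

theorem ofReal_mul_rpow_le_weakLpNorm {p τ L : ℝ} {F : ℝ → ℝ} {s : Set ℝ} (hp : 0 < p)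
    (hτ : 0 ≤ τ) (hL : 0 ≤ L) (hs : ENNReal.ofReal L ≤ volume s) (h : ∀ x ∈ s, τ < F x) :
    ENNReal.ofReal (τ * L ^ (1 / p)) ≤ weakLpNorm p F := by
  refine le_trans ?_ (le_weakLpNorm (Real.toNNReal τ))
  change _ ≤ ENNReal.ofReal τ * _
  rw [ENNReal.ofReal_mul hτ]
  gcongr
  rw [← ENNReal.ofReal_rpow_of_nonneg hL (by positivity)]
  gcongr
  refine hs.trans (measure_mono fun x hx => ?_)
  change ENNReal.ofReal τ < ‖F x‖ₑ
  have := h x hx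
  rw [Real.enorm_eq_ofReal (hτ.trans this.le)]
  exact (ENNReal.ofReal_lt_ofReal_iff_of_nonneg hτ).2 this

/-- For the indicator of `[0, 1]` the transform at x > 1 is log(x / (x - 1)), which exceeds p on an
interval of length e^(-p); the p-th root of that length is e^(-1). -/
theorem le_weakOpNorm_hilbertTransform {p : ℝ} (hp : 1 < p) :
    ENNReal.ofReal (Real.exp (-1) * p) ≤ weakOpNorm (domL2 ℝ) hilbertTransform p := by
  have hp0 : 0 < p := by linarith
  set f : ℝ → ℝ := (Set.Icc 0 1).indicator fun _ => 1
  refine le_weakOpNorm (N := 1) (f := f) (memLp_indicator_Icc_of_continuousOn continuousOn_const _)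
    (memLp_indicator_Icc_of_continuousOn continuousOn_const _) one_ne_zero ENNReal.one_ne_top
    (eLpNorm_indicator_Icc_one_le hp0 (by norm_num)) ?_
  rw [mul_one]
  have h := ofReal_mul_rpow_le_weakLpNorm (p := p) (τ := p) (L := Real.exp (-p))
    (F := hilbertTransform f) (s := Set.Ioo 1 (1 + Real.exp (-p))) hp0 hp0.le (Real.exp_pos _).le
    (by rw [Real.volume_Ioo]; simp) ?_
  · refine le_trans (ENNReal.ofReal_le_ofReal (le_of_eq ?_)) h
    rw [← Real.exp_mul, mul_comm p, neg_mul, mul_one_div_cancel hp0.ne']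
  · intro x hx
    have hx1 : 0 < x - 1 := by linarith [hx.1]
    have hx2 : x - 1 < Real.exp (-p) := by linarith [hx.2]
    have hx0 : 0 < x := by linarith
    simp only [f]
    rw [hilbertTransform_indicator_Icc (fun h => by linarith [h.2])]
    rw [integral_Icc_eq_integral_Ioc, ← intervalIntegral.integral_of_le zero_le_one,
      intervalIntegral.integral_comp_sub_left (fun y => 1 / y) x, sub_zero,
      integral_one_div_of_pos hx1 hx0, Real.lt_log_iff_exp_lt (by positivity), lt_div_iff₀ hx1]
    calc Real.exp p * (x - 1) < Real.exp p * Real.exp (-p) := by gcongr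
      _ = 1 := by rw [← Real.exp_add]; simp
      _ ≤ x := hx.1.le

/-- For the indicator of `[1, 2]` the commutator behaves like (log x)/x far away. At x of order e^q,
with q = p', this is of order q e^(-q) on a set of measure at least e^q, and (e^q)^(1/p) = e^(q-1).
-/
theorem le_weakOpNorm_commutator_conj {p : ℝ} (hp : 1 < p) :
    ENNReal.ofReal (Real.exp (-1) / 16 * (p / (p - 1))) ≤
      weakOpNorm (domCommutator fun x : ℝ => Real.log |x|)
        (opCommutator (fun x : ℝ => Real.log |x|) hilbertTransform) p := by
  have hp0 : 0 < p := by linarith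
  have hp1 : 0 < p - 1 := by linarith
  set q := p / (p - 1) with hq
  have hq0 : 0 < q := by positivity
  set f : ℝ → ℝ := (Set.Icc 1 2).indicator fun _ => 1 with hf
  refine le_weakOpNorm (N := 1) (f := f) (indicator_Icc_mem_domCommutator_log one_pos)
    (memLp_indicator_Icc_of_continuousOn continuousOn_const _) one_ne_zero ENNReal.one_ne_top
    (eLpNorm_indicator_Icc_one_le hp0 (by norm_num)) ?_
  rw [mul_one]
  have hE : 1 ≤ Real.exp q := Real.one_le_exp hq0.le
  have h := ofReal_mul_rpow_le_weakLpNorm (p := p) (τ := q / (16 * Real.exp q)) (L := Real.exp q)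
    (F := opCommutator (fun x : ℝ => Real.log |x|) hilbertTransform f)
    (s := Set.Ioo (4 * Real.exp q) (8 * Real.exp q)) hp0 (by positivity) (Real.exp_pos _).le
    (by rw [Real.volume_Ioo]; apply ENNReal.ofReal_le_ofReal; linarith) ?_
  · refine le_trans (ENNReal.ofReal_le_ofReal (le_of_eq ?_)) h
    rw [← Real.exp_mul]
    have : Real.exp (q * (1 / p)) = Real.exp (-1) * Real.exp q := by
      rw [← Real.exp_add]
      congr 1
      rw [hq]; field_simp; ring
    rw [this]
    field_simp
  · intro x hx
    have hx4 : 4 < x := by linarith [hx.1]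
    have hx0 : 0 < x := by linarith
    have hlogx : q + 2 * Real.log 2 < Real.log x := by
      have : q + 2 * Real.log 2 = Real.log (4 * Real.exp q) := by
        rw [Real.log_mul (by norm_num) (Real.exp_pos _).ne', Real.log_exp,
          show (4 : ℝ) = 2 ^ 2 by norm_num, Real.log_pow]
        push_cast; ring
      rw [this]
      exact Real.log_lt_log (by positivity) hx.1
    have hl2 : 0 < Real.log 2 := Real.log_pos (by norm_num)
    have hxI : x ∉ Set.Icc (1 : ℝ) 2 := fun h => by linarith [h.2]
    rw [hf, opCommutator_log_hilbertTransform one_pos hxI, abs_of_pos hx0]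
    have hlow : ∀ y ∈ Set.Icc (1 : ℝ) 2, q / (8 * Real.exp q) ≤
        (Real.log x - Real.log y) / (x - y) := by
      intro y hy
      have hy2 : Real.log y ≤ Real.log 2 := Real.log_le_log (by linarith [hy.1]) hy.2
      apply div_le_div₀ <;> linarith [hy.1, hy.2, hx.2]
    have hcont : ContinuousOn (fun y => Real.log x - Real.log y) (Set.Icc (1 : ℝ) 2) :=
      continuousOn_const.sub (Real.continuousOn_log.mono fun y hy => by
        have := hy.1; simp; linarith)
    have hint := setIntegral_mono_on (μ := volume) (integrableOn_const (by simp))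
      (integrableOn_div_sub_Icc hxI hcont) measurableSet_Icc hlow
    refine lt_of_lt_of_le ?_ hint
    rw [setIntegral_const, measureReal_def, Real.volume_Icc]
    norm_num
    gcongr
    norm_num

/-- With a = e^(-p), the indicator of `[a, 1]` is tested at -a < x < 0, on the other side of the
singularity of b. There |x - y| ≤ 2y and |log|x| - log y| ≥ log y - log a, so the commutator is at
least the integral of (log y - log a)/(2y), which is (log a)²/4 = p²/4. -/
theorem le_weakOpNorm_commutator_sq {p : ℝ} (hp : 1 < p) :
    ENNReal.ofReal (Real.exp (-1) / 8 * p ^ 2) ≤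
      weakOpNorm (domCommutator fun x : ℝ => Real.log |x|)
        (opCommutator (fun x : ℝ => Real.log |x|) hilbertTransform) p := by
  have hp0 : 0 < p := by linarith
  set a := Real.exp (-p) with ha
  have ha0 : 0 < a := Real.exp_pos _
  have ha1 : a ≤ 1 := Real.exp_le_one_iff.2 (by linarith)
  set f : ℝ → ℝ := (Set.Icc a 1).indicator fun _ => 1 with hf
  refine le_weakOpNorm (N := 1) (f := f) (indicator_Icc_mem_domCommutator_log ha0)
    (memLp_indicator_Icc_of_continuousOn continuousOn_const _) one_ne_zero ENNReal.one_ne_top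
    (eLpNorm_indicator_Icc_one_le hp0 (by linarith)) ?_
  rw [mul_one]
  have h := ofReal_mul_rpow_le_weakLpNorm (p := p) (τ := p ^ 2 / 8) (L := a)
    (F := opCommutator (fun x : ℝ => Real.log |x|) hilbertTransform f)
    (s := Set.Ioo (-a) 0) hp0 (by positivity) ha0.le
    (by rw [Real.volume_Ioo]; apply ENNReal.ofReal_le_ofReal; linarith) ?_
  · refine le_trans (ENNReal.ofReal_le_ofReal (le_of_eq ?_)) h
    rw [ha, ← Real.exp_mul, neg_mul, mul_one_div_cancel hp0.ne']
    ring
  · intro x hx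
    have hxa : -x < a := by linarith [hx.1]
    have hx0 : 0 < -x := by linarith [hx.2]
    have hxI : x ∉ Set.Icc a 1 := fun h => by linarith [h.1]
    rw [hf, opCommutator_log_hilbertTransform ha0 hxI, abs_of_neg hx.2]
    have hlogx : Real.log (-x) < Real.log a := Real.log_lt_log hx0 hxa
    have hlow : ∀ y ∈ Set.Icc a 1, (Real.log y - Real.log a) / (2 * y) ≤
        (Real.log (-x) - Real.log y) / (x - y) := by
      intro y hy
      have hy2 : Real.log a ≤ Real.log y := Real.log_le_log ha0 hy.1
      rw [← neg_div_neg_eq (Real.log (-x) - Real.log y)]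
      apply div_le_div₀ <;> linarith [hy.1, hy.2, hx.2]
    have hcont : ContinuousOn (fun y => Real.log (-x) - Real.log y) (Set.Icc a 1) :=
      continuousOn_const.sub (Real.continuousOn_log.mono fun y hy => by
        have := hy.1; simp; linarith)
    have hcont2 : ContinuousOn (fun y => (Real.log y - Real.log a) / (2 * y)) (Set.Icc a 1) := by
      refine ContinuousOn.div ((Real.continuousOn_log.mono fun y hy => ?_).sub continuousOn_const)
        (by fun_prop) fun y hy => ?_
      · have := hy.1; simp; linarith
      · have := hy.1; have : 0 < y := by linarith
        positivity
    have hint := setIntegral_mono_on (μ := volume) (hcont2.integrableOn_Icc)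
      (integrableOn_div_sub_Icc hxI hcont) measurableSet_Icc hlow
    refine lt_of_lt_of_le ?_ hint
    rw [integral_Icc_eq_integral_Ioc, ← intervalIntegral.integral_of_le ha1]
    have hFTC := intervalIntegral.integral_eq_sub_of_hasDerivAt (a := a) (b := 1)
      (f := fun y => (Real.log y - Real.log a) ^ 2 / 4)
      (f' := fun y => (Real.log y - Real.log a) / (2 * y)) (fun y hy => by
        rw [Set.uIcc_of_le ha1] at hy
        have hy0 : 0 < y := by linarith [hy.1]
        refine ((((Real.hasDerivAt_log hy0.ne').sub_const (Real.log a)).fun_pow 2).div_const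
          4).congr_deriv ?_
        field_simp
        norm_num
        ring) (by
        rw [intervalIntegrable_iff_integrableOn_Icc_of_le ha1]
        exact hcont2.integrableOn_Icc)
    rw [hFTC, ha, Real.log_exp]
    simp
    nlinarith

theorem le_weakOpNorm_commutator_hilbertTransform {p : ℝ} (hp : 1 < p) :
    ENNReal.ofReal (Real.exp (-1) / 16 * max (p / (p - 1)) (p ^ 2)) ≤
      weakOpNorm (domCommutator fun x : ℝ => Real.log |x|)
        (opCommutator (fun x : ℝ => Real.log |x|) hilbertTransform) p := by
  rw [mul_max_of_nonneg _ _ (by positivity), ENNReal.ofReal_max]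
  refine max_le (le_weakOpNorm_commutator_conj hp) (le_trans ?_ (le_weakOpNorm_commutator_sq hp))
  apply ENNReal.ofReal_le_ofReal
  gcongr
  norm_num

/-! ### Functions of bounded mean oscillation -/

section BMO

variable {n : ℕ}

/-- The average of `b` over the cube with centre `c` and side `2 r`. -/
def cubeAvg (b : EuclideanSpace ℝ (Fin n) → ℝ) (c : EuclideanSpace ℝ (Fin n)) (r : ℝ) : ℝ :=
  ⨍ y in cube c r, b y

/-- `b` is locally integrable with mean oscillation at most `β` over every cube. -/
structure BMOBound (b : EuclideanSpace ℝ (Fin n) → ℝ) (β : ℝ) : Prop where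
  pos : 0 < β
  locInt : LocallyIntegrable b
  osc : ∀ c r, 0 < r → ∫⁻ x in cube c r, ‖b x - cubeAvg b c r‖ₑ ≤
    ENNReal.ofReal β * volume (cube c r)

theorem MemBMO.exists_bound {b : EuclideanSpace ℝ (Fin n) → ℝ} (hb : MemBMO b) :
    ∃ β, BMOBound b β := by
  refine ⟨(bmoNorm b).toReal + 1, by positivity, hb.1, fun c r hr => ?_⟩
  have h1 : (volume (cube c r))⁻¹ * ∫⁻ x in cube c r, ‖b x - cubeAvg b c r‖ₑ ≤ bmoNorm b :=
    le_iSup_of_le c <| le_iSup_of_le r <| le_iSup_of_le hr le_rfl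
  have h2 : bmoNorm b ≤ ENNReal.ofReal ((bmoNorm b).toReal + 1) := by
    rw [ENNReal.le_ofReal_iff_toReal_le hb.2.ne (by positivity)]
    linarith
  have h3 := mul_le_mul_right (h1.trans h2) (volume (cube c r))
  rwa [← mul_assoc, ENNReal.mul_inv_cancel (volume_cube_ne_zero c hr) (volume_cube_ne_top c hr),
    one_mul, mul_comm (volume _)] at h3

theorem MeasureTheory.LocallyIntegrable.integrableOn_cube {b : EuclideanSpace ℝ (Fin n) → ℝ}
    (hb : LocallyIntegrable b) (c : EuclideanSpace ℝ (Fin n)) (r : ℝ) :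
    IntegrableOn b (cube c r) :=
  (hb.integrableOn_isCompact ((isBounded_cube c r).isCompact_closure)).mono_set subset_closure

theorem measure_mul_enorm_setAverage_sub_le {X : Type*} [MeasurableSpace X] {μ : Measure X}
    {b : X → ℝ} {s : Set X} (hs : μ s ≠ ∞) (hb : IntegrableOn b s μ) (m : ℝ) :
    μ s * ‖(⨍ y in s, b y ∂μ) - m‖ₑ ≤ ∫⁻ x in s, ‖b x - m‖ₑ ∂μ := by
  rcases eq_or_ne (μ s) 0 with h0 | h0
  · simp [h0]
  have hreal : μ.real s ≠ 0 := (ENNReal.toReal_pos h0 hs).ne'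
  have e : μ.real s * ((⨍ y in s, b y ∂μ) - m) = ∫ x in s, (b x - m) ∂μ := by
    rw [integral_sub hb (integrableOn_const hs), setIntegral_const, setAverage_eq, smul_eq_mul,
      smul_eq_mul, mul_sub, ← mul_assoc, mul_inv_cancel₀ hreal, one_mul]
  have h1 := enorm_integral_le_lintegral_enorm (μ := μ.restrict s) fun x => b x - m
  rw [← e, enorm_mul] at h1
  convert h1
  rw [Real.enorm_eq_ofReal measureReal_nonneg, measureReal_def, ENNReal.ofReal_toReal hs]

/-- The average is within a factor 2 of the best constant, so mean oscillation may be estimated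
about any convenient number. -/
theorem lintegral_enorm_sub_cubeAvg_le {b : EuclideanSpace ℝ (Fin n) → ℝ}
    {c : EuclideanSpace ℝ (Fin n)} {r : ℝ} (hr : 0 < r) (hb : IntegrableOn b (cube c r)) (m : ℝ) :
    ∫⁻ x in cube c r, ‖b x - cubeAvg b c r‖ₑ ≤ 2 * ∫⁻ x in cube c r, ‖b x - m‖ₑ := by
  have h1 := measure_mul_enorm_setAverage_sub_le (volume_cube_ne_top c hr) hb m
  calc ∫⁻ x in cube c r, ‖b x - cubeAvg b c r‖ₑ
      ≤ ∫⁻ x in cube c r, (‖b x - m‖ₑ + ‖cubeAvg b c r - m‖ₑ) := by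
        gcongr with x
        have : b x - cubeAvg b c r = (b x - m) - (cubeAvg b c r - m) := by ring
        rw [this]
        exact enorm_sub_le
    _ = (∫⁻ x in cube c r, ‖b x - m‖ₑ) + volume (cube c r) * ‖cubeAvg b c r - m‖ₑ := by
        rw [lintegral_add_right _ measurable_const, setLIntegral_const, mul_comm]
    _ ≤ _ := by rw [two_mul]; gcongr; exact h1

/-- The truncation of `b` at height `N`. -/
def truncAt (N : ℝ) (b : EuclideanSpace ℝ (Fin n) → ℝ) (x : EuclideanSpace ℝ (Fin n)) : ℝ :=
  max (-N) (min N (b x))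

theorem abs_truncAt_le {N : ℝ} (hN : 0 ≤ N) (b : EuclideanSpace ℝ (Fin n) → ℝ)
    (x : EuclideanSpace ℝ (Fin n)) : |truncAt N b x| ≤ N := by
  rw [abs_le, truncAt]
  exact ⟨le_max_left _ _, max_le (by linarith) (min_le_left _ _)⟩

theorem truncAt_of_abs_le {N : ℝ} {b : EuclideanSpace ℝ (Fin n) → ℝ}
    {x : EuclideanSpace ℝ (Fin n)} (h : |b x| ≤ N) : truncAt N b x = b x := by
  rw [abs_le] at h
  rw [truncAt, min_eq_right h.2, max_eq_right h.1]

theorem abs_truncAt_le_abs {N : ℝ} (hN : 0 ≤ N) (b : EuclideanSpace ℝ (Fin n) → ℝ)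
    (x : EuclideanSpace ℝ (Fin n)) : |truncAt N b x| ≤ |b x| := by
  rcases le_total |b x| N with h | h
  · rw [truncAt_of_abs_le h]
  · exact (abs_truncAt_le hN b x).trans h

/-- Truncation is 1-Lipschitz, so oscillation about the truncated average does not increase; the
factor 2 pays for returning to the true average. The bound is uniform in `N`, which is what later
allows `N → ∞`. -/
theorem BMOBound.truncAt {b : EuclideanSpace ℝ (Fin n) → ℝ} {β : ℝ} (hb : BMOBound b β) {N : ℝ}
    (hN : 0 ≤ N) : BMOBound (truncAt N b) (2 * β) := by
  have hmeas : AEStronglyMeasurable (_root_.truncAt N b) := by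
    have : Continuous fun x : ℝ => max (-N) (min N x) := by fun_prop
    exact this.comp_aestronglyMeasurable hb.locInt.aestronglyMeasurable
  have hint : LocallyIntegrable (_root_.truncAt N b) :=
    hb.locInt.mono hmeas (Eventually.of_forall fun x => by
      simpa using abs_truncAt_le_abs hN b x)
  refine ⟨by linarith [hb.pos], hint, fun c r hr => ?_⟩
  have h1 := lintegral_enorm_sub_cubeAvg_le hr (hint.integrableOn_cube c r)
    (max (-N) (min N (cubeAvg b c r)))
  refine h1.trans ?_
  rw [ENNReal.ofReal_mul (by norm_num), mul_assoc]
  simp only [ENNReal.ofReal_ofNat]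
  gcongr
  refine le_trans ?_ (hb.osc c r hr)
  gcongr with x
  rw [enorm_le_iff_norm_le, Real.norm_eq_abs, Real.norm_eq_abs, _root_.truncAt]
  rw [max_comm, max_comm (-N)]
  refine (abs_max_sub_max_le_abs _ _ _).trans ?_
  rw [min_comm, min_comm N]
  exact abs_inf_sub_inf_le_abs _ _ _

theorem BMOBound.abs_cubeAvg_double_sub_le {b : EuclideanSpace ℝ (Fin n) → ℝ} {β : ℝ}
    (hb : BMOBound b β) (c : EuclideanSpace ℝ (Fin n)) {r : ℝ} (hr : 0 < r) :
    |cubeAvg b c r - cubeAvg b c (2 * r)| ≤ 2 ^ n * β := by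
  have h1 := measure_mul_enorm_setAverage_sub_le (volume_cube_ne_top c hr)
    (hb.locInt.integrableOn_cube c r) (cubeAvg b c (2 * r))
  have h2 := h1.trans ((lintegral_mono_set (cube_subset_cube c (by linarith : r ≤ 2 * r))).trans
    (hb.osc c (2 * r) (by positivity)))
  rw [volume_cube c hr, volume_cube c (by positivity), Real.enorm_eq_ofReal_abs,
    ← ENNReal.ofReal_mul (by positivity), ← ENNReal.ofReal_mul hb.pos.le,
    ENNReal.ofReal_le_ofReal_iff (by have := hb.pos; positivity), mul_pow 2 (2 * r)] at h2
  have h3 : 0 < (2 * r) ^ n := by positivity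
  refine le_of_mul_le_mul_left (h2.trans (le_of_eq ?_)) h3
  ring

theorem BMOBound.abs_cubeAvg_sub_le {b : EuclideanSpace ℝ (Fin n) → ℝ} {β : ℝ}
    (hb : BMOBound b β) (c : EuclideanSpace ℝ (Fin n)) {r : ℝ} (hr : 0 < r) (j : ℕ) :
    |cubeAvg b c r - cubeAvg b c (2 ^ j * r)| ≤ j * (2 ^ n * β) := by
  induction j with
  | zero => simp
  | succ j ih =>
    have h := hb.abs_cubeAvg_double_sub_le c (r := 2 ^ j * r) (by positivity)
    rw [← mul_assoc, ← pow_succ'] at h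
    have := abs_sub_le (cubeAvg b c r) (cubeAvg b c (2 ^ j * r)) (cubeAvg b c (2 ^ (j + 1) * r))
    push_cast
    linarith

/-- The John–Nirenberg inequality, at the levels `2 ^ (n + 2) * β * m`. -/
theorem BMOBound.volume_le {b : EuclideanSpace ℝ (Fin n) → ℝ} {β : ℝ} (hb : BMOBound b β) (m : ℕ)
    (c : EuclideanSpace ℝ (Fin n)) {r : ℝ} (hr : 0 < r) :
    volume {x ∈ cube c r | m * (2 ^ (n + 2) * β) ≤ |b x - cubeAvg b c r|} ≤
      2⁻¹ ^ m * volume (cube c r) := by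
  have hβ := hb.pos
  induction m generalizing c r with
  | zero =>
    simp only [pow_zero, one_mul]
    exact measure_mono fun x hx => hx.1
  | succ m ih =>
    set B := cubeAvg b c r with hB
    -- The grid is anchored so that its top cube of index 0 is the given cube, up to a null set.
    let a : EuclideanSpace ℝ (Fin n) := WithLp.toLp 2 fun i => c i - r
    have hs : 0 < 2 * r := by positivity
    have hcen : gridCenter a (2 * r) 0 = c := by
      ext i; simp [gridCenter, a]; ring
    have hsub0 : cube c r ⊆ gridCube a (2 * r) 0 := by
      have := cube_subset_gridCube a hs 0
      rwa [hcen, mul_div_cancel_left₀ _ two_ne_zero] at this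
    have hae0 : gridCube a (2 * r) 0 =ᵐ[volume] cube c r := by
      have := gridCube_ae_eq_cube a hs 0
      rwa [hcen, mul_div_cancel_left₀ _ two_ne_zero] at this
    set v : EuclideanSpace ℝ (Fin n) → ℝ := (cube c r).indicator fun x => b x - B with hv
    have hvint : Integrable v :=
      ((hb.locInt.integrableOn_cube c r).sub (integrableOn_const
        (volume_cube_ne_top c hr))).integrable_indicator (measurableSet_cube c r)
    have hvn : ∀ x, ‖v x‖ₑ = (cube c r).indicator (fun x => ‖b x - B‖ₑ) x := fun x => by
      by_cases hx : x ∈ cube c r <;> simp [hv, hx]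
    have htot : ∫⁻ x, ‖v x‖ₑ ≤ ENNReal.ofReal β * volume (cube c r) := by
      simp_rw [hvn]
      rw [lintegral_indicator (measurableSet_cube c r)]
      exact hb.osc c r hr
    -- Stopping at twice the mean oscillation: the stopping cubes then fill at most half of the
    -- given cube, the ratio of the geometric decay.
    obtain ⟨S, hdisj, hlow, hup, hoff⟩ := exists_stopping_cubes hvint.locallyIntegrable a hs
      (ENNReal.ofReal (2 * β)) (fun m' => by
        by_cases hm : m' = 0
        · subst hm
          refine (setLIntegral_le_lintegral _ _).trans (htot.trans ?_)
          rw [measure_congr hae0]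
          gcongr
          linarith
        · have : ∫⁻ y in gridCube a (2 * r) m', ‖v y‖ₑ = 0 := by
            rw [setLIntegral_congr_fun (g := fun _ => 0) (measurableSet_gridCube _ _ _)]
            · simp
            · intro y hy
              have hyc : y ∉ cube c r := fun h => hm (by
                have h1 := mem_gridCube_iff.1 (hsub0 h)
                rw [← mem_gridCube_iff.1 hy, h1])
              simp [hv, hyc]
          rw [this]; exact zero_le)
    have hSc : S.Countable := S.to_countable
    have hsq : ∀ q : ℕ × (Fin n → ℤ), 0 < 2 * r / 2 ^ q.1 := fun q => by positivity
    let Q : ℕ × (Fin n → ℤ) → Set (EuclideanSpace ℝ (Fin n)) :=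
      fun q => gridCube a (2 * r / 2 ^ q.1) q.2
    let cc : ℕ × (Fin n → ℤ) → EuclideanSpace ℝ (Fin n) :=
      fun q => gridCenter a (2 * r / 2 ^ q.1) q.2
    let rr : ℕ × (Fin n → ℤ) → ℝ := fun q => 2 * r / 2 ^ q.1 / 2
    have hrr : ∀ q, 0 < rr q := fun q => by have := hsq q; simp only [rr]; positivity
    have hQae : ∀ q, Q q =ᵐ[volume] cube (cc q) (rr q) := fun q => gridCube_ae_eq_cube a (hsq q) _
    have hsum : ∑' q : S, volume (Q q) ≤ 2⁻¹ * volume (cube c r) := by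
      have h1 : ENNReal.ofReal (2 * β) * ∑' q : S, volume (Q q) ≤
          ENNReal.ofReal β * volume (cube c r) := by
        rw [← ENNReal.tsum_mul_left]
        calc _ ≤ ∑' q : S, ∫⁻ y in Q q, ‖v y‖ₑ := by gcongr with q; exact (hlow q q.2).le
          _ = ∫⁻ y in ⋃ q ∈ S, Q q, ‖v y‖ₑ :=
            (lintegral_biUnion hSc (fun q _ => measurableSet_gridCube _ _ _) hdisj _).symm
          _ ≤ _ := (setLIntegral_le_lintegral _ _).trans htot
      have hβ0 : ENNReal.ofReal β ≠ 0 := by simpa using hβ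
      rw [ENNReal.ofReal_mul (by norm_num), mul_comm (ENNReal.ofReal 2), mul_assoc,
        ENNReal.mul_le_mul_iff_right hβ0 ENNReal.ofReal_ne_top] at h1
      rw [← ENNReal.mul_le_mul_iff_right (a := 2) (by norm_num) (by norm_num), ← mul_assoc,
        ENNReal.mul_inv_cancel (by norm_num) (by norm_num), one_mul]
      simpa using h1
    -- Passing to a stopping cube moves the average by less than one step `2 ^ (n + 2) * β` of the
    -- scale, so exceeding `m + 1` steps in the given cube forces exceeding `m` steps in a stopping
    -- cube.
    have havg : ∀ q ∈ S, |cubeAvg b (cc q) (rr q) - B| ≤ 2 ^ (n + 1) * β := by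
      intro q hq
      -- A grid cube disjoint from the given cube carries no mass of `v` and cannot be a stopping
      -- cube.
      have hmeet : ∃ x ∈ Q q, x ∈ cube c r := by
        by_contra! hcon
        have : ∫⁻ y in Q q, ‖v y‖ₑ = 0 := by
          rw [setLIntegral_congr_fun (g := fun _ => 0) (measurableSet_gridCube _ _ _)]
          · simp
          · intro y hy
            simp [hv, hcon y hy]
        have h2 := hlow q hq
        simp only [Q] at this
        rw [this] at h2
        exact absurd h2 not_lt_zero
      obtain ⟨x, hxQ, hxc⟩ := hmeet
      have hQsub : Q q ⊆ gridCube a (2 * r) 0 := by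
        intro y hy
        have h1 := gridIndex_coarser (a := a) (s := 2 * r) (Nat.zero_le q.1)
          ((mem_gridCube_iff.1 hy).trans (mem_gridCube_iff.1 hxQ).symm)
        rw [pow_zero, div_one] at h1
        exact mem_gridCube_iff.2 (h1.trans (mem_gridCube_iff.1 (hsub0 hxc)))
      have h1 := measure_mul_enorm_setAverage_sub_le (volume_cube_ne_top (cc q) (hrr q))
        (hb.locInt.integrableOn_cube (cc q) (rr q)) B
      have hle : ∫⁻ x in cube (cc q) (rr q), ‖b x - B‖ₑ = ∫⁻ x in Q q, ‖v x‖ₑ := by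
        rw [← setLIntegral_congr (hQae q)]
        have hin : ∀ᵐ x, x ∈ Q q → x ∈ cube c r := by
          filter_upwards [hae0.mem_iff] with x hx hxq using hx.1 (hQsub hxq)
        refine setLIntegral_congr_fun_ae (measurableSet_gridCube _ _ _) ?_
        filter_upwards [hin] with x hx hxq
        rw [hvn, Set.indicator_of_mem (hx hxq)]
      rw [hle] at h1
      have h2 := h1.trans (hup q hq)
      rw [← measure_congr (hQae q), mul_comm, ENNReal.mul_le_mul_iff_left
        (volume_gridCube_ne_zero a (hsq q) _) (volume_gridCube_ne_top a (hsq q) _),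
        Real.enorm_eq_ofReal_abs, show (2 : ℝ≥0∞) ^ n = ENNReal.ofReal (2 ^ n) by
          rw [ENNReal.ofReal_pow (by norm_num)]; simp, ← ENNReal.ofReal_mul (by positivity),
        ENNReal.ofReal_le_ofReal_iff (by positivity)] at h2
      refine h2.trans (le_of_eq ?_)
      ring
    have hcover : ∀ᵐ x, x ∈ {x ∈ cube c r | ((m + 1 : ℕ) : ℝ) * (2 ^ (n + 2) * β) ≤ |b x - B|} →
        x ∈ ⋃ q : S, {x ∈ cube (cc q) (rr q) | m * (2 ^ (n + 2) * β) ≤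
          |b x - cubeAvg b (cc q) (rr q)|} := by
      have hall : ∀ᵐ x, ∀ q : S, (x ∈ Q q → x ∈ cube (cc q) (rr q)) := by
        have := hSc.to_subtype
        rw [ae_all_iff]
        intro q
        filter_upwards [(hQae q).mem_iff] with x hx using hx.1
      filter_upwards [hoff, hall] with x hx hx2 hxm
      obtain ⟨hxc, hxm⟩ := hxm
      push_cast at hxm
      have hxU : x ∈ ⋃ q ∈ S, Q q := by
        by_contra hcon
        have h3 := hx hcon
        rw [hvn, Set.indicator_of_mem hxc, Real.enorm_eq_ofReal_abs,
          ENNReal.ofReal_le_ofReal_iff (by positivity)] at h3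
        have h4 : 2 * β < (m + 1) * (2 ^ (n + 2) * β) := by
          have h5 : (1 : ℝ) ≤ 2 ^ n := one_le_pow₀ (by norm_num)
          have h6 : (0 : ℝ) ≤ m := by positivity
          rw [pow_add]
          nlinarith [mul_nonneg h6 (mul_nonneg (by positivity : (0 : ℝ) ≤ 2 ^ n) hβ.le),
            mul_le_mul_of_nonneg_right h5 hβ.le]
        linarith
      obtain ⟨q, hq, hxq⟩ := Set.mem_iUnion₂.1 hxU
      refine Set.mem_iUnion.2 ⟨⟨q, hq⟩, hx2 ⟨q, hq⟩ hxq, ?_⟩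
      have h7 := havg q hq
      have h8 := abs_sub_le (b x) (cubeAvg b (cc q) (rr q)) B
      have h9 : (2 : ℝ) ^ (n + 1) * β ≤ 2 ^ (n + 2) * β := by
        gcongr
        · norm_num
        · norm_num
      simp only
      linarith
    have := hSc.to_subtype
    calc _ ≤ volume (⋃ q : S, {x ∈ cube (cc q) (rr q) | m * (2 ^ (n + 2) * β) ≤
          |b x - cubeAvg b (cc q) (rr q)|}) := measure_mono_ae hcover
      _ ≤ ∑' q : S, volume {x ∈ cube (cc q) (rr q) | m * (2 ^ (n + 2) * β) ≤
          |b x - cubeAvg b (cc q) (rr q)|} := measure_iUnion_le _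
      _ ≤ ∑' q : S, 2⁻¹ ^ m * volume (Q q) := by
          gcongr with q
          rw [measure_congr (hQae q)]
          exact ih (cc q) (hrr q)
      _ ≤ _ := by
          rw [ENNReal.tsum_mul_left, pow_succ, mul_assoc]
          gcongr

theorem rpow_le_mul_exp {u q : ℝ} (hu : 0 ≤ u) (hq : 0 < q) :
    u ^ q ≤ (4 * q) ^ q * Real.exp (u / 4) := by
  have h1 : u ≤ 4 * q * Real.exp (u / (4 * q)) := by
    have := Real.add_one_le_exp (u / (4 * q))
    calc u = 4 * q * (u / (4 * q)) := by field_simp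
      _ ≤ _ := by gcongr; linarith
  calc u ^ q ≤ (4 * q * Real.exp (u / (4 * q))) ^ q := by gcongr
    _ = _ := by
      rw [Real.mul_rpow (by positivity) (Real.exp_pos _).le, ← Real.exp_mul]
      congr 2
      field_simp

/-- The exponential decay of the distribution dominates u^q by (4q)^q e^(u/4), so the `L^q`
oscillation grows linearly in q. This linear growth becomes the single factor p' in the commutator
estimate. -/
theorem BMOBound.lintegral_rpow_le {b : EuclideanSpace ℝ (Fin n) → ℝ} {β : ℝ} (hb : BMOBound b β)
    (c : EuclideanSpace ℝ (Fin n)) {r : ℝ} (hr : 0 < r) {q : ℝ} (hq : 1 ≤ q) :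
    ∫⁻ x in cube c r, ‖b x - cubeAvg b c r‖ₑ ^ q ≤
      ENNReal.ofReal ((2 ^ (n + 6) * q * β) ^ q) * volume (cube c r) := by
  have hβ := hb.pos
  have hq0 : 0 < q := by linarith
  set A : ℝ := 2 ^ (n + 2) * β with hA
  have hA0 : 0 < A := by positivity
  set B := cubeAvg b c r
  have hpt : ∀ x ∈ cube c r, ‖b x - B‖ₑ ^ q ≤ ENNReal.ofReal ((A * (4 * q)) ^ q) *
      ∑' m : ℕ, ENNReal.ofReal ((4 / 3) ^ (m + 1)) *
        {x ∈ cube c r | m * A ≤ |b x - B|}.indicator 1 x := by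
    intro x hx
    set u := |b x - B| / A with hu
    have hu0 : 0 ≤ u := by positivity
    have hfl : (⌊u⌋₊ : ℝ) * A ≤ |b x - B| := by
      rw [← le_div_iff₀ hA0]; exact Nat.floor_le hu0
    refine le_trans ?_ (mul_le_mul_right (ENNReal.le_tsum ⌊u⌋₊) _)
    rw [Set.indicator_of_mem (by exact ⟨hx, hfl⟩), Pi.one_apply, mul_one,
      ← ENNReal.ofReal_mul (by positivity), Real.enorm_eq_ofReal_abs,
      ENNReal.ofReal_rpow_of_nonneg (abs_nonneg _) hq0.le]
    apply ENNReal.ofReal_le_ofReal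
    have e1 : |b x - B| = A * u := by rw [hu]; field_simp
    -- The rate 1/4 makes the layers summable: growth `4 / 3` against decay `1 / 2` leaves a
    -- geometric series of ratio `2 / 3`, with total 4.
    have h43 : Real.exp (1 / 4) ≤ 4 / 3 := by
      have h3 : Real.exp 1 ≤ (4 / 3) ^ 4 := by
        have := Real.exp_one_lt_d9; norm_num; linarith
      have h4 : Real.exp (1 / 4) ^ 4 ≤ (4 / 3 : ℝ) ^ 4 := by
        rw [← Real.exp_nat_mul]; norm_num; norm_num at h3; exact h3
      exact le_of_pow_le_pow_left₀ (by norm_num) (by norm_num) h4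
    have hexp : Real.exp (u / 4) ≤ (4 / 3) ^ (⌊u⌋₊ + 1) := by
      calc Real.exp (u / 4) ≤ Real.exp (((⌊u⌋₊ + 1 : ℕ) : ℝ) * (1 / 4)) := by
            apply Real.exp_le_exp.2
            have := (Nat.lt_floor_add_one u).le
            push_cast; linarith
        _ = Real.exp (1 / 4) ^ (⌊u⌋₊ + 1) := Real.exp_nat_mul _ _
        _ ≤ _ := by gcongr
    rw [e1, Real.mul_rpow hA0.le hu0, Real.mul_rpow hA0.le (by positivity), mul_assoc]
    gcongr
    exact (rpow_le_mul_exp hu0 hq0).trans (by gcongr)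
  have hmeasb : AEMeasurable (fun x => |b x - B|) (volume.restrict (cube c r)) :=
    ((hb.locInt.aestronglyMeasurable.aemeasurable.sub_const B).abs).restrict
  have hms : ∀ m : ℕ, NullMeasurableSet {x ∈ cube c r | (m : ℝ) * A ≤ |b x - B|} := by
    intro m
    exact (measurableSet_cube c r).nullMeasurableSet.inter
      (nullMeasurableSet_le aemeasurable_const
        ((hb.locInt.aestronglyMeasurable.aemeasurable.sub_const B).abs))
  calc ∫⁻ x in cube c r, ‖b x - B‖ₑ ^ q
      ≤ ∫⁻ x in cube c r, ENNReal.ofReal ((A * (4 * q)) ^ q) *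
      ∑' m : ℕ, ENNReal.ofReal ((4 / 3) ^ (m + 1)) *
        {x ∈ cube c r | m * A ≤ |b x - B|}.indicator 1 x :=
        setLIntegral_mono' (measurableSet_cube c r) hpt
    _ = ENNReal.ofReal ((A * (4 * q)) ^ q) * ∑' m : ℕ, ENNReal.ofReal ((4 / 3) ^ (m + 1)) *
        ∫⁻ x in cube c r, {x ∈ cube c r | m * A ≤ |b x - B|}.indicator 1 x := by
        rw [lintegral_const_mul' _ _ ENNReal.ofReal_ne_top, lintegral_tsum]
        · congr 2
          funext m
          rw [lintegral_const_mul' _ _ ENNReal.ofReal_ne_top]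
        · intro m
          exact (aemeasurable_const.indicator₀ ((hms m).mono Measure.restrict_le_self)).const_mul _
    _ ≤ ENNReal.ofReal ((A * (4 * q)) ^ q) * ∑' m : ℕ, ENNReal.ofReal ((4 / 3) ^ (m + 1)) *
        (2⁻¹ ^ m * volume (cube c r)) := by
        gcongr with m
        refine (setLIntegral_le_lintegral _ _).trans ?_
        rw [lintegral_indicator_one₀ (hms m)]
        exact hb.volume_le m c hr
    _ = ENNReal.ofReal ((A * (4 * q)) ^ q) * (4 * volume (cube c r)) := by
        congr 1
        have : ∀ m : ℕ, ENNReal.ofReal ((4 / 3) ^ (m + 1)) * (2⁻¹ ^ m * volume (cube c r)) =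
            ENNReal.ofReal (4 / 3 * (2 / 3) ^ m) * volume (cube c r) := by
          intro m
          rw [← mul_assoc]
          congr 1
          rw [show (2⁻¹ : ℝ≥0∞) = ENNReal.ofReal (2⁻¹) by
            rw [ENNReal.ofReal_inv_of_pos (by norm_num)]; simp, ← ENNReal.ofReal_pow (by norm_num),
            ← ENNReal.ofReal_mul (by positivity)]
          congr 1
          rw [pow_succ, mul_comm _ (4 / 3 : ℝ), mul_assoc, ← mul_pow]
          norm_num
        simp_rw [this]
        rw [ENNReal.tsum_mul_right, ← ENNReal.ofReal_tsum_of_nonneg (fun m => by positivity)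
          ((summable_geometric_of_lt_one (by norm_num) (by norm_num)).mul_left _), tsum_mul_left,
          tsum_geometric_of_lt_one (by norm_num) (by norm_num)]
        norm_num
    _ ≤ _ := by
        rw [← mul_assoc]
        gcongr
        rw [show (4 : ℝ≥0∞) = ENNReal.ofReal 4 by simp, ← ENNReal.ofReal_mul (by positivity)]
        apply ENNReal.ofReal_le_ofReal
        have h4 : (4 : ℝ) ≤ 4 ^ q := Real.self_le_rpow_of_one_le (by norm_num) hq
        calc (A * (4 * q)) ^ q * 4 ≤ (A * (4 * q)) ^ q * 4 ^ q := by gcongr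
          _ = (A * (4 * q) * 4) ^ q :=
            (Real.mul_rpow (by positivity) (by norm_num)).symm
          _ = _ := by congr 1; rw [hA]; ring

/-- Each doubling moves the average by at most `2 ^ n * β`, so comparison with the original average
costs only a factor linear in `j`. -/
theorem BMOBound.lintegral_dilate_rpow_le {b : EuclideanSpace ℝ (Fin n) → ℝ} {β : ℝ}
    (hb : BMOBound b β) (c : EuclideanSpace ℝ (Fin n)) {r : ℝ} (hr : 0 < r) {q : ℝ} (hq : 1 ≤ q)
    (j : ℕ) :
    ∫⁻ x in cube c (2 ^ j * r), ‖b x - cubeAvg b c r‖ₑ ^ q ≤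
      ENNReal.ofReal ((2 ^ (n + 7) * q * β * (j + 1)) ^ q) * volume (cube c (2 ^ j * r)) := by
  have hβ := hb.pos
  have hq0 : 0 < q := by linarith
  set B := cubeAvg b c (2 ^ j * r)
  have hpt : ∀ x, ‖b x - cubeAvg b c r‖ₑ ^ q ≤
      2 ^ (q - 1) * (‖b x - B‖ₑ ^ q + ENNReal.ofReal ((j * (2 ^ n * β)) ^ q)) := by
    intro x
    have h1 : ‖b x - cubeAvg b c r‖ₑ ≤ ‖b x - B‖ₑ + ENNReal.ofReal (j * (2 ^ n * β)) := by
      rw [show b x - cubeAvg b c r = (b x - B) - (cubeAvg b c r - B) by ring]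
      refine enorm_sub_le.trans ?_
      gcongr
      rw [Real.enorm_eq_ofReal_abs]
      exact ENNReal.ofReal_le_ofReal (hb.abs_cubeAvg_sub_le c hr j)
    rw [← ENNReal.ofReal_rpow_of_nonneg (by positivity) hq0.le]
    exact (ENNReal.rpow_le_rpow h1 hq0.le).trans (ENNReal.rpow_add_le_mul_rpow_add_rpow _ _ hq)
  calc _ ≤ ∫⁻ x in cube c (2 ^ j * r), 2 ^ (q - 1) * (‖b x - B‖ₑ ^ q +
        ENNReal.ofReal ((j * (2 ^ n * β)) ^ q)) := by gcongr with x; exact hpt x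
    _ = 2 ^ (q - 1) * ((∫⁻ x in cube c (2 ^ j * r), ‖b x - B‖ₑ ^ q) +
        ENNReal.ofReal ((j * (2 ^ n * β)) ^ q) * volume (cube c (2 ^ j * r))) := by
        rw [lintegral_const_mul' _ _ (by finiteness), lintegral_add_right _ measurable_const,
          setLIntegral_const]
    _ ≤ 2 ^ (q - 1) * (ENNReal.ofReal ((2 ^ (n + 6) * q * β) ^ q) * volume (cube c (2 ^ j * r)) +
        ENNReal.ofReal ((j * (2 ^ n * β)) ^ q) * volume (cube c (2 ^ j * r))) := by
        gcongr
        exact hb.lintegral_rpow_le c (by positivity) hq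
    _ ≤ _ := by
        rw [← add_mul, ← mul_assoc]
        gcongr
        rw [← ENNReal.ofReal_add (by positivity) (by positivity), show (2 : ℝ≥0∞) =
          ENNReal.ofReal 2 by simp, ENNReal.ofReal_rpow_of_pos (by norm_num),
          ← ENNReal.ofReal_mul (by positivity)]
        apply ENNReal.ofReal_le_ofReal
        set Z : ℝ := 2 ^ (n + 6) * q * β * (j + 1) with hZ
        have hj : (0 : ℝ) ≤ j := by positivity
        have h1 : 2 ^ (n + 6) * q * β ≤ Z := by
          rw [hZ]; exact le_mul_of_one_le_right (by positivity) (by linarith)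
        have h2 : j * (2 ^ n * β) ≤ Z := by
          have h3 : (2 : ℝ) ^ n ≤ 2 ^ (n + 6) * q := by
            rw [pow_add]
            have : (0 : ℝ) < 2 ^ n := by positivity
            nlinarith
          calc j * (2 ^ n * β) ≤ (j + 1) * (2 ^ (n + 6) * q * β) := by gcongr; linarith
            _ = Z := by rw [hZ]; ring
        calc 2 ^ (q - 1) * ((2 ^ (n + 6) * q * β) ^ q + (j * (2 ^ n * β)) ^ q)
            ≤ 2 ^ (q - 1) * (Z ^ q + Z ^ q) := by gcongr
          _ = 2 ^ q * Z ^ q := by rw [Real.rpow_sub_one (by norm_num)]; ring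
          _ = (2 * Z) ^ q := (Real.mul_rpow (by norm_num) (by positivity)).symm
          _ = _ := by congr 1; rw [hZ]; ring

end BMO

/-! ### Operators on `L²` acting on functions -/

namespace L2Operator

variable {n : ℕ} (T : L2Operator n) {f g : EuclideanSpace ℝ (Fin n) → ℝ}

theorem onFun_eq (hf : MemLp f 2) : T.onFun f = T (hf.toLp f) := by
  simp [onFun, hf]

theorem memLp_onFun (f : EuclideanSpace ℝ (Fin n) → ℝ) : MemLp (T.onFun f) 2 := by
  by_cases hf : MemLp f 2
  · rw [T.onFun_eq hf]; exact Lp.memLp _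
  · simp only [onFun, hf, dite_false]; exact MemLp.zero

theorem eLpNorm_onFun_le (hf : MemLp f 2) :
    eLpNorm (T.onFun f) 2 ≤ ENNReal.ofReal ‖T‖ * eLpNorm f 2 := by
  rw [T.onFun_eq hf, ← Lp.enorm_def, ← eLpNorm_congr_ae hf.coeFn_toLp, ← Lp.enorm_def,
    ofReal_norm]
  exact T.le_opENorm _

theorem onFun_add (hf : MemLp f 2) (hg : MemLp g 2) :
    T.onFun (fun x => f x + g x) =ᵐ[volume] fun x => T.onFun f x + T.onFun g x := by
  have hfg : MemLp (fun x => f x + g x) 2 := hf.add hg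
  rw [T.onFun_eq hf, T.onFun_eq hg, T.onFun_eq hfg]
  have : hfg.toLp _ = hf.toLp f + hg.toLp g := MemLp.toLp_add hf hg
  rw [this, map_add]
  exact Lp.coeFn_add _ _

theorem onFun_sub (hf : MemLp f 2) (hg : MemLp g 2) :
    T.onFun (fun x => f x - g x) =ᵐ[volume] fun x => T.onFun f x - T.onFun g x := by
  have hfg : MemLp (fun x => f x - g x) 2 := hf.sub hg
  rw [T.onFun_eq hf, T.onFun_eq hg, T.onFun_eq hfg]
  have : hfg.toLp _ = hf.toLp f - hg.toLp g := MemLp.toLp_sub hf hg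
  rw [this, map_sub]
  exact Lp.coeFn_sub _ _

theorem onFun_const_mul (c : ℝ) (hf : MemLp f 2) :
    T.onFun (fun x => c * f x) =ᵐ[volume] fun x => c * T.onFun f x := by
  have hcf : MemLp (fun x => c * f x) 2 := hf.const_mul c
  rw [T.onFun_eq hf, T.onFun_eq hcf]
  have : hcf.toLp _ = c • hf.toLp f := MemLp.toLp_const_smul c hf
  rw [this, map_smul]
  exact Lp.coeFn_smul _ _

theorem onFun_finset_sum {ι : Type*} (J : Finset ι) {h : ι → EuclideanSpace ℝ (Fin n) → ℝ}
    (hh : ∀ i ∈ J, MemLp (h i) 2) :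
    T.onFun (fun x => ∑ i ∈ J, h i x) =ᵐ[volume] fun x => ∑ i ∈ J, T.onFun (h i) x := by
  classical
  induction J using Finset.induction_on with
  | empty =>
    have h0 : MemLp (fun _ : EuclideanSpace ℝ (Fin n) => (0 : ℝ)) 2 := MemLp.zero
    have := T.onFun_const_mul 0 h0
    simpa using this
  | insert i J hi ih =>
    have h1 := ih fun j hj => hh j (Finset.mem_insert_of_mem hj)
    have h2 := T.onFun_add (hh i (Finset.mem_insert_self i J))
      (memLp_finsetSum J fun j hj => hh j (Finset.mem_insert_of_mem hj))
    simp_rw [Finset.sum_insert hi]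
    filter_upwards [h1, h2] with x hx1 hx2
    rw [hx2, hx1]

/-- The adjoint operator. -/
def adj : L2Operator n := ContinuousLinearMap.adjoint T

theorem norm_adj : ‖T.adj‖ = ‖T‖ := LinearIsometryEquiv.norm_map _ _

theorem integral_onFun_mul (hf : MemLp f 2) (hg : MemLp g 2) :
    ∫ x, T.onFun f x * g x = ∫ x, f x * T.adj.onFun g x := by
  have h := ContinuousLinearMap.adjoint_inner_right T (hf.toLp f) (hg.toLp g)
  rw [L2.inner_def, L2.inner_def] at h
  rw [T.onFun_eq hf, T.adj.onFun_eq hg]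
  refine Eq.trans ?_ (h.symm.trans ?_)
  · refine integral_congr_ae ?_
    filter_upwards [hg.coeFn_toLp] with x hx
    simp [hx, mul_comm]
  · refine integral_congr_ae ?_
    filter_upwards [hf.coeFn_toLp] with x hx
    simp [hx, adj, mul_comm]

end L2Operator

/-! ### Kernels -/

section Kernel

variable {n : ℕ}

/-- A measurable standard kernel, with explicit constants. -/
structure KernelBound (K : EuclideanSpace ℝ (Fin n) → EuclideanSpace ℝ (Fin n) → ℝ) (A δ : ℝ) :
    Prop where
  pos : 0 < A
  exp_pos : 0 < δ
  meas : Measurable (Function.uncurry K)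
  size : ∀ x y, x ≠ y → |K x y| ≤ A / ‖x - y‖ ^ n
  reg_left : ∀ x x' y, x ≠ y → ‖x - x'‖ ≤ (1 / 2) * ‖x - y‖ →
    |K x y - K x' y| ≤ A * (‖x - x'‖ / ‖x - y‖) ^ δ * (1 / ‖x - y‖ ^ n)
  reg_right : ∀ x x' y, x ≠ y → ‖x - x'‖ ≤ (1 / 2) * ‖x - y‖ →
    |K y x - K y x'| ≤ A * (‖x - x'‖ / ‖x - y‖) ^ δ * (1 / ‖x - y‖ ^ n)

/-- `T` is given by integration against `K` off the support of functions in `L²` with bounded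
support. -/
def Represents (T : L2Operator n)
    (K : EuclideanSpace ℝ (Fin n) → EuclideanSpace ℝ (Fin n) → ℝ) : Prop :=
  ∀ f : EuclideanSpace ℝ (Fin n) → ℝ, MemLp f 2 → ∀ F : Set (EuclideanSpace ℝ (Fin n)),
    IsClosed F → Bornology.IsBounded F → (∀ x ∉ F, f x = 0) →
      ∀ᵐ x, x ∉ F → T.onFun f x = ∫ y, K x y * f y

/-- The quantitative form of being a Calderón–Zygmund operator. -/
structure CZBound (T : L2Operator n)
    (K : EuclideanSpace ℝ (Fin n) → EuclideanSpace ℝ (Fin n) → ℝ) (A δ : ℝ) : Prop where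
  kernel : KernelBound K A δ
  rep : Represents T K
  norm_le : ‖T‖ ≤ A

theorem KernelBound.swap {K : EuclideanSpace ℝ (Fin n) → EuclideanSpace ℝ (Fin n) → ℝ} {A δ : ℝ}
    (hK : KernelBound K A δ) : KernelBound (fun x y => K y x) A δ where
  pos := hK.pos
  exp_pos := hK.exp_pos
  meas := hK.meas.comp measurable_swap
  size x y h := by rw [norm_sub_rev]; exact hK.size y x h.symm
  reg_left := hK.reg_right
  reg_right := hK.reg_left

theorem exists_pos_le_norm_sub {F : Set (EuclideanSpace ℝ (Fin n))} (hF : IsClosed F)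
    {x : EuclideanSpace ℝ (Fin n)} (hx : x ∉ F) : ∃ d > 0, ∀ y ∈ F, d ≤ ‖x - y‖ := by
  obtain ⟨d, hd, h⟩ := Metric.isOpen_iff.1 hF.isOpen_compl x hx
  refine ⟨d, hd, fun y hy => ?_⟩
  by_contra! hlt
  refine h (a := y) ?_ hy
  rwa [Metric.mem_ball, dist_comm, dist_eq_norm]

theorem KernelBound.abs_le {K : EuclideanSpace ℝ (Fin n) → EuclideanSpace ℝ (Fin n) → ℝ}
    {A δ : ℝ} (hK : KernelBound K A δ) {x y : EuclideanSpace ℝ (Fin n)} {d : ℝ} (hd : 0 < d)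
    (h : d ≤ ‖x - y‖) : |K x y| ≤ A / d ^ n := by
  have hA := hK.pos
  have hne : x ≠ y := by
    rintro rfl
    simp at h; linarith
  refine (hK.size x y hne).trans ?_
  gcongr

theorem integrable_of_memLp_two_of_bounded {f : EuclideanSpace ℝ (Fin n) → ℝ} (hf : MemLp f 2)
    {F : Set (EuclideanSpace ℝ (Fin n))} (hF : Bornology.IsBounded F) (h0 : ∀ x ∉ F, f x = 0) :
    Integrable f := by
  rw [← memLp_one_iff_integrable]
  exact hf.mono_exponent_of_measure_support_ne_top h0 hF.measure_lt_top.ne (by norm_num)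

theorem KernelBound.integrable_mul {K : EuclideanSpace ℝ (Fin n) → EuclideanSpace ℝ (Fin n) → ℝ}
    {A δ : ℝ} (hK : KernelBound K A δ) {f : EuclideanSpace ℝ (Fin n) → ℝ} (hf : MemLp f 2)
    {F : Set (EuclideanSpace ℝ (Fin n))} (hF : IsClosed F) (hFb : Bornology.IsBounded F)
    (h0 : ∀ x ∉ F, f x = 0) {x : EuclideanSpace ℝ (Fin n)} (hx : x ∉ F) :
    Integrable fun y => K x y * f y := by
  obtain ⟨d, hd, hdF⟩ := exists_pos_le_norm_sub hF hx
  have hi := integrable_of_memLp_two_of_bounded hf hFb h0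
  refine (hi.norm.const_mul (A / d ^ n)).mono' ?_ (Eventually.of_forall fun y => ?_)
  · exact ((hK.meas.comp measurable_prodMk_left).aestronglyMeasurable).mul hi.1
  · rw [norm_mul, Real.norm_eq_abs, Real.norm_eq_abs]
    by_cases hy : y ∈ F
    · gcongr
      exact hK.abs_le hd (hdF y hy)
    · simp [h0 y hy]

theorem exists_notMem_cthickening {F : Set (EuclideanSpace ℝ (Fin n))} (hF : IsClosed F)
    {x : EuclideanSpace ℝ (Fin n)} (hx : x ∉ F) :
    ∃ k : ℕ, x ∉ Metric.cthickening (1 / ((k : ℝ) + 1)) F := by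
  obtain ⟨d, hd, h⟩ := exists_pos_le_norm_sub hF hx
  obtain ⟨k, hk⟩ := exists_nat_one_div_lt hd
  refine ⟨k, fun hmem => ?_⟩
  rw [Metric.cthickening_eq_iInter_thickening (by positivity)] at hmem
  have := Set.mem_iInter₂.1 hmem d hk
  obtain ⟨z, hz, hzd⟩ := Metric.mem_thickening_iff.1 this
  have h2 := h z hz
  rw [← dist_eq_norm] at h2
  linarith

/-- The kernel formula passes from test functions to `L²` functions of bounded support by density.
The left side converges in `L²`, hence a.e. along a subsequence, and the right side converges
pointwise because the kernel is bounded away from the support. -/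
theorem represents_of_smooth {T : L2Operator n}
    {K : EuclideanSpace ℝ (Fin n) → EuclideanSpace ℝ (Fin n) → ℝ} {A δ : ℝ}
    (hK : KernelBound K A δ)
    (hrep : ∀ f : EuclideanSpace ℝ (Fin n) → ℝ, ContDiff ℝ ((⊤ : ℕ∞) : WithTop ℕ∞) f →
      HasCompactSupport f → ∀ᵐ x, x ∉ tsupport f → T.onFun f x = ∫ y, K x y * f y) :
    Represents T K := by
  intro f hf F hF hFb h0
  have key : ∀ k : ℕ, ∀ᵐ x, x ∉ Metric.cthickening (1 / ((k : ℝ) + 1)) F →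
      T.onFun f x = ∫ y, K x y * f y := by
    intro k
    set ε : ℝ := 1 / ((k : ℝ) + 1) with hε
    have hε0 : 0 < ε := by positivity
    set V := Metric.cthickening ε F with hV
    have hVc : IsClosed V := Metric.isClosed_cthickening
    have hVb : Bornology.IsBounded V := hFb.cthickening
    have hVfin : volume V ≠ ∞ := hVb.measure_lt_top.ne
    obtain ⟨χ, hχs, hχr, hχsup, hχ1⟩ := exists_contMDiff_support_eq_eq_one_iff
      (n := (⊤ : ℕ∞))
      (modelWithCornersSelf ℝ (EuclideanSpace ℝ (Fin n))) (Metric.isOpen_thickening (δ := ε) (E := F))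
      hF (Metric.self_subset_thickening hε0 F)
    rw [contMDiff_iff_contDiff] at hχs
    have hχle : ∀ x, |χ x| ≤ 1 := fun x => by
      have := hχr (Set.mem_range_self x)
      rw [abs_of_nonneg this.1]; exact this.2
    have hχ0 : ∀ x ∉ V, χ x = 0 := fun x hx => by
      by_contra hne
      have : x ∈ Function.support χ := hne
      rw [hχsup] at this
      exact hx (Metric.thickening_subset_cthickening _ _ this)
    choose g hgc hgs hgn using fun j : ℕ => hf.exist_eLpNorm_sub_le (by norm_num) (by norm_num)
      (ε := 1 / ((j : ℝ) + 1)) (by positivity)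
    -- Without the cutoff the supports of the approximants could spread over the point `x`. Since `χ
    -- = 1` on `F` and `f` vanishes off `F`, the error is `-χ (f - g j)`, no larger than before.
    let φ : ℕ → EuclideanSpace ℝ (Fin n) → ℝ := fun j x => χ x * g j x
    have hφs : ∀ j, ContDiff ℝ ((⊤ : ℕ∞) : WithTop ℕ∞) (φ j) := fun j => hχs.mul (hgs j)
    have hφc : ∀ j, HasCompactSupport (φ j) := fun j => (hgc j).mul_left
    have hφm : ∀ j, MemLp (φ j) 2 := fun j => (hφs j).continuous.memLp_of_hasCompactSupport (hφc j)
    have hφ0 : ∀ j, ∀ x ∉ V, φ j x = 0 := fun j x hx => by simp [φ, hχ0 x hx]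
    have hf0 : ∀ x ∉ V, f x = 0 := fun x hx =>
      h0 x fun h => hx (Metric.self_subset_cthickening F h)
    have htsub : ∀ j, tsupport (φ j) ⊆ V := fun j =>
      closure_minimal (fun x hx => by by_contra hc; exact hx (hφ0 j x hc)) hVc
    have hφn : ∀ j : ℕ, eLpNorm (fun x => φ j x - f x) 2 ≤ ENNReal.ofReal (1 / ((j : ℝ) + 1)) := by
      intro j
      refine le_trans (eLpNorm_mono fun x => ?_) (hgn j)
      have : φ j x - f x = - (χ x * (f x - g j x)) := by
        by_cases hx : x ∈ F
        · simp only [φ, (hχ1 x).1 hx]; ring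
        · simp only [φ, h0 x hx]; ring
      rw [this, norm_neg, norm_mul]
      exact mul_le_of_le_one_left (norm_nonneg _) (hχle x)
    have hlim0 : Tendsto (fun j : ℕ => ENNReal.ofReal (1 / ((j : ℝ) + 1))) atTop (𝓝 0) := by
      have := ENNReal.tendsto_ofReal tendsto_one_div_add_atTop_nhds_zero_nat
      simpa using this
    have hTlim : Tendsto (fun j => eLpNorm (T.onFun (φ j) - T.onFun f) 2 volume) atTop (𝓝 0) := by
      have h1 : ∀ j, eLpNorm (T.onFun (φ j) - T.onFun f) 2 ≤
          ENNReal.ofReal ‖T‖ * ENNReal.ofReal (1 / ((j : ℝ) + 1)) := by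
        intro j
        have h2 : T.onFun (φ j) - T.onFun f =ᵐ[volume] T.onFun fun x => φ j x - f x :=
          (T.onFun_sub (hφm j) hf).symm
        rw [eLpNorm_congr_ae h2]
        exact (T.eLpNorm_onFun_le ((hφm j).sub hf)).trans (mul_le_mul_right (hφn j) _)
      refine tendsto_of_tendsto_of_tendsto_of_le_of_le tendsto_const_nhds ?_ (fun _ => zero_le) h1
      have := ENNReal.Tendsto.const_mul (a := ENNReal.ofReal ‖T‖) hlim0
        (Or.inr ENNReal.ofReal_ne_top)
      rwa [mul_zero] at this
    obtain ⟨ns, hns, hae⟩ := (tendstoInMeasure_of_tendsto_eLpNorm (by norm_num)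
      (fun j => (T.memLp_onFun (φ j)).1) (T.memLp_onFun f).1 hTlim).exists_seq_tendsto_ae
    filter_upwards [hae, ae_all_iff.2 fun j => hrep (φ j) (hφs j) (hφc j)] with x hx hxrep hxV
    obtain ⟨d, hd, hdV⟩ := exists_pos_le_norm_sub hVc hxV
    refine tendsto_nhds_unique hx ?_
    have hconv : Tendsto (fun j => ∫ y, K x y * φ j y) atTop (𝓝 (∫ y, K x y * f y)) := by
      have h3 : ∀ j, ‖(∫ y, K x y * φ j y) - ∫ y, K x y * f y‖ₑ ≤ ENNReal.ofReal (A / d ^ n) *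
          (ENNReal.ofReal (1 / ((j : ℝ) + 1)) * volume V ^ (1 / 2 : ℝ)) := by
        intro j
        rw [← integral_sub (hK.integrable_mul (hφm j) hVc hVb (hφ0 j) hxV)
          (hK.integrable_mul hf hVc hVb hf0 hxV)]
        refine (enorm_integral_le_lintegral_enorm _).trans ?_
        have h4 : ∀ y, ‖K x y * φ j y - K x y * f y‖ₑ ≤
            ENNReal.ofReal (A / d ^ n) * V.indicator (fun y => ‖φ j y - f y‖ₑ) y := by
          intro y
          by_cases hy : y ∈ V
          · rw [Set.indicator_of_mem hy, ← mul_sub, enorm_mul, Real.enorm_eq_ofReal_abs (K x y)]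
            gcongr
            exact hK.abs_le hd (hdV y hy)
          · simp [hφ0 j y hy, hf0 y hy]
        refine (lintegral_mono h4).trans ?_
        rw [lintegral_const_mul' _ _ ENNReal.ofReal_ne_top, lintegral_indicator hVc.measurableSet]
        gcongr
        have h5 := eLpNorm_le_eLpNorm_mul_rpow_measure_univ (μ := volume.restrict V)
          (p := 1) (q := 2) (f := fun y => φ j y - f y) (by norm_num)
          ((hφm j).sub hf).1.restrict
        rw [eLpNorm_one_eq_lintegral_enorm, Measure.restrict_apply_univ] at h5
        refine h5.trans ?_
        norm_num
        gcongr
        refine (eLpNorm_mono_measure _ Measure.restrict_le_self).trans ?_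
        simpa using hφn j
      rw [tendsto_iff_edist_tendsto_0]
      simp_rw [edist_eq_enorm_sub]
      refine tendsto_of_tendsto_of_tendsto_of_le_of_le tendsto_const_nhds ?_
        (fun _ => zero_le) h3
      have h6 := ENNReal.Tendsto.const_mul (ENNReal.Tendsto.mul_const
        (b := volume V ^ (1 / 2 : ℝ)) hlim0 (Or.inr (by finiteness)))
        (a := ENNReal.ofReal (A / d ^ n)) (Or.inr ENNReal.ofReal_ne_top)
      simpa using h6
    refine (hconv.comp hns.tendsto_atTop).congr fun i => ?_
    exact (hxrep (ns i) fun h => hxV (htsub _ h)).symm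
  filter_upwards [ae_all_iff.2 key] with x hx hxF
  obtain ⟨k, hk⟩ := exists_notMem_cthickening hF hxF
  exact hx k hk

/-- The adjoint is given by the transposed kernel: pair with indicators of subsets of a compact set
at positive distance from the support, where the kernel is bounded and Fubini applies. -/
theorem Represents.adj {T : L2Operator n}
    {K : EuclideanSpace ℝ (Fin n) → EuclideanSpace ℝ (Fin n) → ℝ} {A δ : ℝ}
    (hK : KernelBound K A δ) (hrep : Represents T K) : Represents T.adj fun x y => K y x := by
  intro f hf F hF hFb h0
  have key : ∀ k : ℕ, ∀ᵐ x, x ∉ Metric.cthickening (1 / ((k : ℝ) + 1)) F →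
      x ∈ Metric.closedBall (0 : EuclideanSpace ℝ (Fin n)) k →
      T.adj.onFun f x = ∫ y, K y x * f y := by
    intro k
    set ε : ℝ := 1 / ((k : ℝ) + 1) with hε
    have hε0 : 0 < ε := by positivity
    set W := Metric.closedBall (0 : EuclideanSpace ℝ (Fin n)) k \ Metric.thickening ε F with hW
    have hWc : IsClosed W := Metric.isClosed_closedBall.sdiff Metric.isOpen_thickening
    have hWb : Bornology.IsBounded W := Metric.isBounded_closedBall.subset Set.sdiff_subset
    have hWfin : volume W ≠ ∞ := hWb.measure_lt_top.ne
    have hWF : ∀ x ∈ W, ∀ y ∈ F, ε ≤ ‖y - x‖ := by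
      intro x hx y hy
      by_contra! hlt
      refine hx.2 (Metric.mem_thickening_iff.2 ⟨y, hy, ?_⟩)
      rwa [dist_comm, dist_eq_norm]
    have hfi : Integrable f := integrable_of_memLp_two_of_bounded hf hFb h0
    have hprod : Integrable (Function.uncurry fun x y => K y x * f y)
        ((volume.restrict W).prod volume) := by
      have h1 : Integrable (fun z : EuclideanSpace ℝ (Fin n) × EuclideanSpace ℝ (Fin n) =>
          (1 : ℝ) * f z.2) ((volume.restrict W).prod volume) := by
        have : IsFiniteMeasure (volume.restrict W) := ⟨by simpa using hWfin.lt_top⟩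
        exact (integrable_const (1 : ℝ)).mul_prod hfi
      refine (h1.norm.const_mul (A / ε ^ n)).mono' ?_ ?_
      · refine AEStronglyMeasurable.mul ?_ hfi.1.comp_snd
        exact (hK.meas.comp measurable_swap).aestronglyMeasurable
      · have h2 : ∀ᵐ z ∂((volume.restrict W).prod
            (volume : Measure (EuclideanSpace ℝ (Fin n)))), z.1 ∈ W := by
          exact Measure.quasiMeasurePreserving_fst.ae (ae_restrict_mem hWc.measurableSet)
        filter_upwards [h2] with z hz
        simp only [Function.uncurry, one_mul, norm_mul]
        by_cases hy : z.2 ∈ F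
        · gcongr
          exact hK.abs_le hε0 (hWF z.1 hz z.2 hy)
        · simp [h0 z.2 hy]
    have hmain : T.adj.onFun f =ᵐ[volume.restrict W] fun x => ∫ y, K y x * f y := by
      refine ae_eq_of_forall_setIntegral_eq_of_sigmaFinite ?_ ?_ ?_
      · intro s _ _
        have : IsFiniteMeasure (volume.restrict W) := ⟨by simpa using hWfin.lt_top⟩
        exact (((T.adj.memLp_onFun f).restrict W).integrable (by norm_num)).integrableOn
      · intro s _ _
        exact (hprod.integral_prod_left).integrableOn
      · intro s hs _
        rw [Measure.restrict_restrict hs]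
        set G := s ∩ W with hG
        have hGm : MeasurableSet G := hs.inter hWc.measurableSet
        have hGfin : volume G ≠ ∞ := measure_ne_top_of_subset Set.inter_subset_right hWfin
        set e : EuclideanSpace ℝ (Fin n) → ℝ := G.indicator fun _ => 1
        have he : MemLp e 2 := memLp_indicator_const _ hGm _ (Or.inr hGfin)
        have he0 : ∀ x ∉ W, e x = 0 := fun x hx =>
          Set.indicator_of_notMem (fun h => hx h.2) _
        have hr := hrep e he W hWc hWb he0
        have hpair := T.integral_onFun_mul he hf
        have e1 : ∫ x in G, T.adj.onFun f x = ∫ x, e x * T.adj.onFun f x := by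
          rw [← integral_indicator hGm]
          congr 1; funext x
          by_cases hx : x ∈ G <;> simp [e, hx]
        have e2 : ∫ y, T.onFun e y * f y = ∫ y, ∫ x in G, K y x * f y := by
          refine integral_congr_ae ?_
          filter_upwards [hr] with y hy
          by_cases hyF : y ∈ F
          · have hyW : y ∉ W := fun h => by
              have := hWF y h y hyF
              simp at this; linarith
            rw [hy hyW, integral_mul_const, ← integral_indicator hGm]
            congr 2; funext x
            by_cases hx : x ∈ G <;> simp [e, hx]
          · simp [h0 y hyF]
        rw [e1, ← hpair, e2]
        refine (integral_integral_swap (f := fun x y => K y x * f y) ?_).symm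
        refine hprod.mono_measure ?_
        exact Measure.prod_mono (Measure.restrict_mono Set.inter_subset_right le_rfl) le_rfl
    rw [Filter.EventuallyEq, ae_restrict_iff' hWc.measurableSet] at hmain
    filter_upwards [hmain] with x hx h1 h2
    exact hx ⟨h2, fun h => h1 (Metric.thickening_subset_cthickening _ _ h)⟩
  filter_upwards [ae_all_iff.2 key] with x hx hxF
  obtain ⟨k, hk⟩ := exists_notMem_cthickening hF hxF
  obtain ⟨m, hm⟩ := exists_nat_ge ‖x‖
  refine hx (max k m) (fun h => hk (Metric.cthickening_mono ?_ F h)) ?_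
  -- A single index has to serve both the distance to `F` and the size of `x`, whence the maximum.
  · gcongr
    exact le_max_left _ _
  · rw [Metric.mem_closedBall, dist_zero_right]
    exact hm.trans (by exact_mod_cast le_max_right _ _)

theorem CZBound.adj {T : L2Operator n}
    {K : EuclideanSpace ℝ (Fin n) → EuclideanSpace ℝ (Fin n) → ℝ} {A δ : ℝ}
    (h : CZBound T K A δ) : CZBound T.adj (fun x y => K y x) A δ where
  kernel := h.kernel.swap
  rep := h.rep.adj h.kernel
  norm_le := by rw [T.norm_adj]; exact h.norm_le

/-- Hölder regularity in each variable separately gives joint continuity off the diagonal, and with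
it the joint measurability that Fubini requires. -/
theorem continuousOn_uncurry_of_regular
    {K : EuclideanSpace ℝ (Fin n) → EuclideanSpace ℝ (Fin n) → ℝ} {A δ : ℝ} (hδ : 0 < δ)
    (hreg : ∀ x x' y, x ≠ y → ‖x - x'‖ ≤ (1 / 2) * ‖x - y‖ →
      |K x y - K x' y| ≤ A * (‖x - x'‖ / ‖x - y‖) ^ δ * (1 / ‖x - y‖ ^ n) ∧
      |K y x - K y x'| ≤ A * (‖x - x'‖ / ‖x - y‖) ^ δ * (1 / ‖x - y‖ ^ n)) :
    ContinuousOn (Function.uncurry K) {z | z.1 ≠ z.2} := by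
  rintro ⟨x, y⟩ hxy
  have hxy' : x ≠ y := hxy
  have hpos : 0 < ‖x - y‖ := norm_pos_iff.2 (sub_ne_zero.2 hxy')
  refine ContinuousAt.continuousWithinAt ?_
  rw [ContinuousAt, tendsto_iff_dist_tendsto_zero]
  have hbound : ∀ᶠ z : EuclideanSpace ℝ (Fin n) × EuclideanSpace ℝ (Fin n) in 𝓝 (x, y),
      dist (Function.uncurry K z) (Function.uncurry K (x, y)) ≤
      A * (‖x - z.1‖ / ‖x - y‖) ^ δ * (1 / ‖x - y‖ ^ n) +
        A * (‖y - z.2‖ / ‖y - z.1‖) ^ δ * (1 / ‖y - z.1‖ ^ n) := by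
    have h1 : ∀ᶠ z : EuclideanSpace ℝ (Fin n) × EuclideanSpace ℝ (Fin n) in 𝓝 (x, y),
        ‖x - z.1‖ < (1 / 2) * ‖x - y‖ := by
      refine ContinuousAt.eventually_lt (by fun_prop) continuousAt_const ?_
      simp; exact sub_ne_zero.2 hxy'
    have h2 : ∀ᶠ z : EuclideanSpace ℝ (Fin n) × EuclideanSpace ℝ (Fin n) in 𝓝 (x, y),
        ‖y - z.2‖ < (1 / 2) * ‖y - z.1‖ := by
      refine ContinuousAt.eventually_lt (by fun_prop) (by fun_prop) ?_
      simp; exact sub_ne_zero.2 hxy'.symm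
    filter_upwards [h1, h2] with z hz1 hz2
    have hne : y ≠ z.1 := by
      rintro h
      rw [← h] at hz1
      linarith
    have a1 := (hreg x z.1 y hxy' hz1.le).1
    have a2 := (hreg y z.2 z.1 hne hz2.le).2
    rw [Real.dist_eq]
    simp only [Function.uncurry]
    rw [abs_sub_comm] at a1 a2
    calc |K z.1 z.2 - K x y| ≤ |K z.1 z.2 - K z.1 y| + |K z.1 y - K x y| := abs_sub_le _ _ _
      _ ≤ _ := by linarith
  refine squeeze_zero' (Eventually.of_forall fun _ => dist_nonneg) hbound ?_
  have hc : ContinuousAt (fun z : EuclideanSpace ℝ (Fin n) × EuclideanSpace ℝ (Fin n) =>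
      A * (‖x - z.1‖ / ‖x - y‖) ^ δ * (1 / ‖x - y‖ ^ n) +
        A * (‖y - z.2‖ / ‖y - z.1‖) ^ δ * (1 / ‖y - z.1‖ ^ n)) (x, y) := by
    have hpos' : ‖y - x‖ ≠ 0 := by rw [norm_sub_rev]; exact hpos.ne'
    refine ContinuousAt.add ?_ ?_
    · refine ContinuousAt.mul (ContinuousAt.mul continuousAt_const ?_) continuousAt_const
      exact ContinuousAt.rpow_const (by fun_prop) (Or.inr hδ.le)
    · refine ContinuousAt.mul (ContinuousAt.mul continuousAt_const ?_) ?_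
      · exact ContinuousAt.rpow_const (ContinuousAt.div (by fun_prop) (by fun_prop) hpos')
          (Or.inr hδ.le)
      · exact ContinuousAt.div continuousAt_const (by fun_prop) (pow_ne_zero _ hpos')
  have := hc.tendsto
  simpa [Real.zero_rpow hδ.ne'] using this

theorem IsCalderonZygmund.exists_bound {T : L2Operator n} (hT : IsCalderonZygmund T) :
    ∃ K A δ, CZBound T K A δ := by
  classical
  obtain ⟨K, ⟨⟨C₁, h1⟩, C₂, δ, hδ, h2⟩, hrep⟩ := hT
  -- Nothing is known on the diagonal; setting the kernel to 0 there makes it measurable and leaves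
  -- the formula off the support unchanged.
  let K' : EuclideanSpace ℝ (Fin n) → EuclideanSpace ℝ (Fin n) → ℝ :=
    fun x y => if x = y then 0 else K x y
  set A := |C₁| + |C₂| + ‖T‖ + 1 with hA
  have hK'eq : ∀ x y, x ≠ y → K' x y = K x y := fun x y h => by simp [K', h]
  have hA1 : C₁ ≤ A := by
    have := le_abs_self C₁; have := abs_nonneg C₂; have := norm_nonneg T; linarith
  have hA2 : C₂ ≤ A := by
    have := le_abs_self C₂; have := abs_nonneg C₁; have := norm_nonneg T; linarith
  have hreg : ∀ x x' y, x ≠ y → ‖x - x'‖ ≤ (1 / 2) * ‖x - y‖ →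
      |K' x y - K' x' y| ≤ A * (‖x - x'‖ / ‖x - y‖) ^ δ * (1 / ‖x - y‖ ^ n) ∧
      |K' y x - K' y x'| ≤ A * (‖x - x'‖ / ‖x - y‖) ^ δ * (1 / ‖x - y‖ ^ n) := by
    intro x x' y hxy hle
    have hpos : 0 < ‖x - y‖ := norm_pos_iff.2 (sub_ne_zero.2 hxy)
    have hne : x' ≠ y := by
      rintro rfl
      linarith
    rw [hK'eq x y hxy, hK'eq x' y hne, hK'eq y x hxy.symm, hK'eq y x' hne.symm]
    obtain ⟨a1, a2⟩ := h2 x x' y hxy hle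
    constructor
    · refine a1.trans ?_
      gcongr
    · refine a2.trans ?_
      gcongr
  have hmeas : Measurable (Function.uncurry K') := by
    have hc := continuousOn_uncurry_of_regular hδ hreg
    have hs : MeasurableSet {z : EuclideanSpace ℝ (Fin n) × EuclideanSpace ℝ (Fin n) |
        z.1 ≠ z.2} := (isOpen_ne_fun continuous_fst continuous_snd).measurableSet
    have := hc.measurable_piecewise (g := fun _ => (0 : ℝ)) continuousOn_const hs
    convert this using 1
    funext z
    by_cases hz : z.1 ≠ z.2
    · rw [Set.piecewise_eq_of_mem _ _ _ hz]
    · rw [Set.piecewise_eq_of_notMem _ _ _ hz]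
      simp only [not_not] at hz
      simp [Function.uncurry, K', hz]
  have hker : KernelBound K' A δ :=
    { pos := by positivity
      exp_pos := hδ
      meas := hmeas
      size := fun x y hxy => by
        rw [hK'eq x y hxy]
        refine (h1 x y hxy).trans ?_
        gcongr
      reg_left := fun x x' y a b => (hreg x x' y a b).1
      reg_right := fun x x' y a b => (hreg x x' y a b).2 }
  refine ⟨K', A, δ, hker, represents_of_smooth hker fun f hf hfc => ?_, ?_⟩
  · filter_upwards [hrep f hf hfc] with x hx hxf
    rw [hx hxf]
    congr 1; funext y
    by_cases hxy : x = y
    · rw [← hxy, image_eq_zero_of_notMem_tsupport hxf]; simp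
    · rw [hK'eq x y hxy]
  · have := abs_nonneg C₁; have := abs_nonneg C₂; linarith

end Kernel

/-! ### Calderón–Zygmund theory -/

section Shells

variable {n : ℕ}

/-- The constant in the summation over dyadic shells. -/
def shellConst (δ : ℝ) : ℝ := ∑' j : ℕ, ((j : ℝ) + 1) * (2 ^ (-δ)) ^ j

theorem summable_shell {δ : ℝ} (hδ : 0 < δ) :
    Summable fun j : ℕ => ((j : ℝ) + 1) * ((2 : ℝ) ^ (-δ)) ^ j := by
  have h1 : (2 : ℝ) ^ (-δ) < 1 := Real.rpow_lt_one_of_one_lt_of_neg (by norm_num) (by linarith)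
  have h0 : (0 : ℝ) ≤ 2 ^ (-δ) := by positivity
  have a := summable_pow_mul_geometric_of_norm_lt_one 1
    (r := (2 : ℝ) ^ (-δ)) (by rwa [Real.norm_of_nonneg h0])
  have b := summable_geometric_of_lt_one h0 h1
  refine (a.add b).congr fun j => ?_
  simp; ring

theorem shellConst_nonneg (δ : ℝ) : 0 ≤ shellConst δ := tsum_nonneg fun j => by positivity

theorem le_norm_sub_of_notMem_cube {c x : EuclideanSpace ℝ (Fin n)} {R : ℝ} (h : x ∉ cube c R) :
    R ≤ ‖x - c‖ := by
  simp only [cube, Set.mem_ofPred_eq, not_forall, not_lt] at h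
  obtain ⟨i, hi⟩ := h
  exact hi.trans (abs_coord_sub_le x c i)

/-- The decay `2 ^ (-δ j)` on the j-th dyadic shell absorbs a weight growing like `j + 1` times the
volume. The linear allowance is what admits |b - b_Q| as a weight. -/
theorem lintegral_compl_cube_le {δ : ℝ} (hδ : 0 < δ) (c : EuclideanSpace ℝ (Fin n)) {R : ℝ}
    (hR : 0 < R) {w : EuclideanSpace ℝ (Fin n) → ℝ≥0∞} (hw : AEMeasurable w) {D : ℝ≥0∞}
    (hD : ∀ j : ℕ, ∫⁻ x in cube c (2 ^ (j + 1) * R), w x ≤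
      D * ENNReal.ofReal ((j + 1) * (2 ^ j * R) ^ n)) :
    ∫⁻ x in (cube c R)ᶜ, ENNReal.ofReal ((R / ‖x - c‖) ^ δ * (1 / ‖x - c‖ ^ n)) * w x ≤
      ENNReal.ofReal (shellConst δ) * D := by
  have hpt : ∀ x ∈ (cube c R)ᶜ,
      ENNReal.ofReal ((R / ‖x - c‖) ^ δ * (1 / ‖x - c‖ ^ n)) * w x ≤
      ∑' j : ℕ, ENNReal.ofReal ((2 ^ (-δ)) ^ j * (1 / (2 ^ j * R) ^ n)) *
        (cube c (2 ^ (j + 1) * R)).indicator w x := by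
    intro x hx
    have hex : ∃ j : ℕ, x ∈ cube c (2 ^ (j + 1) * R) := by
      obtain ⟨j, hj⟩ := pow_unbounded_of_one_lt (‖x - c‖ / R) (by norm_num : (1 : ℝ) < 2)
      refine ⟨j, ball_subset_cube c _ ?_⟩
      rw [Metric.mem_ball, dist_eq_norm]
      rw [div_lt_iff₀ hR] at hj
      refine hj.trans ?_
      gcongr
      · norm_num
      · omega
    classical
    set j := Nat.find hex with hj
    have hj1 : x ∈ cube c (2 ^ (j + 1) * R) := Nat.find_spec hex
    have hj2 : x ∉ cube c (2 ^ j * R) := by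
      rcases Nat.eq_zero_or_pos j with h | h
      · rw [h]; simpa using hx
      · obtain ⟨i, hi⟩ : ∃ i, j = i + 1 := ⟨j - 1, by omega⟩
        rw [hi]
        exact Nat.find_min hex (by omega)
    have hd : 2 ^ j * R ≤ ‖x - c‖ := le_norm_sub_of_notMem_cube hj2
    have hd0 : 0 < 2 ^ j * R := by positivity
    refine le_trans ?_ (ENNReal.le_tsum j)
    rw [Set.indicator_of_mem hj1]
    gcongr
    calc (R / ‖x - c‖) ^ δ ≤ (R / (2 ^ j * R)) ^ δ := by gcongr
      _ = (2 ^ (-δ)) ^ j := by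
        rw [mul_comm, div_mul_cancel_left₀ hR.ne', Real.inv_rpow (by positivity),
          ← Real.rpow_natCast, ← Real.rpow_mul (by norm_num), ← Real.rpow_neg (by norm_num),
          ← Real.rpow_natCast, ← Real.rpow_mul (by norm_num)]
        congr 1; ring
  calc _ ≤ ∫⁻ x in (cube c R)ᶜ, ∑' j : ℕ,
        ENNReal.ofReal ((2 ^ (-δ)) ^ j * (1 / (2 ^ j * R) ^ n)) *
        (cube c (2 ^ (j + 1) * R)).indicator w x :=
        setLIntegral_mono' (measurableSet_cube c R).compl hpt
    _ ≤ ∫⁻ x, ∑' j : ℕ, ENNReal.ofReal ((2 ^ (-δ)) ^ j * (1 / (2 ^ j * R) ^ n)) *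
        (cube c (2 ^ (j + 1) * R)).indicator w x := setLIntegral_le_lintegral _ _
    _ = ∑' j : ℕ, ENNReal.ofReal ((2 ^ (-δ)) ^ j * (1 / (2 ^ j * R) ^ n)) *
        ∫⁻ x in cube c (2 ^ (j + 1) * R), w x := by
        rw [lintegral_tsum fun j => (hw.indicator (measurableSet_cube _ _)).const_mul _]
        congr 1; funext j
        rw [lintegral_const_mul' _ _ ENNReal.ofReal_ne_top,
          lintegral_indicator (measurableSet_cube _ _)]
    _ ≤ ∑' j : ℕ, ENNReal.ofReal (((j : ℝ) + 1) * (2 ^ (-δ)) ^ j) * D := by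
        refine ENNReal.tsum_le_tsum fun j => ?_
        refine (mul_le_mul_right (hD j) _).trans (le_of_eq ?_)
        rw [mul_left_comm, mul_comm D, ← ENNReal.ofReal_mul (by positivity)]
        congr 2
        field_simp
    _ = _ := by
        rw [ENNReal.tsum_mul_right, ← ENNReal.ofReal_tsum_of_nonneg (fun j => by positivity)
          (summable_shell hδ)]
        rfl

/-- Since `h` has mean zero, `K x c` may be subtracted from the kernel, and its Hölder regularity
provides the decay. The weight is 1 for `T` itself and |b - b_Q| for commutators. -/
theorem lintegral_mul_enorm_onFun_le {T : L2Operator n}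
    {K : EuclideanSpace ℝ (Fin n) → EuclideanSpace ℝ (Fin n) → ℝ} {A δ : ℝ}
    (hT : CZBound T K A δ) {h : EuclideanSpace ℝ (Fin n) → ℝ} (hh : MemLp h 2)
    {c : EuclideanSpace ℝ (Fin n)} {r : ℝ} (hr : 0 < r)
    (h0 : ∀ x, x ∉ Metric.closedBall c (2 ^ n * r) → h x = 0) (hmean : ∫ x, h x = 0)
    {w : EuclideanSpace ℝ (Fin n) → ℝ≥0∞} (hw : AEMeasurable w) {D : ℝ≥0∞}
    (hD : ∀ j : ℕ, ∫⁻ x in cube c (2 ^ (j + 1) * (2 ^ (n + 1) * r)), w x ≤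
      D * ENNReal.ofReal ((j + 1) * (2 ^ j * (2 ^ (n + 1) * r)) ^ n)) :
    ∫⁻ x in (cube c (2 ^ (n + 1) * r))ᶜ, w x * ‖T.onFun h x‖ₑ ≤
      ENNReal.ofReal (A * shellConst δ) * D * ∫⁻ x, ‖h x‖ₑ := by
  have hK := hT.kernel
  have hA := hK.pos
  set R := 2 ^ (n + 1) * r with hR
  have hR0 : 0 < R := by positivity
  -- The excluded cube has twice the radius of the ball containing the support, exactly the
  -- separation that kernel regularity asks for.
  have hRρ : R = 2 * (2 ^ n * r) := by rw [hR, pow_succ]; ring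
  set F := Metric.closedBall c (2 ^ n * r)
  have hFb : Bornology.IsBounded F := Metric.isBounded_closedBall
  have hFc : IsClosed F := Metric.isClosed_closedBall
  have hpt : ∀ᵐ x, x ∈ (cube c R)ᶜ → w x * ‖T.onFun h x‖ₑ ≤
      (ENNReal.ofReal A * ∫⁻ x, ‖h x‖ₑ) *
        (ENNReal.ofReal ((R / ‖x - c‖) ^ δ * (1 / ‖x - c‖ ^ n)) * w x) := by
    filter_upwards [hT.rep h hh F hFc hFb h0] with x hx hxR
    have hd : R ≤ ‖x - c‖ := le_norm_sub_of_notMem_cube hxR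
    have hxF : x ∉ F := by
      rw [Metric.mem_closedBall, dist_eq_norm]
      have : 0 < 2 ^ n * r := by positivity
      linarith
    have hxc : c ≠ x := by
      rintro rfl
      simp at hd; linarith
    have hint := integrable_of_memLp_two_of_bounded hh hFb h0
    have e : T.onFun h x = ∫ y, (K x y - K x c) * h y := by
      rw [hx hxF]
      simp_rw [sub_mul]
      rw [integral_sub (hK.integrable_mul hh hFc hFb h0 hxF) (hint.const_mul _),
        integral_const_mul, hmean, mul_zero, sub_zero]
    have hb : ‖T.onFun h x‖ₑ ≤ ENNReal.ofReal (A * ((R / ‖x - c‖) ^ δ * (1 / ‖x - c‖ ^ n))) *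
        ∫⁻ y, ‖h y‖ₑ := by
      rw [e, ← lintegral_const_mul' _ _ ENNReal.ofReal_ne_top]
      refine (enorm_integral_le_lintegral_enorm _).trans (lintegral_mono fun y => ?_)
      rw [enorm_mul]
      by_cases hy : y ∈ F
      · gcongr
        rw [Real.enorm_eq_ofReal_abs, abs_sub_comm]
        apply ENNReal.ofReal_le_ofReal
        rw [Metric.mem_closedBall, dist_eq_norm, norm_sub_rev] at hy
        have hd' : R ≤ ‖c - x‖ := by rwa [norm_sub_rev]
        refine (hK.reg_right c y x hxc (by linarith)).trans ?_
        rw [mul_assoc, norm_sub_rev c x]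
        have hδ := hK.exp_pos
        gcongr
        have : 0 < 2 ^ n * r := by positivity
        linarith
      · simp [h0 y hy]
    refine (mul_le_mul_right hb _).trans (le_of_eq ?_)
    rw [ENNReal.ofReal_mul hA.le]
    ring
  calc _ ≤ ∫⁻ x in (cube c R)ᶜ, (ENNReal.ofReal A * ∫⁻ x, ‖h x‖ₑ) *
        (ENNReal.ofReal ((R / ‖x - c‖) ^ δ * (1 / ‖x - c‖ ^ n)) * w x) :=
        lintegral_mono_ae ((ae_restrict_iff' (measurableSet_cube c R).compl).2 hpt)
    _ = (ENNReal.ofReal A * ∫⁻ x, ‖h x‖ₑ) * ∫⁻ x in (cube c R)ᶜ,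
        (ENNReal.ofReal ((R / ‖x - c‖) ^ δ * (1 / ‖x - c‖ ^ n)) * w x) := by
        rw [lintegral_const_mul']
        have := integrable_of_memLp_two_of_bounded hh hFb h0
        exact ENNReal.mul_ne_top ENNReal.ofReal_ne_top this.2.ne
    _ ≤ (ENNReal.ofReal A * ∫⁻ x, ‖h x‖ₑ) * (ENNReal.ofReal (shellConst δ) * D) := by
        gcongr
        exact lintegral_compl_cube_le hK.exp_pos c hR0 hw hD
    _ = _ := by rw [ENNReal.ofReal_mul hA.le]; ring

theorem lintegral_one_shell_le (c : EuclideanSpace ℝ (Fin n)) {R : ℝ} (hR : 0 < R) (j : ℕ) :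
    ∫⁻ _ in cube c (2 ^ (j + 1) * R), (1 : ℝ≥0∞) ≤
      ENNReal.ofReal (4 ^ n) * ENNReal.ofReal ((j + 1) * (2 ^ j * R) ^ n) := by
  rw [setLIntegral_const, one_mul, volume_cube _ (by positivity),
    ← ENNReal.ofReal_mul (by positivity)]
  apply ENNReal.ofReal_le_ofReal
  have : (2 * (2 ^ (j + 1) * R)) ^ n = 4 ^ n * (2 ^ j * R) ^ n := by
    rw [← mul_pow]; congr 1; rw [pow_succ]; ring
  rw [this]
  have hj : (0 : ℝ) ≤ j := by positivity
  gcongr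
  exact le_mul_of_one_le_left (by positivity) (by linarith)

end Shells

/-! ### The Calderón–Zygmund decomposition. -/

section Decomposition

variable {n : ℕ}

/-- The cubes of the dyadic grid with origin `0` and top-level side `s`. -/
def stopCube (s : ℝ) (q : ℕ × (Fin n → ℤ)) : Set (EuclideanSpace ℝ (Fin n)) :=
  gridCube 0 (s / 2 ^ q.1) q.2

/-- The centre of a dyadic cube. -/
def stopCenter (s : ℝ) (q : ℕ × (Fin n → ℤ)) : EuclideanSpace ℝ (Fin n) :=
  gridCenter 0 (s / 2 ^ q.1) q.2

/-- Half the side of a dyadic cube. -/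
def stopRadius (s : ℝ) (q : ℕ × (Fin n → ℤ)) : ℝ := s / 2 ^ q.1 / 2

theorem stopRadius_pos {s : ℝ} (hs : 0 < s) (q : ℕ × (Fin n → ℤ)) : 0 < stopRadius s q := by
  unfold stopRadius; positivity

theorem measurableSet_stopCube (s : ℝ) (q : ℕ × (Fin n → ℤ)) : MeasurableSet (stopCube s q) :=
  measurableSet_gridCube _ _ _

theorem stopCube_ae_eq {s : ℝ} (hs : 0 < s) (q : ℕ × (Fin n → ℤ)) :
    stopCube s q =ᵐ[volume] cube (stopCenter s q) (stopRadius s q) :=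
  gridCube_ae_eq_cube 0 (by positivity) _

theorem volume_stopCube {s : ℝ} (hs : 0 < s) (q : ℕ × (Fin n → ℤ)) :
    volume (stopCube s q) = ENNReal.ofReal ((2 * stopRadius s q) ^ n) := by
  rw [measure_congr (stopCube_ae_eq hs q), volume_cube _ (stopRadius_pos hs q)]

theorem volume_stopCube_ne_zero {s : ℝ} (hs : 0 < s) (q : ℕ × (Fin n → ℤ)) :
    volume (stopCube s q) ≠ 0 := volume_gridCube_ne_zero 0 (by positivity) _

theorem volume_stopCube_ne_top {s : ℝ} (hs : 0 < s) (q : ℕ × (Fin n → ℤ)) :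
    volume (stopCube s q) ≠ ∞ := volume_gridCube_ne_top 0 (by positivity) _

theorem stopCube_subset_closedBall {s : ℝ} (hs : 0 < s) (q : ℕ × (Fin n → ℤ)) :
    stopCube s q ⊆ Metric.closedBall (stopCenter s q) (2 ^ n * stopRadius s q) := by
  intro y hy
  have hr := stopRadius_pos hs q
  rw [Metric.mem_closedBall, dist_eq_norm]
  refine (norm_sub_le_of_forall_abs hr.le
    fun i => abs_sub_gridCenter_le (by positivity) hy i).trans ?_
  gcongr
  exact_mod_cast Nat.lt_two_pow_self.le

theorem exists_stopCubes (hn : 1 ≤ n) {v : EuclideanSpace ℝ (Fin n) → ℝ}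
    (hv : AEStronglyMeasurable v) {p : ℝ} (hp : 1 ≤ p) (hvp : ∫⁻ x, ‖v x‖ₑ ^ p ≠ ∞) {t : ℝ}
    (ht : 0 < t) :
    ∃ s : ℝ, 0 < s ∧ ∃ S : Set (ℕ × (Fin n → ℤ)), S.PairwiseDisjoint (stopCube s) ∧
      (∀ q ∈ S, ENNReal.ofReal (t ^ p) * volume (stopCube s q) ≤
        ∫⁻ y in stopCube s q, ‖v y‖ₑ ^ p) ∧
      (∀ q ∈ S, ∫⁻ y in stopCube s q, ‖v y‖ₑ ^ p ≤
        ENNReal.ofReal (2 ^ n * t ^ p) * volume (stopCube s q)) ∧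
      ∀ᵐ x, x ∉ ⋃ q ∈ S, stopCube s q → |v x| ≤ t := by
  have hp0 : 0 < p := by linarith
  set u : EuclideanSpace ℝ (Fin n) → ℝ := fun x => |v x| ^ p with hu
  have hun : ∀ x, ‖u x‖ₑ = ‖v x‖ₑ ^ p := fun x => by
    rw [Real.enorm_eq_ofReal (by positivity), Real.enorm_eq_ofReal_abs,
      ENNReal.ofReal_rpow_of_nonneg (abs_nonneg _) hp0.le]
  have hui : Integrable u := by
    refine ⟨?_, ?_⟩
    · exact ((Real.continuous_rpow_const hp0.le).comp continuous_abs).comp_aestronglyMeasurable hv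
    · rw [hasFiniteIntegral_iff_enorm]; simp_rw [hun]; exact hvp.lt_top
  set I := ∫⁻ x, ‖v x‖ₑ ^ p with hI
  -- The top cubes are so large that the average of `|v| ^ p` over any of them is at most `t ^ p`;
  -- having side at least 1 gives `s ≤ s ^ n`.
  set s : ℝ := max 1 (I.toReal / t ^ p) with hs
  have hs0 : 0 < s := lt_of_lt_of_le one_pos (le_max_left _ _)
  have htp : 0 < t ^ p := by positivity
  obtain ⟨S, h1, h2, h3, h4⟩ := exists_stopping_cubes hui.locallyIntegrable 0 hs0
    (ENNReal.ofReal (t ^ p)) (fun m => by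
      simp_rw [hun]
      refine (setLIntegral_le_lintegral _ _).trans ?_
      rw [volume_gridCube 0 hs0, ← ENNReal.ofReal_mul htp.le, ← hI, ← ENNReal.ofReal_toReal hvp]
      apply ENNReal.ofReal_le_ofReal
      have h5 : I.toReal / t ^ p ≤ s := le_max_right _ _
      rw [div_le_iff₀ htp] at h5
      have h6 : s ≤ s ^ n := le_self_pow₀ (le_max_left _ _) (by omega)
      nlinarith)
  simp_rw [hun] at h2 h3
  refine ⟨s, hs0, S, h1, fun q hq => (h2 q hq).le, fun q hq => ?_, ?_⟩
  · refine (h3 q hq).trans (le_of_eq ?_)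
    rw [ENNReal.ofReal_mul (by positivity), ENNReal.ofReal_pow (by norm_num)]
    simp [stopCube]
  · filter_upwards [h4] with x hx hxS
    have h5 := hx hxS
    rw [hun, Real.enorm_eq_ofReal_abs, ENNReal.ofReal_rpow_of_nonneg (abs_nonneg _) hp0.le,
      ENNReal.ofReal_le_ofReal_iff htp.le] at h5
    exact (Real.rpow_le_rpow_iff (abs_nonneg _) ht.le hp0).1 h5

theorem tsum_volume_stopCube_le {s t p : ℝ} (ht : 0 < t)
    {v : EuclideanSpace ℝ (Fin n) → ℝ} {S : Set (ℕ × (Fin n → ℤ))}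
    (hdisj : S.PairwiseDisjoint (stopCube s))
    (hlow : ∀ q ∈ S, ENNReal.ofReal (t ^ p) * volume (stopCube s q) ≤
        ∫⁻ y in stopCube s q, ‖v y‖ₑ ^ p) :
    ∑' q : S, volume (stopCube s q.1) ≤ ENNReal.ofReal (1 / t ^ p) * ∫⁻ x, ‖v x‖ₑ ^ p := by
  have htp : 0 < t ^ p := by positivity
  have h1 : ENNReal.ofReal (t ^ p) * ∑' q : S, volume (stopCube s q.1) ≤ ∫⁻ x, ‖v x‖ₑ ^ p := by
    rw [← ENNReal.tsum_mul_left]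
    calc _ ≤ ∑' q : S, ∫⁻ y in stopCube s q.1, ‖v y‖ₑ ^ p := by
          gcongr with q; exact hlow q q.2
      _ = ∫⁻ y in ⋃ q ∈ S, stopCube s q, ‖v y‖ₑ ^ p :=
          (lintegral_biUnion S.to_countable (fun q _ => measurableSet_stopCube _ _) hdisj _).symm
      _ ≤ _ := setLIntegral_le_lintegral _ _
  have h2 := mul_le_mul_right h1 (ENNReal.ofReal (1 / t ^ p))
  rwa [← mul_assoc, ← ENNReal.ofReal_mul (by positivity), one_div_mul_cancel htp.ne',
    ENNReal.ofReal_one, one_mul] at h2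

theorem lintegral_le_of_lintegral_rpow_le {Q : Set (EuclideanSpace ℝ (Fin n))}
    (hQ : volume Q ≠ ∞) {f : EuclideanSpace ℝ (Fin n) → ℝ} (hf : AEStronglyMeasurable f) {p t : ℝ}
    (hp : 1 ≤ p) (ht : 0 ≤ t)
    (h : ∫⁻ y in Q, ‖f y‖ₑ ^ p ≤ ENNReal.ofReal (2 ^ n * t ^ p) * volume Q) :
    ∫⁻ y in Q, ‖f y‖ₑ ≤ ENNReal.ofReal (2 ^ n * t) * volume Q := by
  have hp0 : 0 < p := by linarith
  rcases eq_or_ne (volume Q) 0 with h0 | h0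
  · rw [setLIntegral_measure_zero _ _ h0]; exact zero_le
  have h1 := lintegral_rpow_le_measure_rpow_mul (μ := volume.restrict Q)
    (g := fun y => ‖f y‖ₑ) hf.enorm.restrict hp
  rw [Measure.restrict_apply_univ] at h1
  rw [← ENNReal.rpow_le_rpow_iff hp0]
  refine h1.trans ((mul_le_mul_right h _).trans ?_)
  rw [ENNReal.mul_rpow_of_nonneg _ _ hp0.le, mul_left_comm,
    ENNReal.ofReal_rpow_of_nonneg (by positivity) hp0.le]
  have e : volume Q ^ (p - 1) * volume Q = volume Q ^ p := by
    nth_rewrite 2 [← ENNReal.rpow_one (volume Q)]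
    rw [← ENNReal.rpow_add _ _ h0 hQ]
    congr 1; ring
  rw [e]
  gcongr
  rw [Real.mul_rpow (by positivity) ht]
  gcongr
  exact Real.self_le_rpow_of_one_le (one_le_pow₀ (by norm_num)) hp

/-- The Calderón–Zygmund decomposition of `f` at height `t`: a good part `g`, finitely many
atoms with mean zero, and an error `e` which is as small as desired in `L²`. -/
theorem exists_cz_decomposition (hn : 1 ≤ n) {f : EuclideanSpace ℝ (Fin n) → ℝ} (hf : MemLp f 2)
    {p : ℝ} (hp1 : 1 ≤ p) (hp2 : p ≤ 2) (hfp : ∫⁻ x, ‖f x‖ₑ ^ p ≠ ∞) {t : ℝ} (ht : 0 < t)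
    {κ ε : ℝ≥0∞} (hκ : κ ≠ ∞) (hε : ε ≠ 0) :
    ∃ s : ℝ, 0 < s ∧ ∃ (J : Finset (ℕ × (Fin n → ℤ))) (g e : EuclideanSpace ℝ (Fin n) → ℝ)
      (m : ℕ × (Fin n → ℤ) → ℝ),
      (∀ x, f x = g x + e x + ∑ q ∈ J, (stopCube s q).indicator (fun y => f y - m q) x) ∧
      MemLp g 2 ∧ MemLp e 2 ∧ κ * ∫⁻ x, ‖e x‖ₑ ^ (2 : ℝ) ≤ ε ∧
      ∫⁻ x, ‖g x‖ₑ ^ (2 : ℝ) ≤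
        ENNReal.ofReal ((1 + 4 ^ n) * t ^ (2 - p)) * ∫⁻ x, ‖f x‖ₑ ^ p ∧
      (∀ q ∈ J, ∫ x in stopCube s q, (f x - m q) = 0) ∧ (∀ q ∈ J, |m q| ≤ 2 ^ n * t) ∧
      (∀ q ∈ J, ∫⁻ y in stopCube s q, ‖f y‖ₑ ^ p ≤
        ENNReal.ofReal (2 ^ n * t ^ p) * volume (stopCube s q)) ∧
      ∑ q ∈ J, volume (stopCube s q) ≤ ENNReal.ofReal (1 / t ^ p) * ∫⁻ x, ‖f x‖ₑ ^ p := by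
  classical
  obtain ⟨s, hs, S, hdisj, hlow, hup, hoff⟩ := exists_stopCubes hn hf.1 hp1 hfp ht
  have htsum := tsum_volume_stopCube_le ht hdisj hlow
  have hSc : Countable S := S.to_countable.to_subtype
  have hf2 : ∫⁻ x, ‖f x‖ₑ ^ (2 : ℝ) ≠ ∞ := by
    have := (eLpNorm_lt_top_iff_lintegral_rpow_enorm_lt_top (p := 2) (by norm_num) (by norm_num)).1
      hf.2
    simpa using this.ne
  have hdisjS : Pairwise (Function.onFun Disjoint fun q : S => stopCube s q.1) := fun a b hab =>
    hdisj a.2 b.2 (fun h => hab (Subtype.ext h))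
  have htail : ∑' q : S, ∫⁻ x in stopCube s q.1, ‖f x‖ₑ ^ (2 : ℝ) ≠ ∞ := by
    rw [← lintegral_iUnion (fun q : S => measurableSet_stopCube s q.1) hdisjS]
    exact ne_top_of_le_ne_top hf2 (setLIntegral_le_lintegral _ _)
  -- Keeping only finitely many atoms lets `T` act termwise. The restriction of `f` to the discarded
  -- cubes is left untouched as the error `e`, small in `L²` because its squared norm is the tail of
  -- a convergent series.
  have htend : Tendsto (fun J : Finset S => κ * ∑' q : {q : S // q ∉ J},
      ∫⁻ x in stopCube s q.1.1, ‖f x‖ₑ ^ (2 : ℝ)) atTop (𝓝 0) := by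
    have := ENNReal.Tendsto.const_mul (a := κ)
      (ENNReal.tendsto_tsum_compl_atTop_zero htail) (Or.inr hκ)
    simpa using this
  obtain ⟨J₀, hJ₀⟩ := (htend.eventually (ge_mem_nhds (pos_iff_ne_zero.2 hε))).exists
  set Ω : Set (EuclideanSpace ℝ (Fin n)) := ⋃ q ∈ S, stopCube s q with hΩ
  have hΩm : MeasurableSet Ω :=
    MeasurableSet.biUnion S.to_countable fun q _ => measurableSet_stopCube s q
  set J : Finset (ℕ × (Fin n → ℤ)) := J₀.map (Function.Embedding.subtype _) with hJ
  have hJS : ∀ q ∈ J, q ∈ S := fun q hq => by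
    rw [hJ, Finset.mem_map] at hq
    obtain ⟨q', _, rfl⟩ := hq
    exact q'.2
  set m : ℕ × (Fin n → ℤ) → ℝ := fun q => ⨍ y in stopCube s q, f y with hm
  have hfint : ∀ q, IntegrableOn f (stopCube s q) := fun q => by
    have : IsFiniteMeasure (volume.restrict (stopCube s q)) :=
      ⟨by simpa using (volume_stopCube_ne_top hs q).lt_top⟩
    exact (hf.restrict _).integrable (by norm_num)
  have hmle : ∀ q ∈ J, |m q| ≤ 2 ^ n * t := by
    intro q hq
    have h1 := measure_mul_enorm_setAverage_sub_le (volume_stopCube_ne_top hs q) (hfint q) 0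
    simp only [sub_zero] at h1
    have h2 := h1.trans (lintegral_le_of_lintegral_rpow_le (volume_stopCube_ne_top hs q) hf.1 hp1
      ht.le (hup q (hJS q hq)))
    rw [mul_comm, ENNReal.mul_le_mul_iff_left (volume_stopCube_ne_zero hs q)
      (volume_stopCube_ne_top hs q), Real.enorm_eq_ofReal_abs,
      ENNReal.ofReal_le_ofReal_iff (by positivity)] at h2
    exact h2
  set U : Set (EuclideanSpace ℝ (Fin n)) := ⋃ q : {q : S // q ∉ J₀}, stopCube s q.1.1 with hU
  have hUm : MeasurableSet U := MeasurableSet.iUnion fun q => measurableSet_stopCube s _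
  have hUΩ : U ⊆ Ω := Set.iUnion_subset fun q => Set.subset_biUnion_of_mem q.1.2
  set g : EuclideanSpace ℝ (Fin n) → ℝ := fun x => Ωᶜ.indicator f x +
    ∑ q ∈ J, (stopCube s q).indicator (fun _ => m q) x with hg
  set e : EuclideanSpace ℝ (Fin n) → ℝ := U.indicator f with he
  have huniq : ∀ q ∈ S, ∀ q' ∈ S, ∀ x, x ∈ stopCube s q → x ∈ stopCube s q' → q = q' := by
    intro q hq q' hq' x hx hx'
    by_contra hne
    exact Set.disjoint_left.1 (hdisj hq hq' hne) hx hx'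
  refine ⟨s, hs, J, g, e, m, ?_, ?_, hf.indicator hUm, ?_, ?_, ?_, hmle,
    fun q hq => hup q (hJS q hq), ?_⟩
  · intro x
    have hsplit : ∑ q ∈ J, (stopCube s q).indicator (fun _ => m q) x +
        ∑ q ∈ J, (stopCube s q).indicator (fun y => f y - m q) x =
        ∑ q ∈ J, (stopCube s q).indicator f x := by
      rw [← Finset.sum_add_distrib]
      refine Finset.sum_congr rfl fun q _ => ?_
      by_cases hx : x ∈ stopCube s q <;> simp [hx]
    have hgoal : f x = Ωᶜ.indicator f x + e x + ∑ q ∈ J, (stopCube s q).indicator f x := by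
      by_cases hxΩ : x ∈ Ω
      · rw [Set.indicator_of_notMem (by simpa using hxΩ), zero_add]
        obtain ⟨q, hq, hxq⟩ := Set.mem_iUnion₂.1 hxΩ
        by_cases hqJ : q ∈ J
        · have hxU : x ∉ U := by
            intro h
            obtain ⟨q', hxq'⟩ := Set.mem_iUnion.1 h
            have := huniq q hq q'.1.1 q'.1.2 x hxq hxq'
            subst this
            rw [hJ, Finset.mem_map] at hqJ
            obtain ⟨q'', h1, h2⟩ := hqJ
            exact q'.2 (by rwa [← Subtype.ext h2])
          rw [he, Set.indicator_of_notMem hxU, zero_add, Finset.sum_eq_single_of_mem q hqJ,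
            Set.indicator_of_mem hxq]
          intro q' hq' hne
          exact Set.indicator_of_notMem (fun h => hne (huniq q' (hJS q' hq') q hq x h hxq)) _
        · have hxU : x ∈ U := by
            refine Set.mem_iUnion.2 ⟨⟨⟨q, hq⟩, fun h => hqJ ?_⟩, hxq⟩
            rw [hJ, Finset.mem_map]
            exact ⟨_, h, rfl⟩
          rw [he, Set.indicator_of_mem hxU, Finset.sum_eq_zero, add_zero]
          intro q' hq'
          refine Set.indicator_of_notMem (fun h => hqJ ?_) _
          rwa [← huniq q' (hJS q' hq') q hq x h hxq]
      · rw [Set.indicator_of_mem (by simpa using hxΩ), he,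
          Set.indicator_of_notMem (fun h => hxΩ (hUΩ h)), Finset.sum_eq_zero, add_zero, add_zero]
        intro q hq
        exact Set.indicator_of_notMem
          (fun h => hxΩ (Set.mem_biUnion (hJS q hq) h)) _
    rw [hg]
    linarith
  · refine (hf.indicator hΩm.compl).add (memLp_finsetSum J fun q _ => ?_)
    exact memLp_indicator_const _ (measurableSet_stopCube s q) _
      (Or.inr (volume_stopCube_ne_top hs q))
  · refine le_trans (le_of_eq ?_) hJ₀
    congr 1
    have h1 : ∀ x, ‖e x‖ₑ ^ (2 : ℝ) = U.indicator (fun x => ‖f x‖ₑ ^ (2 : ℝ)) x := fun x => by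
      by_cases hx : x ∈ U
      · rw [he, Set.indicator_of_mem hx, Set.indicator_of_mem hx]
      · rw [he, Set.indicator_of_notMem hx, Set.indicator_of_notMem hx]
        simp
    rw [lintegral_congr h1, lintegral_indicator hUm, hU, lintegral_iUnion (fun q => measurableSet_stopCube s _)]
    intro a b hab
    exact hdisjS fun h => hab (Subtype.ext h)
  -- Off the stopping cubes |f| ≤ t, so |f|² ≤ t^(2-p) |f|^p because p ≤ 2; on a kept cube `g` is
  -- the mean, at most `2 ^ n * t`.
  · have hpt : ∀ᵐ x, ‖g x‖ₑ ^ (2 : ℝ) ≤ ENNReal.ofReal (t ^ (2 - p)) * ‖f x‖ₑ ^ p +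
        ∑ q ∈ J, (stopCube s q).indicator (fun _ => ENNReal.ofReal (4 ^ n * t ^ (2 : ℝ))) x := by
      filter_upwards [hoff] with x hx
      by_cases hxJ : ∃ q ∈ J, x ∈ stopCube s q
      · obtain ⟨q, hq, hxq⟩ := hxJ
        have hxΩ : x ∈ Ω := Set.mem_biUnion (hJS q hq) hxq
        have hgx : g x = m q := by
          rw [hg]
          simp only
          rw [Set.indicator_of_notMem (by simpa using hxΩ), zero_add,
            Finset.sum_eq_single_of_mem q hq, Set.indicator_of_mem hxq]
          intro q' hq' hne
          exact Set.indicator_of_notMem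
            (fun h => hne (huniq q' (hJS q' hq') q (hJS q hq) x h hxq)) _
        refine le_trans ?_ le_add_self
        refine le_trans ?_ (Finset.single_le_sum (f := fun q => (stopCube s q).indicator
          (fun _ => ENNReal.ofReal (4 ^ n * t ^ (2 : ℝ))) x) (fun _ _ => zero_le) hq)
        rw [Set.indicator_of_mem hxq, hgx, Real.enorm_eq_ofReal_abs,
          ENNReal.ofReal_rpow_of_nonneg (abs_nonneg _) (by norm_num)]
        apply ENNReal.ofReal_le_ofReal
        calc |m q| ^ (2 : ℝ) ≤ (2 ^ n * t) ^ (2 : ℝ) := by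
              gcongr
              exact hmle q hq
          _ = _ := by
            rw [Real.mul_rpow (by positivity) ht.le]
            congr 1
            rw [Real.rpow_two, ← pow_mul, mul_comm, pow_mul]
            norm_num
      · push Not at hxJ
        have hsum0 : ∑ q ∈ J, (stopCube s q).indicator (fun _ => m q) x = 0 :=
          Finset.sum_eq_zero fun q hq => Set.indicator_of_notMem (hxJ q hq) _
        have hgx : g x = Ωᶜ.indicator f x := by rw [hg]; simp only; rw [hsum0, add_zero]
        refine le_trans ?_ le_self_add
        rw [hgx]
        by_cases hxΩ : x ∈ Ω
        · rw [Set.indicator_of_notMem (by simpa using hxΩ)]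
          simp
        · rw [Set.indicator_of_mem (by simpa using hxΩ), Real.enorm_eq_ofReal_abs,
            ENNReal.ofReal_rpow_of_nonneg (abs_nonneg _) (by norm_num),
            ENNReal.ofReal_rpow_of_nonneg (abs_nonneg _) (by linarith),
            ← ENNReal.ofReal_mul (by positivity)]
          apply ENNReal.ofReal_le_ofReal
          have h1 := hx hxΩ
          rcases (abs_nonneg (f x)).eq_or_lt with h0 | h0
          · rw [← h0, Real.zero_rpow (by norm_num)]; positivity
          · rw [show (2 : ℝ) = (2 - p) + p by ring, Real.rpow_add h0]
            rw [show (2 : ℝ) - p + p - p = 2 - p by ring]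
            gcongr
    refine (lintegral_mono_ae hpt).trans ?_
    rw [lintegral_add_right, lintegral_const_mul' _ _ ENNReal.ofReal_ne_top,
      lintegral_finsetSum]
    · simp_rw [lintegral_indicator_const (measurableSet_stopCube s _)]
      rw [← Finset.mul_sum, add_mul, one_mul, ENNReal.ofReal_add (by positivity) (by positivity),
        add_mul]
      refine add_le_add le_rfl ?_
      have hsumle : ∑ q ∈ J, volume (stopCube s q) ≤
          ENNReal.ofReal (1 / t ^ p) * ∫⁻ x, ‖f x‖ₑ ^ p := by
        rw [hJ, Finset.sum_map]
        exact (ENNReal.sum_le_tsum J₀).trans htsum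
      refine (mul_le_mul_right hsumle _).trans (le_of_eq ?_)
      rw [← mul_assoc, ← ENNReal.ofReal_mul (by positivity)]
      congr 2
      rw [Real.rpow_sub ht]
      ring
    · exact fun q _ => measurable_const.indicator (measurableSet_stopCube s q)
    · exact Finset.measurable_sum _ fun q _ =>
        measurable_const.indicator (measurableSet_stopCube s q)
  · intro q _
    rw [integral_sub (hfint q) (integrableOn_const (volume_stopCube_ne_top hs q)),
      setIntegral_const, hm]
    simp only [setAverage_eq, smul_eq_mul]
    rw [← mul_assoc, mul_inv_cancel₀, one_mul, sub_self]
    exact (ENNReal.toReal_pos (volume_stopCube_ne_zero hs q) (volume_stopCube_ne_top hs q)).ne'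
  · rw [hJ, Finset.sum_map]
    exact (ENNReal.sum_le_tsum J₀).trans htsum

end Decomposition

/-! ### Chebyshev-type estimates for level sets. -/

section LevelSets

variable {X : Type*} [MeasurableSpace X] {μ : Measure X}

theorem measure_lt_abs_le {F : X → ℝ} (hF : AEStronglyMeasurable F μ) {p t : ℝ} (hp : 0 < p)
    (ht : 0 < t) :
    μ {x | t < |F x|} ≤ ENNReal.ofReal (1 / t ^ p) * ∫⁻ x, ‖F x‖ₑ ^ p ∂μ := by
  have h := mul_meas_ge_le_lintegral₀ (μ := μ) (hF.enorm.pow_const p) (ENNReal.ofReal (t ^ p))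
  have htp : 0 < t ^ p := by positivity
  have h2 := mul_le_mul_right h (ENNReal.ofReal (1 / t ^ p))
  rw [← mul_assoc, ← ENNReal.ofReal_mul (by positivity), one_div_mul_cancel htp.ne',
    ENNReal.ofReal_one, one_mul] at h2
  refine (measure_mono fun x hx => ?_).trans h2
  rw [Set.mem_ofPred_eq] at hx ⊢
  rw [Real.enorm_eq_ofReal_abs, ENNReal.ofReal_rpow_of_nonneg (abs_nonneg _) hp.le]
  apply ENNReal.ofReal_le_ofReal
  gcongr

theorem measure_lt_abs_add_le {F F₁ F₂ : X → ℝ} (h : F =ᵐ[μ] fun x => F₁ x + F₂ x) (a b : ℝ) :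
    μ {x | a + b < |F x|} ≤ μ {x | a < |F₁ x|} + μ {x | b < |F₂ x|} := by
  refine le_trans (measure_mono_ae ?_) (measure_union_le _ _)
  filter_upwards [h] with x hx hlt
  have hlt' : a + b < |F x| := hlt
  rw [hx] at hlt'
  by_contra hcon
  have h1 : ¬ (a < |F₁ x| ∨ b < |F₂ x|) := hcon
  push Not at h1
  have := abs_add_le (F₁ x) (F₂ x)
  linarith

/-- Each summand is measured in `L¹` outside its own exceptional set; the exceptional sets are
merely counted by measure. In the applications `E q` is a dilate of the cube carrying the q-th atom.
-/
theorem measure_lt_abs_sum_le {ι : Type*} (J : Finset ι) {G : ι → X → ℝ}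
    (hG : ∀ q ∈ J, AEStronglyMeasurable (G q) μ) {E : ι → Set X}
    (hE : ∀ q ∈ J, MeasurableSet (E q)) {t : ℝ} (ht : 0 < t) :
    μ {x | t < |∑ q ∈ J, G q x|} ≤ ∑ q ∈ J, μ (E q) +
      ENNReal.ofReal (1 / t) * ∑ q ∈ J, ∫⁻ x in (E q)ᶜ, ‖G q x‖ₑ ∂μ := by
  set W : X → ℝ≥0∞ := fun x => ∑ q ∈ J, (E q)ᶜ.indicator (fun x => ‖G q x‖ₑ) x with hW
  have hWm : AEMeasurable W μ :=
    Finset.aemeasurable_fun_sum J fun q hq => (hG q hq).enorm.indicator (hE q hq).compl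
  have hsub : {x | t < |∑ q ∈ J, G q x|} ⊆ (⋃ q ∈ J, E q) ∪ {x | ENNReal.ofReal t ≤ W x} := by
    intro x hx
    by_cases hxE : x ∈ ⋃ q ∈ J, E q
    · exact Or.inl hxE
    · right
      have hxE' : ∀ q ∈ J, x ∉ E q := fun q hq h => hxE (Set.mem_biUnion hq h)
      have e : W x = ∑ q ∈ J, ‖G q x‖ₑ := Finset.sum_congr rfl fun q hq =>
        Set.indicator_of_mem (by exact hxE' q hq) _
      rw [Set.mem_ofPred_eq, e]
      refine le_trans ?_ (enorm_sum_le J fun q => G q x)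
      rw [Real.enorm_eq_ofReal_abs]
      exact ENNReal.ofReal_le_ofReal (le_of_lt hx)
  refine (measure_mono hsub).trans ((measure_union_le _ _).trans ?_)
  gcongr
  · exact measure_biUnion_finset_le J E
  · have h1 := mul_meas_ge_le_lintegral₀ hWm (ENNReal.ofReal t)
    have h2 := mul_le_mul_right h1 (ENNReal.ofReal (1 / t))
    rw [← mul_assoc, ← ENNReal.ofReal_mul (by positivity), one_div_mul_cancel ht.ne',
      ENNReal.ofReal_one, one_mul] at h2
    refine h2.trans (le_of_eq ?_)
    rw [hW, lintegral_finsetSum' J fun q hq => (hG q hq).enorm.indicator (hE q hq).compl]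
    congr 1
    exact Finset.sum_congr rfl fun q hq => lintegral_indicator (hE q hq).compl _

theorem lintegral_enorm_rpow_two_eq {f : X → ℝ} :
    ∫⁻ x, ‖f x‖ₑ ^ (2 : ℝ) ∂μ = eLpNorm f 2 μ ^ (2 : ℝ) := by
  rw [eLpNorm_eq_lintegral_rpow_enorm_toReal (by norm_num) (by norm_num), ← ENNReal.rpow_mul]
  norm_num

theorem MeasureTheory.MemLp.lintegral_rpow_two_ne_top {f : X → ℝ} (hf : MemLp f 2 μ) :
    ∫⁻ x, ‖f x‖ₑ ^ (2 : ℝ) ∂μ ≠ ∞ := by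
  rw [lintegral_enorm_rpow_two_eq]
  exact ENNReal.rpow_ne_top_of_nonneg (by norm_num) hf.2.ne

end LevelSets

/-! ### Weak type (p, p) of Calderón–Zygmund operators, 1 ≤ p ≤ 2. -/

section WeakType

variable {n : ℕ}

theorem L2Operator.lintegral_onFun_le (T : L2Operator n) {A : ℝ} (hA : ‖T‖ ≤ A)
    {f : EuclideanSpace ℝ (Fin n) → ℝ} (hf : MemLp f 2) :
    ∫⁻ x, ‖T.onFun f x‖ₑ ^ (2 : ℝ) ≤ ENNReal.ofReal (A ^ 2) * ∫⁻ x, ‖f x‖ₑ ^ (2 : ℝ) := by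
  have hA0 : 0 ≤ A := (norm_nonneg T).trans hA
  rw [lintegral_enorm_rpow_two_eq, lintegral_enorm_rpow_two_eq]
  refine (ENNReal.rpow_le_rpow (T.eLpNorm_onFun_le hf) (by norm_num)).trans ?_
  rw [ENNReal.mul_rpow_of_nonneg _ _ (by norm_num)]
  gcongr
  rw [ENNReal.ofReal_rpow_of_nonneg (norm_nonneg T) (by norm_num), Real.rpow_two]
  gcongr

theorem L2Operator.volume_lt_onFun_le (T : L2Operator n) {A : ℝ} (hA : ‖T‖ ≤ A)
    {f : EuclideanSpace ℝ (Fin n) → ℝ} (hf : MemLp f 2) {t : ℝ} (ht : 0 < t) :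
    volume {x | t < |T.onFun f x|} ≤
      ENNReal.ofReal (A ^ 2 / t ^ (2 : ℝ)) * ∫⁻ x, ‖f x‖ₑ ^ (2 : ℝ) := by
  refine (measure_lt_abs_le (T.memLp_onFun f).1 (p := 2) (by norm_num) ht).trans ?_
  refine (mul_le_mul_right (T.lintegral_onFun_le hA hf) _).trans (le_of_eq ?_)
  rw [← mul_assoc, ← ENNReal.ofReal_mul (by positivity)]
  congr 2
  ring

theorem volume_cube_stop_le {s : ℝ} (hs : 0 < s) (q : ℕ × (Fin n → ℤ)) :
    volume (cube (stopCenter s q) (2 ^ (n + 1) * stopRadius s q)) =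
      ENNReal.ofReal ((2 ^ (n + 1)) ^ n) * volume (stopCube s q) := by
  have hr := stopRadius_pos hs q
  rw [volume_stopCube hs, volume_cube _ (by positivity), ← ENNReal.ofReal_mul (by positivity),
    ← mul_pow]
  congr 2
  ring

theorem memLp_atom {f : EuclideanSpace ℝ (Fin n) → ℝ} (hf : MemLp f 2) {s : ℝ} (hs : 0 < s)
    (q : ℕ × (Fin n → ℤ)) (m : ℝ) : MemLp ((stopCube s q).indicator fun y => f y - m) 2 := by
  rw [memLp_indicator_iff_restrict (measurableSet_stopCube s q)]
  have : IsFiniteMeasure (volume.restrict (stopCube s q)) :=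
    ⟨by simpa using (volume_stopCube_ne_top hs q).lt_top⟩
  exact (hf.restrict _).sub (memLp_const m)

theorem atom_eq_zero {f : EuclideanSpace ℝ (Fin n) → ℝ} {s : ℝ} (hs : 0 < s)
    (q : ℕ × (Fin n → ℤ)) {x : EuclideanSpace ℝ (Fin n)}
    (hx : x ∉ Metric.closedBall (stopCenter s q) (2 ^ n * stopRadius s q)) :
    (stopCube s q).indicator f x = 0 :=
  Set.indicator_of_notMem (fun h => hx (stopCube_subset_closedBall hs q h)) _

theorem lintegral_atom_le {f : EuclideanSpace ℝ (Fin n) → ℝ} (hf : MemLp f 2) {s : ℝ}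
    (hs : 0 < s) {q : ℕ × (Fin n → ℤ)} {m p t : ℝ} (hp : 1 ≤ p) (ht : 0 < t)
    (hm : |m| ≤ 2 ^ n * t)
    (h : ∫⁻ y in stopCube s q, ‖f y‖ₑ ^ p ≤
        ENNReal.ofReal (2 ^ n * t ^ p) * volume (stopCube s q)) :
    ∫⁻ x, ‖(stopCube s q).indicator (fun y => f y - m) x‖ₑ ≤
      ENNReal.ofReal (2 ^ (n + 1) * t) * volume (stopCube s q) := by
  have h1 := lintegral_le_of_lintegral_rpow_le (volume_stopCube_ne_top hs q) hf.1 hp ht.le h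
  simp_rw [enorm_indicator_eq_indicator_enorm]
  rw [lintegral_indicator (measurableSet_stopCube s q)]
  calc ∫⁻ x in stopCube s q, ‖f x - m‖ₑ
      ≤ ∫⁻ x in stopCube s q, (‖f x‖ₑ + ENNReal.ofReal (2 ^ n * t)) := by
        gcongr with x
        refine enorm_sub_le.trans ?_
        gcongr
        rw [Real.enorm_eq_ofReal_abs]
        exact ENNReal.ofReal_le_ofReal hm
    _ = (∫⁻ x in stopCube s q, ‖f x‖ₑ) + ENNReal.ofReal (2 ^ n * t) * volume (stopCube s q) := by
        rw [lintegral_add_right _ measurable_const, setLIntegral_const]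
    _ ≤ ENNReal.ofReal (2 ^ n * t) * volume (stopCube s q) +
        ENNReal.ofReal (2 ^ n * t) * volume (stopCube s q) := by gcongr
    _ = _ := by
        rw [← add_mul, ← ENNReal.ofReal_add (by positivity) (by positivity)]
        congr 2
        rw [pow_succ]; ring

/-- The constant in the weak type inequalities for Calderón–Zygmund operators. -/
def weakConst (n : ℕ) (A δ : ℝ) : ℝ :=
  9 * (A ^ 2 * (1 + 4 ^ n) + (2 ^ (n + 1)) ^ n + A * shellConst δ * 4 ^ n * 2 ^ (n + 1))

theorem weakConst_nonneg (n : ℕ) {A : ℝ} (hA : 0 ≤ A) (δ : ℝ) : 0 ≤ weakConst n A δ := by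
  have := shellConst_nonneg δ
  unfold weakConst; positivity

/-- The weak type `(p, p)` inequality, uniformly for `1 ≤ p ≤ 2`. -/
theorem CZBound.weak_type (hn : 1 ≤ n) {T : L2Operator n}
    {K : EuclideanSpace ℝ (Fin n) → EuclideanSpace ℝ (Fin n) → ℝ} {A δ : ℝ}
    (hT : CZBound T K A δ) {f : EuclideanSpace ℝ (Fin n) → ℝ} (hf : MemLp f 2) {p : ℝ}
    (hp1 : 1 ≤ p) (hp2 : p ≤ 2) {t : ℝ} (ht : 0 < t) :
    volume {x | t < |T.onFun f x|} ≤
      ENNReal.ofReal (weakConst n A δ / t ^ p) * ∫⁻ x, ‖f x‖ₑ ^ p := by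
  have hA := hT.kernel.pos
  have hsh := shellConst_nonneg δ
  have hp0 : 0 < p := by linarith
  set I := ∫⁻ x, ‖f x‖ₑ ^ p with hI
  set C₀ : ℝ := A ^ 2 * (1 + 4 ^ n) + (2 ^ (n + 1)) ^ n +
    A * shellConst δ * 4 ^ n * 2 ^ (n + 1) with hC₀
  have hC₀pos : 0 < C₀ := by positivity
  -- One unit of height for each of the good part, the error and the atoms; returning to height `t`
  -- costs `3 ^ p ≤ 9`, the 9 in `weakConst`.
  suffices h3 : ∀ t : ℝ, 0 < t → volume {x | 3 * t < |T.onFun f x|} ≤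
      ENNReal.ofReal (C₀ / t ^ p) * I by
    have h := h3 (t / 3) (by positivity)
    rw [mul_div_cancel₀ _ (by norm_num : (3 : ℝ) ≠ 0)] at h
    refine h.trans (mul_le_mul_left (ENNReal.ofReal_le_ofReal ?_) _)
    rw [Real.div_rpow ht.le (by norm_num), weakConst, ← hC₀, div_div_eq_mul_div, mul_comm 9]
    have := Real.rpow_pos_of_pos ht p
    refine div_le_div_of_nonneg_right (mul_le_mul_of_nonneg_left ?_ hC₀pos.le) this.le
    calc (3 : ℝ) ^ p ≤ 3 ^ (2 : ℝ) := Real.rpow_le_rpow_of_exponent_le (by norm_num) hp2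
      _ = 9 := by norm_num
  clear ht t
  intro t ht
  have htp : 0 < t ^ p := by positivity
  rcases eq_or_ne I ∞ with hItop | hItop
  · rw [hItop, ENNReal.mul_top]
    · exact le_top
    · simp only [ne_eq, ENNReal.ofReal_eq_zero, not_le]; positivity
  -- The slack `ε` is filled by the `L²` error of the decomposition.
  refine ENNReal.le_of_forall_pos_le_add fun ε hε _ => ?_
  obtain ⟨s, hs, J, g, e, m, hdec, hg, he, hesm, hgn, hmean, hm, hJp, hJvol⟩ :=
    exists_cz_decomposition hn hf hp1 hp2 hItop ht
      (κ := ENNReal.ofReal (A ^ 2 / t ^ (2 : ℝ))) ENNReal.ofReal_ne_top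
      (ε := (ε : ℝ≥0∞)) (by simpa using hε.ne')
  set h : ℕ × (Fin n → ℤ) → EuclideanSpace ℝ (Fin n) → ℝ :=
    fun q => (stopCube s q).indicator fun y => f y - m q with hh
  have hhm : ∀ q, MemLp (h q) 2 := fun q => memLp_atom hf hs q (m q)
  have hsumm : MemLp (fun x => ∑ q ∈ J, h q x) 2 := memLp_finsetSum J fun q _ => hhm q
  have hTf : T.onFun f =ᵐ[volume] fun x => T.onFun g x + (T.onFun e x + ∑ q ∈ J, T.onFun (h q) x) := by
    have h1 : f = fun x => g x + (e x + ∑ q ∈ J, h q x) := by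
      funext x; rw [hdec x]; ring
    have hes : MemLp (fun x => e x + ∑ q ∈ J, h q x) 2 := he.add hsumm
    have h2 := T.onFun_add hg hes
    have h3 := T.onFun_add he hsumm
    have h4 := T.onFun_finset_sum J fun q _ => hhm q
    rw [← h1] at h2
    filter_upwards [h2, h3, h4] with x a1 a2 a3
    rw [a1, ← a3, ← a2]
  have hlev : volume {x | 3 * t < |T.onFun f x|} ≤ volume {x | t < |T.onFun g x|} +
      (volume {x | t < |T.onFun e x|} + volume {x | t < |∑ q ∈ J, T.onFun (h q) x|}) := by
    rw [show 3 * t = t + (t + t) by ring]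
    refine (measure_lt_abs_add_le hTf t (t + t)).trans ?_
    gcongr
    exact measure_lt_abs_add_le (ae_eq_refl _) t t
  have hgood : volume {x | t < |T.onFun g x|} ≤
      ENNReal.ofReal (A ^ 2 * (1 + 4 ^ n) / t ^ p) * I := by
    refine (T.volume_lt_onFun_le hT.norm_le hg ht).trans ?_
    refine (mul_le_mul_right hgn _).trans (le_of_eq ?_)
    rw [← mul_assoc, ← ENNReal.ofReal_mul (by positivity)]
    congr 2
    rw [Real.rpow_sub ht]
    field_simp
  have herr : volume {x | t < |T.onFun e x|} ≤ ε :=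
    (T.volume_lt_onFun_le hT.norm_le he ht).trans hesm
  have hbad : volume {x | t < |∑ q ∈ J, T.onFun (h q) x|} ≤
      ENNReal.ofReal (((2 ^ (n + 1)) ^ n + A * shellConst δ * 4 ^ n * 2 ^ (n + 1)) / t ^ p) * I := by
    refine (measure_lt_abs_sum_le J (fun q _ => (T.memLp_onFun (h q)).1)
      (E := fun q => cube (stopCenter s q) (2 ^ (n + 1) * stopRadius s q))
      (fun q _ => measurableSet_cube _ _) ht).trans ?_
    have h1 : ∀ q ∈ J, ∫⁻ x in (cube (stopCenter s q) (2 ^ (n + 1) * stopRadius s q))ᶜ,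
        ‖T.onFun (h q) x‖ₑ ≤ ENNReal.ofReal (A * shellConst δ * 4 ^ n * 2 ^ (n + 1) * t) *
          volume (stopCube s q) := by
      intro q hq
      have hr := stopRadius_pos hs q
      have h2 := lintegral_mul_enorm_onFun_le hT (hhm q) hr
        (fun x hx => atom_eq_zero hs q hx) (by
          rw [hh]; simp only
          rw [integral_indicator (measurableSet_stopCube s q)]
          exact hmean q hq) (w := fun _ => 1) aemeasurable_const (D := ENNReal.ofReal (4 ^ n))
        (fun j => lintegral_one_shell_le _ (by positivity) j)
      simp only [one_mul] at h2
      refine h2.trans ?_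
      refine (mul_le_mul_right (lintegral_atom_le hf hs hp1 ht (hm q hq) (hJp q hq)) _).trans
        (le_of_eq ?_)
      rw [← mul_assoc, ← ENNReal.ofReal_mul (by positivity), ← ENNReal.ofReal_mul (by positivity)]
      congr 2
      ring
    calc _ ≤ ∑ q ∈ J, ENNReal.ofReal ((2 ^ (n + 1)) ^ n) * volume (stopCube s q) +
          ENNReal.ofReal (1 / t) * ∑ q ∈ J,
            ENNReal.ofReal (A * shellConst δ * 4 ^ n * 2 ^ (n + 1) * t) * volume (stopCube s q) := by
          refine add_le_add (Finset.sum_le_sum fun q _ => (volume_cube_stop_le hs q).le) ?_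
          gcongr with q hq
          exact h1 q hq
      _ = ENNReal.ofReal ((2 ^ (n + 1)) ^ n + A * shellConst δ * 4 ^ n * 2 ^ (n + 1)) *
          ∑ q ∈ J, volume (stopCube s q) := by
          rw [← Finset.mul_sum, ← Finset.mul_sum, ← mul_assoc, ← ENNReal.ofReal_mul (by positivity),
            ← add_mul, ← ENNReal.ofReal_add (by positivity) (by positivity)]
          congr 3
          field_simp
      _ ≤ _ := by
          refine (mul_le_mul_right hJvol _).trans (le_of_eq ?_)
          rw [← mul_assoc, ← ENNReal.ofReal_mul (by positivity)]
          congr 2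
          ring
  calc _ ≤ _ := hlev
    _ ≤ ENNReal.ofReal (A ^ 2 * (1 + 4 ^ n) / t ^ p) * I + (ε +
        ENNReal.ofReal (((2 ^ (n + 1)) ^ n + A * shellConst δ * 4 ^ n * 2 ^ (n + 1)) / t ^ p) * I) := by
        gcongr
    _ = ENNReal.ofReal (C₀ / t ^ p) * I + ε := by
        rw [add_left_comm, add_comm, ← add_mul, ← ENNReal.ofReal_add (by positivity) (by positivity)]
        congr 3
        rw [hC₀]; ring

end WeakType

/-! ### Kolmogorov's inequality and Hölder's inequality for averages. -/

section Integration

variable {X : Type*} [MeasurableSpace X] {μ : Measure X}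

/-- Kolmogorov's inequality: functions in weak `L^r`, `r > 1`, are locally integrable. -/
theorem setLIntegral_enorm_le_of_weak {F : X → ℝ} (hF : AEStronglyMeasurable F μ) {r a : ℝ}
    (hr : 1 < r) (ha : 0 < a) {W : ℝ≥0∞}
    (h : ∀ s, 0 < s → μ {x | s < |F x|} ≤ ENNReal.ofReal (1 / s ^ r) * W) (E : Set X) :
    ∫⁻ x in E, ‖F x‖ₑ ∂μ ≤
      ENNReal.ofReal a * μ E + ENNReal.ofReal (a ^ (1 - r) / (r - 1)) * W := by
  have h1 : ∫⁻ x in E, ‖F x‖ₑ ∂μ = ∫⁻ s in Set.Ioi (0 : ℝ), (μ.restrict E) {x | s < |F x|} := by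
    simp_rw [Real.enorm_eq_ofReal_abs]
    exact lintegral_eq_lintegral_meas_lt _ (Eventually.of_forall fun x => abs_nonneg _)
      hF.restrict.aemeasurable.abs
  -- Below height `a` the level sets are bounded by `μ E`, above it by the weak type hypothesis,
  -- integrable at infinity since `r > 1`.
  rw [h1, ← Set.Ioc_union_Ioi_eq_Ioi ha.le, lintegral_union measurableSet_Ioi
    (Set.disjoint_left.2 fun x hx hx' => not_lt.2 hx.2 hx')]
  gcongr
  · calc _ ≤ ∫⁻ _ in Set.Ioc (0 : ℝ) a, μ E := by
          refine lintegral_mono fun s => ?_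
          exact (measure_mono (Set.subset_univ _)).trans (by rw [Measure.restrict_apply_univ])
      _ = _ := by rw [setLIntegral_const, Real.volume_Ioc, sub_zero, mul_comm]
  · calc _ ≤ ∫⁻ s in Set.Ioi a, ENNReal.ofReal (s ^ (-r)) * W := by
          refine setLIntegral_mono_ae' measurableSet_Ioi (ae_of_all _ fun s hs => ?_)
          have hs0 : 0 < s := ha.trans hs
          refine (Measure.restrict_apply_le _ _).trans ((h s hs0).trans (le_of_eq ?_))
          rw [Real.rpow_neg hs0.le, one_div]
      _ = ENNReal.ofReal (∫ s in Set.Ioi a, s ^ (-r)) * W := by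
          rw [lintegral_mul_const _ (by fun_prop), ofReal_integral_eq_lintegral_ofReal
            (integrableOn_Ioi_rpow_of_lt (by linarith) ha)]
          exact (ae_restrict_iff' measurableSet_Ioi).2 (ae_of_all _ fun s hs =>
            Real.rpow_nonneg (ha.trans hs).le _)
      _ = _ := by
          rw [integral_Ioi_rpow_of_lt (by linarith) ha]
          congr 2
          rw [show -r + 1 = 1 - r by ring, show 1 - r = -(r - 1) by ring, neg_div_neg_eq]

/-- Hölder's inequality for averages. -/
theorem lintegral_mul_le_of_lintegral_rpow {u v : X → ℝ≥0∞} (hu : AEMeasurable u μ)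
    (hv : AEMeasurable v μ) {p q a b : ℝ} (hpq : p.HolderConjugate q) (ha : 0 ≤ a) (hb : 0 ≤ b)
    {V : ℝ≥0∞} (h1 : ∫⁻ x, u x ^ p ∂μ ≤ ENNReal.ofReal (a ^ p) * V)
    (h2 : ∫⁻ x, v x ^ q ∂μ ≤ ENNReal.ofReal (b ^ q) * V) :
    ∫⁻ x, u x * v x ∂μ ≤ ENNReal.ofReal (a * b) * V := by
  have hp := hpq.pos
  have hq := hpq.symm.pos
  have key : ∀ {c r : ℝ}, 0 ≤ c → 0 < r → (ENNReal.ofReal (c ^ r) * V) ^ (1 / r) =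
      ENNReal.ofReal c * V ^ (1 / r) := fun {c r} hc hr => by
    rw [ENNReal.mul_rpow_of_nonneg _ _ (by positivity),
      ENNReal.ofReal_rpow_of_nonneg (by positivity) (by positivity), ← Real.rpow_mul hc,
      mul_one_div_cancel hr.ne', Real.rpow_one]
  calc _ ≤ (∫⁻ x, u x ^ p ∂μ) ^ (1 / p) * (∫⁻ x, v x ^ q ∂μ) ^ (1 / q) :=
        ENNReal.lintegral_mul_le_Lp_mul_Lq μ hpq hu hv
    _ ≤ (ENNReal.ofReal (a ^ p) * V) ^ (1 / p) * (ENNReal.ofReal (b ^ q) * V) ^ (1 / q) := by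
        gcongr
    _ = ENNReal.ofReal (a * b) * (V ^ (1 / p) * V ^ (1 / q)) := by
        rw [key ha hp, key hb hq, ENNReal.ofReal_mul ha]; ring
    _ = _ := by
        rw [← ENNReal.rpow_add_of_nonneg _ _ (by positivity) (by positivity), one_div, one_div,
          hpq.inv_add_inv_eq_one, ENNReal.rpow_one]

theorem MeasureTheory.MemLp.bdd_mul_two {b f : X → ℝ} (hf : MemLp f 2 μ)
    (hb : AEStronglyMeasurable b μ) {B : ℝ} (hB : ∀ x, |b x| ≤ B) :
    MemLp (fun x => b x * f x) 2 μ :=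
  hf.of_le_mul (c := B) (hb.mul hf.1) (ae_of_all _ fun x => by
    rw [norm_mul]; exact mul_le_mul_of_nonneg_right (hB x) (norm_nonneg _))

end Integration

/-! ### Local mean oscillation of commutators. -/

section Local

variable {n : ℕ}

/-- Here the averages of |v| itself are stopped although `v` is only square integrable;
Cauchy–Schwarz on each cube controls the top cubes and makes the total volume finite, which the
later absorption needs. -/
theorem exists_stopCubes_of_memLp_two (hn : 1 ≤ n) {v : EuclideanSpace ℝ (Fin n) → ℝ}
    (hv : MemLp v 2) {t : ℝ} (ht : 0 < t) :
    ∃ s : ℝ, 0 < s ∧ ∃ S : Set (ℕ × (Fin n → ℤ)), S.PairwiseDisjoint (stopCube s) ∧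
      (∀ q ∈ S, ENNReal.ofReal t * volume (stopCube s q) ≤ ∫⁻ y in stopCube s q, ‖v y‖ₑ) ∧
      (∀ q ∈ S, ∫⁻ y in stopCube s q, ‖v y‖ₑ ≤
        ENNReal.ofReal (2 ^ n * t) * volume (stopCube s q)) ∧
      (∀ᵐ x, x ∉ ⋃ q ∈ S, stopCube s q → |v x| ≤ t) ∧
      ∑' q : S, volume (stopCube s q.1) ≠ ∞ := by
  set I := ∫⁻ x, ‖v x‖ₑ ^ (2 : ℝ) with hI
  have hI0 : I ≠ ∞ := hv.lintegral_rpow_two_ne_top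
  set s : ℝ := max 1 (I.toReal / t ^ (2 : ℝ)) with hs
  have hs0 : 0 < s := lt_of_lt_of_le one_pos (le_max_left _ _)
  have htp : 0 < t ^ (2 : ℝ) := by positivity
  have jensen : ∀ Q : Set (EuclideanSpace ℝ (Fin n)), (∫⁻ y in Q, ‖v y‖ₑ) ^ (2 : ℝ) ≤
      volume Q * ∫⁻ y in Q, ‖v y‖ₑ ^ (2 : ℝ) := fun Q => by
    have h := lintegral_rpow_le_measure_rpow_mul (μ := volume.restrict Q)
      (g := fun y => ‖v y‖ₑ) hv.1.enorm.restrict (p := 2) (by norm_num)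
    rw [Measure.restrict_apply_univ] at h
    norm_num at h ⊢
    exact h
  obtain ⟨S, h1, h2, h3, h4⟩ := exists_stopping_cubes
    (hv.locallyIntegrable (by norm_num)) 0 hs0 (ENNReal.ofReal t) (fun m => by
      rw [← ENNReal.rpow_le_rpow_iff (z := 2) (by norm_num)]
      refine (jensen _).trans ?_
      rw [ENNReal.mul_rpow_of_nonneg _ _ (by norm_num), ENNReal.rpow_two (volume _), sq,
        ← mul_assoc, mul_comm]
      gcongr ?_ * _
      refine (setLIntegral_le_lintegral _ _).trans ?_
      rw [volume_gridCube 0 hs0, ENNReal.ofReal_rpow_of_nonneg ht.le (by norm_num),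
        ← ENNReal.ofReal_mul htp.le, ← hI, ← ENNReal.ofReal_toReal hI0]
      apply ENNReal.ofReal_le_ofReal
      have h5 : I.toReal / t ^ (2 : ℝ) ≤ s := le_max_right _ _
      rw [div_le_iff₀ htp, mul_comm] at h5
      have h6 : s ≤ s ^ n := le_self_pow₀ (le_max_left _ _) (by omega)
      exact h5.trans (mul_le_mul_of_nonneg_left h6 htp.le))
  refine ⟨s, hs0, S, h1, fun q hq => (h2 q hq).le, fun q hq => ?_, ?_, ?_⟩
  · refine (h3 q hq).trans (le_of_eq ?_)
    rw [ENNReal.ofReal_mul (by positivity), ENNReal.ofReal_pow (by norm_num)]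
    simp [stopCube]
  · filter_upwards [h4] with x hx hxS
    have h5 := hx hxS
    rwa [Real.enorm_eq_ofReal_abs, ENNReal.ofReal_le_ofReal_iff ht.le] at h5
  · refine ne_top_of_le_ne_top (ENNReal.mul_ne_top ENNReal.ofReal_ne_top hI0)
      (tsum_volume_stopCube_le (p := 2) ht h1 fun q hq => ?_)
    have h6 := (ENNReal.rpow_le_rpow (h2 q hq).le (z := 2) (by norm_num)).trans (jensen _)
    rw [ENNReal.mul_rpow_of_nonneg _ _ (by norm_num), ENNReal.rpow_two (volume _), sq,
      ← mul_assoc, mul_comm] at h6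
    have h7 := (ENNReal.mul_le_mul_iff_right (volume_stopCube_ne_zero hs0 q)
      (volume_stopCube_ne_top hs0 q)).1 h6
    rwa [ENNReal.ofReal_rpow_of_nonneg ht.le (by norm_num)] at h7

/-- Commutators do not see constants added to the symbol, so on each cube `b` may be centred at its
average there. -/
theorem opCommutator_ae_eq (T : L2Operator n) {b f : EuclideanSpace ℝ (Fin n) → ℝ}
    (hf : MemLp f 2) (hbf : MemLp (fun x => b x * f x) 2) (m : ℝ) :
    opCommutator b T.onFun f =ᵐ[volume] fun x =>
      (b x - m) * T.onFun f x - T.onFun (fun y => (b y - m) * f y) x := by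
  have h1 := T.onFun_sub hbf (hf.const_mul m)
  have h2 := T.onFun_const_mul m hf
  have e : (fun y => (b y - m) * f y) = fun y => b y * f y - m * f y := by
    funext y; ring
  filter_upwards [h1, h2] with x a1 a2
  rw [e, a1, a2, opCommutator]; ring

/-- The part of the function far from a cube produces a nearly constant image on it. The comparison
value is the kernel integral at the centre, since `T u`, being a class, has no value at a point. -/
theorem CZBound.enorm_onFun_sub_le {T : L2Operator n}
    {K : EuclideanSpace ℝ (Fin n) → EuclideanSpace ℝ (Fin n) → ℝ} {A δ : ℝ}
    (hT : CZBound T K A δ) {u : EuclideanSpace ℝ (Fin n) → ℝ} (hu : MemLp u 2)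
    {c : EuclideanSpace ℝ (Fin n)} {r : ℝ} (hr : 0 < r)
    {F : Set (EuclideanSpace ℝ (Fin n))} (hF : IsClosed F) (hFb : Bornology.IsBounded F)
    (h0 : ∀ x ∉ F, u x = 0) (h1 : ∀ x ∈ cube c (2 ^ (n + 1) * r), u x = 0) :
    ∀ᵐ x, x ∈ cube c r → ‖T.onFun u x - ∫ y, K c y * u y‖ₑ ≤
      ENNReal.ofReal A * ∫⁻ y in (cube c (2 ^ (n + 1) * r))ᶜ,
        ENNReal.ofReal ((2 ^ (n + 1) * r / ‖y - c‖) ^ δ * (1 / ‖y - c‖ ^ n)) * ‖u y‖ₑ := by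
  have hK := hT.kernel
  have hA := hK.pos
  set R := 2 ^ (n + 1) * r with hR
  have hR0 : 0 < R := by positivity
  have hrR : r ≤ R := by
    rw [hR]; exact le_mul_of_one_le_left hr.le (one_le_pow₀ (by norm_num))
  set G := F ∩ (cube c R)ᶜ with hG
  have hGc : IsClosed G := hF.inter (isOpen_cube c R).isClosed_compl
  have hGb : Bornology.IsBounded G := hFb.subset Set.inter_subset_left
  have hG0 : ∀ x ∉ G, u x = 0 := fun x hx => by
    by_cases hxR : x ∈ cube c R
    · exact h1 x hxR
    · exact h0 x fun hxF => hx ⟨hxF, hxR⟩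
  have hcG : c ∉ G := fun h => h.2 (mem_cube_self c hR0)
  filter_upwards [hT.rep u hu G hGc hGb hG0] with x hx hxr
  have hxG : x ∉ G := fun h => h.2 (cube_subset_cube c hrR hxr)
  have hxc : ‖c - x‖ ≤ n * r := by
    rw [norm_sub_rev]
    exact norm_sub_le_of_forall_abs hr.le fun i => (hxr i).le
  have hnr : (n : ℝ) * r ≤ 2 ^ n * r := by
    gcongr; exact_mod_cast Nat.lt_two_pow_self.le
  have h2R : R = 2 * (2 ^ n * r) := by rw [hR, pow_succ]; ring
  rw [hx hxG, ← integral_sub (hK.integrable_mul hu hGc hGb hG0 hxG)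
    (hK.integrable_mul hu hGc hGb hG0 hcG), ← lintegral_const_mul' _ _ ENNReal.ofReal_ne_top,
    ← lintegral_indicator (measurableSet_cube c R).compl]
  refine (enorm_integral_le_lintegral_enorm _).trans (lintegral_mono fun y => ?_)
  by_cases hy : y ∈ cube c R
  · simp [h1 y hy]
  rw [Set.indicator_of_mem (by exact hy), ← sub_mul, enorm_mul, ← mul_assoc,
    ← ENNReal.ofReal_mul hA.le]
  gcongr
  rw [Real.enorm_eq_ofReal_abs, abs_sub_comm]
  apply ENNReal.ofReal_le_ofReal
  have hd : R ≤ ‖y - c‖ := le_norm_sub_of_notMem_cube hy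
  have hcy : c ≠ y := by
    rintro rfl; simp at hd; linarith
  refine (hK.reg_left c x y hcy (by rw [norm_sub_rev c y]; linarith)).trans ?_
  rw [mul_assoc, norm_sub_rev c y]
  have hδ := hK.exp_pos
  have : 0 < 2 ^ n * r := by positivity
  gcongr
  linarith

/-- The constant in the local oscillation estimate for commutators. -/
def oscConst (n : ℕ) (A δ β : ℝ) : ℝ :=
  2 ^ (n + 6) * 2 * β + 2 ^ (n + 7) * 4 * β * (n + 2) * (1 + 3 * weakConst n A δ * (2 ^ (n + 1)) ^ n)
    + A * shellConst δ * (2 ^ (n + 7) * 2 * β * (n + 3) * 4 ^ n)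

theorem oscConst_pos (n : ℕ) {A β : ℝ} (hA : 0 < A) (δ : ℝ) (hβ : 0 < β) :
    0 < oscConst n A δ β := by
  have := shellConst_nonneg δ
  have := weakConst_nonneg n hA.le δ
  unfold oscConst; positivity

theorem holderConjugate_two_two : (2 : ℝ).HolderConjugate 2 := Real.HolderConjugate.two_two

/-- With w = b - b_Q, the commutator is w·Tf - T(wf). The first term is handled by Cauchy–Schwarz.
In the second, the part of wf near the cube lies in `L^(4/3)`, so weak type plus Kolmogorov bound
the mean of its image; the far part varies little and contributes the constant `m`. -/
theorem CZBound.exists_lintegral_opCommutator_sub_le (hn : 1 ≤ n) {T : L2Operator n}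
    {K : EuclideanSpace ℝ (Fin n) → EuclideanSpace ℝ (Fin n) → ℝ} {A δ : ℝ}
    (hT : CZBound T K A δ) {b : EuclideanSpace ℝ (Fin n) → ℝ} {β B : ℝ} (hb : BMOBound b β)
    (hB : ∀ x, |b x| ≤ B) {f : EuclideanSpace ℝ (Fin n) → ℝ} (hf : MemLp f 2)
    {F : Set (EuclideanSpace ℝ (Fin n))} (hF : IsClosed F) (hFb : Bornology.IsBounded F)
    (h0 : ∀ x ∉ F, f x = 0) (c : EuclideanSpace ℝ (Fin n)) {r l : ℝ} (hr : 0 < r) (hl : 0 < l)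
    (h1 : ∫⁻ x in cube c r, ‖T.onFun f x‖ₑ ^ (2 : ℝ) ≤
      ENNReal.ofReal (l ^ (2 : ℝ)) * volume (cube c r))
    (h2 : ∀ j : ℕ, ∫⁻ x in cube c (2 ^ j * r), ‖f x‖ₑ ^ (2 : ℝ) ≤
      ENNReal.ofReal (l ^ (2 : ℝ)) * volume (cube c (2 ^ j * r))) :
    ∃ m : ℝ, ∫⁻ x in cube c r, ‖opCommutator b T.onFun f x - m‖ₑ ≤
      ENNReal.ofReal (oscConst n A δ β * l) * volume (cube c r) := by
  have hA := hT.kernel.pos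
  have hβ := hb.pos
  have hsh := shellConst_nonneg δ
  have hwc := weakConst_nonneg n hA.le δ
  have hbm : AEStronglyMeasurable b volume := hb.locInt.aestronglyMeasurable
  set R := 2 ^ (n + 1) * r with hR
  have hR0 : 0 < R := by positivity
  set d := cubeAvg b c r with hd
  set w : EuclideanSpace ℝ (Fin n) → ℝ := fun x => b x - d with hw
  have hwm : AEStronglyMeasurable w volume := hbm.sub aestronglyMeasurable_const
  have hwB : ∀ x, |w x| ≤ B + |d| := fun x =>
    (abs_sub _ _).trans (by linarith [hB x])
  have hbf := hf.bdd_mul_two hbm hB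
  have hwf : MemLp (fun x => w x * f x) 2 := hf.bdd_mul_two hwm hwB
  set h : EuclideanSpace ℝ (Fin n) → ℝ := (cube c R).indicator fun x => w x * f x with hh
  set u : EuclideanSpace ℝ (Fin n) → ℝ := (cube c R)ᶜ.indicator fun x => w x * f x with hu
  have hhm : MemLp h 2 := hwf.indicator (measurableSet_cube c R)
  have hum : MemLp u 2 := hwf.indicator (measurableSet_cube c R).compl
  have hsum : (fun x => w x * f x) = fun x => h x + u x := by
    funext x
    by_cases hx : x ∈ cube c R <;> simp [hh, hu, hx]
  set m' := ∫ y, K c y * u y with hm'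
  refine ⟨-m', ?_⟩
  have hdec : ∀ᵐ x, ‖opCommutator b T.onFun f x - (-m')‖ₑ ≤
      ‖w x‖ₑ * ‖T.onFun f x‖ₑ + (‖T.onFun h x‖ₑ + ‖T.onFun u x - m'‖ₑ) := by
    filter_upwards [opCommutator_ae_eq T hf hbf d, T.onFun_add hhm hum] with x a1 a2
    have e : opCommutator b T.onFun f x - (-m') =
        w x * T.onFun f x - (T.onFun h x + (T.onFun u x - m')) := by
      have a3 : T.onFun (fun y => (b y - d) * f y) x = T.onFun h x + T.onFun u x := by
        rw [← a2, ← hsum]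
      rw [a1, a3]; ring
    rw [e]
    refine enorm_sub_le.trans ?_
    rw [enorm_mul]
    gcongr
    exact enorm_add_le _ _
  have e1 : ∫⁻ x in cube c r, ‖w x‖ₑ * ‖T.onFun f x‖ₑ ≤
      ENNReal.ofReal (2 ^ (n + 6) * 2 * β * l) * volume (cube c r) :=
    lintegral_mul_le_of_lintegral_rpow hwm.enorm.restrict
      (T.memLp_onFun f).1.enorm.restrict holderConjugate_two_two (by positivity) hl.le
      (hb.lintegral_rpow_le c hr (by norm_num)) h1
  set a₂ : ℝ := 2 ^ (n + 7) * 4 * β * (n + 2) with ha₂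
  have ha₂0 : 0 < a₂ := by positivity
  have e2 : ∫⁻ x in cube c r, ‖T.onFun h x‖ₑ ≤
      ENNReal.ofReal (a₂ * (1 + 3 * weakConst n A δ * (2 ^ (n + 1)) ^ n) * l) *
        volume (cube c r) := by
    have hint : ∫⁻ x, ‖h x‖ₑ ^ (4 / 3 : ℝ) ≤
        ENNReal.ofReal ((a₂ * l) ^ (4 / 3 : ℝ)) * volume (cube c R) := by
      have hi : ∀ x, ‖h x‖ₑ ^ (4 / 3 : ℝ) = (cube c R).indicator
          (fun x => ‖w x‖ₑ ^ (4 / 3 : ℝ) * ‖f x‖ₑ ^ (4 / 3 : ℝ)) x := fun x => by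
        by_cases hx : x ∈ cube c R
        · rw [hh, Set.indicator_of_mem hx, Set.indicator_of_mem hx, enorm_mul,
            ENNReal.mul_rpow_of_nonneg _ _ (by norm_num)]
        · rw [hh, Set.indicator_of_notMem hx, Set.indicator_of_notMem hx]
          simp
      simp_rw [hi]
      rw [lintegral_indicator (measurableSet_cube c R), Real.mul_rpow ha₂0.le hl.le]
      -- Exponents 3 and 3/2 turn 4/3 into 4 on `w`, where BMO gives every power, and into 2 on `f`,
      -- the only one available.
      refine lintegral_mul_le_of_lintegral_rpow (p := 3) (q := 3 / 2)
        (hwm.enorm.pow_const _).restrict (hf.1.enorm.pow_const _).restrict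
        ⟨by norm_num, by norm_num, by norm_num⟩ (by positivity) (by positivity) ?_ ?_
      · simp_rw [← ENNReal.rpow_mul]
        rw [← Real.rpow_mul ha₂0.le]
        have := hb.lintegral_dilate_rpow_le c hr (q := 4) (by norm_num) (n + 1)
        norm_num at this ⊢
        refine this.trans (le_of_eq ?_)
        congr 3
        rw [ha₂]; ring
      · simp_rw [← ENNReal.rpow_mul]
        rw [← Real.rpow_mul hl.le]
        have := h2 (n + 1)
        norm_num at this ⊢
        exact this
    have hk := setLIntegral_enorm_le_of_weak (T.memLp_onFun h).1 (r := 4 / 3) (a := a₂ * l)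
      (by norm_num) (by positivity) (W := ENNReal.ofReal (weakConst n A δ) *
        ∫⁻ x, ‖h x‖ₑ ^ (4 / 3 : ℝ)) (fun s hs => by
          refine (hT.weak_type hn hhm (p := 4 / 3) (by norm_num) (by norm_num) hs).trans
            (le_of_eq ?_)
          rw [← mul_assoc, ← ENNReal.ofReal_mul (by positivity)]
          congr 2; ring) (cube c r)
    refine hk.trans ?_
    have hvR : volume (cube c R) = ENNReal.ofReal ((2 ^ (n + 1)) ^ n) * volume (cube c r) := by
      rw [volume_cube c hR0, volume_cube c hr, ← ENNReal.ofReal_mul (by positivity), ← mul_pow]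
      congr 2; rw [hR]; ring
    calc _ ≤ ENNReal.ofReal (a₂ * l) * volume (cube c r) +
          ENNReal.ofReal ((a₂ * l) ^ (1 - 4 / 3 : ℝ) / (4 / 3 - 1)) *
            (ENNReal.ofReal (weakConst n A δ) * (ENNReal.ofReal ((a₂ * l) ^ (4 / 3 : ℝ)) *
              (ENNReal.ofReal ((2 ^ (n + 1)) ^ n) * volume (cube c r)))) := by
          rw [← hvR]; gcongr
      _ = _ := by
          rw [← mul_assoc, ← mul_assoc, ← mul_assoc, ← ENNReal.ofReal_mul (by positivity),
            ← ENNReal.ofReal_mul (by positivity), ← ENNReal.ofReal_mul (by positivity), ← add_mul,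
            ← ENNReal.ofReal_add (by positivity) (by positivity)]
          congr 2
          have h3 : (a₂ * l) ^ (1 - 4 / 3 : ℝ) * (a₂ * l) ^ (4 / 3 : ℝ) = a₂ * l := by
            rw [← Real.rpow_add (by positivity)]; norm_num
          have h4 : (a₂ * l) ^ (1 - 4 / 3 : ℝ) / (4 / 3 - 1) * weakConst n A δ *
              (a₂ * l) ^ (4 / 3 : ℝ) * (2 ^ (n + 1)) ^ n =
              ((a₂ * l) ^ (1 - 4 / 3 : ℝ) * (a₂ * l) ^ (4 / 3 : ℝ)) * 3 * weakConst n A δ *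
                (2 ^ (n + 1)) ^ n := by ring
          rw [h4, h3]; ring
  have e3 : ∫⁻ x in cube c r, ‖T.onFun u x - m'‖ₑ ≤
      ENNReal.ofReal (A * shellConst δ * (2 ^ (n + 7) * 2 * β * (n + 3) * 4 ^ n) * l) *
        volume (cube c r) := by
    have hpt := hT.enorm_onFun_sub_le hum hr hF hFb
      (fun x hx => by
        by_cases hxR : x ∈ cube c R
        · exact Set.indicator_of_notMem (Set.notMem_compl_iff.2 hxR) _
        · rw [hu, Set.indicator_of_mem (by exact hxR), h0 x hx, mul_zero])
      (fun x hx => Set.indicator_of_notMem (Set.notMem_compl_iff.2 hx) _)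
    have hsh := lintegral_compl_cube_le hT.kernel.exp_pos c hR0 hum.1.enorm
      (D := ENNReal.ofReal (2 ^ (n + 7) * 2 * β * (n + 3) * 4 ^ n * l)) (fun j => by
        -- The shells are counted from the dilated cube of radius `R`, but `b` is centred on the
        -- original one: hence `n + 2` further doublings and the factor `n + 3` below.
        have hj : 2 ^ (j + 1) * R = 2 ^ (j + n + 2) * r := by rw [hR]; ring
        have hj0 : 0 < (2 : ℝ) ^ (j + n + 2) * r := by positivity
        have h3 : ∫⁻ x in cube c (2 ^ (j + n + 2) * r), ‖w x‖ₑ * ‖f x‖ₑ ≤ _ :=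
          lintegral_mul_le_of_lintegral_rpow hwm.enorm.restrict
            hf.1.enorm.restrict holderConjugate_two_two (by positivity) hl.le
            (hb.lintegral_dilate_rpow_le c hr (by norm_num) (j + n + 2)) (h2 (j + n + 2))
        rw [hj]
        refine (lintegral_mono (g := fun x => ‖w x‖ₑ * ‖f x‖ₑ) fun x => ?_).trans
          (h3.trans ?_)
        · simp only [hu]
          rw [← enorm_mul]
          exact enorm_indicator_le_enorm_self _ _
        rw [volume_cube c hj0, ← ENNReal.ofReal_mul (by positivity),
          ← ENNReal.ofReal_mul (by positivity)]
        apply ENNReal.ofReal_le_ofReal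
        have h4 : (2 * (2 ^ (j + n + 2) * r)) ^ n = 4 ^ n * (2 ^ j * R) ^ n := by
          rw [← hj, ← mul_pow]; congr 1; ring
        rw [h4]
        have h5 : ((j + n + 2 : ℕ) : ℝ) + 1 ≤ (n + 3) * (j + 1) := by
          push_cast
          have : (0 : ℝ) ≤ n * j := by positivity
          have : (0 : ℝ) ≤ j := by positivity
          nlinarith
        calc 2 ^ (n + 7) * 2 * β * (((j + n + 2 : ℕ) : ℝ) + 1) * l * (4 ^ n * (2 ^ j * R) ^ n)
            ≤ 2 ^ (n + 7) * 2 * β * ((n + 3) * (j + 1)) * l * (4 ^ n * (2 ^ j * R) ^ n) := by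
              gcongr
          _ = _ := by ring)
    refine (setLIntegral_mono_ae' (measurableSet_cube c r) hpt).trans ?_
    rw [setLIntegral_const]
    refine mul_le_mul_left ((mul_le_mul_right hsh _).trans (le_of_eq ?_)) _
    rw [← ENNReal.ofReal_mul (by positivity), ← ENNReal.ofReal_mul (by positivity)]
    congr 1; ring
  calc _ ≤ ∫⁻ x in cube c r, (‖w x‖ₑ * ‖T.onFun f x‖ₑ +
        (‖T.onFun h x‖ₑ + ‖T.onFun u x - m'‖ₑ)) :=
        lintegral_mono_ae (ae_restrict_of_ae hdec)
    _ = (∫⁻ x in cube c r, ‖w x‖ₑ * ‖T.onFun f x‖ₑ) + ((∫⁻ x in cube c r, ‖T.onFun h x‖ₑ) +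
        ∫⁻ x in cube c r, ‖T.onFun u x - m'‖ₑ) := by
        have hm : AEMeasurable (fun x => ‖w x‖ₑ * ‖T.onFun f x‖ₑ) :=
          hwm.enorm.mul (T.memLp_onFun f).1.enorm
        rw [lintegral_add_left' hm.restrict,
          lintegral_add_left' (T.memLp_onFun h).1.enorm.restrict]
    _ ≤ _ := by
        refine (add_le_add e1 (add_le_add e2 e3)).trans (le_of_eq ?_)
        rw [← add_mul, ← add_mul, ← ENNReal.ofReal_add (by positivity) (by positivity),
          ← ENNReal.ofReal_add (by positivity) (by positivity)]
        congr 2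
        rw [oscConst, ha₂]; ring

end Local

theorem tendsto_setLIntegral_antitone {X : Type*} [MeasurableSpace X] {μ : Measure X} [SFinite μ]
    {f : X → ℝ≥0∞} (hf : ∫⁻ x, f x ∂μ ≠ ∞) {s : ℕ → Set X} (hs : ∀ k, NullMeasurableSet (s k) μ)
    (hanti : Antitone s) (hempty : ⋂ k, s k = ∅) :
    Tendsto (fun k => ∫⁻ x in s k, f x ∂μ) atTop (𝓝 0) := by
  have h := tendsto_measure_iInter_atTop (μ := μ.withDensity f)
    (fun k => (hs k).mono_ac (withDensity_absolutelyContinuous μ f)) hanti ⟨0, by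
      rw [withDensity_apply₀ f (hs 0)]
      exact ne_top_of_le_ne_top hf (setLIntegral_le_lintegral _ _)⟩
  rw [hempty, measure_empty] at h
  exact h.congr fun k => withDensity_apply₀ f (hs k)

/-! ### Weak type (2, 2) of commutators, independent of the size of a bounded symbol. -/

section WeakTwo

variable {n : ℕ}

theorem memLp_opCommutator (T : L2Operator n) {b f : EuclideanSpace ℝ (Fin n) → ℝ}
    (hb : AEStronglyMeasurable b) {B : ℝ} (hB : ∀ x, |b x| ≤ B) :
    MemLp (opCommutator b T.onFun f) 2 :=
  ((T.memLp_onFun f).bdd_mul_two hb hB).sub (T.memLp_onFun _)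

/-- The two hypotheses force |m| ≤ (2^n + 1)t, so exceeding (2^n + 2)t means deviating from `m` by
more than `t`, and Chebyshev applies. -/
theorem volume_inter_le_of_lintegral_sub_le {F : EuclideanSpace ℝ (Fin n) → ℝ}
    (hF : AEStronglyMeasurable F) {Q : Set (EuclideanSpace ℝ (Fin n))} (hQ0 : volume Q ≠ 0)
    (hQ : volume Q ≠ ∞) {m t a : ℝ} (ht : 0 < t) (ha : 0 ≤ a) (ha1 : a ≤ 1)
    (h1 : ∫⁻ x in Q, ‖F x - m‖ₑ ≤ ENNReal.ofReal (a * t) * volume Q)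
    (h2 : ∫⁻ x in Q, ‖F x‖ₑ ≤ ENNReal.ofReal (2 ^ n * t) * volume Q) :
    volume (Q ∩ {x | (2 ^ n + 2) * t < |F x|}) ≤ ENNReal.ofReal a * volume Q := by
  have hm : |m| ≤ (2 ^ n + 1) * t := by
    have h3 : ENNReal.ofReal |m| * volume Q ≤ ENNReal.ofReal (2 ^ n * t + a * t) * volume Q := by
      rw [ENNReal.ofReal_add (by positivity) (by positivity), add_mul]
      refine le_trans ?_ (add_le_add h2 h1)
      rw [← lintegral_add_left' hF.enorm.restrict, ← setLIntegral_const]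
      refine lintegral_mono fun x => ?_
      rw [← Real.enorm_eq_ofReal_abs]
      have : m = F x - (F x - m) := by ring
      conv_lhs => rw [this]
      exact enorm_sub_le
    have h4 := (ENNReal.mul_le_mul_iff_left hQ0 hQ).1 h3
    rw [ENNReal.ofReal_le_ofReal_iff (by positivity)] at h4
    nlinarith
  have h5 := mul_meas_ge_le_lintegral₀ (μ := volume.restrict Q)
    (f := fun x => ‖F x - m‖ₑ) (hF.sub aestronglyMeasurable_const).enorm.restrict
    (ENNReal.ofReal t)
  have h6 : volume (Q ∩ {x | (2 ^ n + 2) * t < |F x|}) ≤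
      (volume.restrict Q) {x | ENNReal.ofReal t ≤ ‖F x - m‖ₑ} := by
    refine le_trans (measure_mono ?_) (Measure.le_restrict_apply _ _)
    rintro x ⟨hx, hlt⟩
    refine ⟨?_, hx⟩
    rw [Set.mem_ofPred_eq] at hlt ⊢
    rw [Real.enorm_eq_ofReal_abs]
    apply ENNReal.ofReal_le_ofReal
    have := abs_sub_abs_le_abs_sub (F x) m
    linarith
  have h7 := (mul_le_mul_right h6 (ENNReal.ofReal t)).trans (h5.trans h1)
  rw [mul_comm a, ENNReal.ofReal_mul ht.le, mul_assoc] at h7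
  exact (ENNReal.mul_le_mul_iff_right (by simpa using ht) ENNReal.ofReal_ne_top).1 h7

/-- The relative distributional inequality between a commutator and maximal functions. -/
theorem CZBound.volume_lt_opCommutator_le (hn : 1 ≤ n) {T : L2Operator n}
    {K : EuclideanSpace ℝ (Fin n) → EuclideanSpace ℝ (Fin n) → ℝ} {A δ : ℝ}
    (hT : CZBound T K A δ) {b : EuclideanSpace ℝ (Fin n) → ℝ} {β B : ℝ} (hb : BMOBound b β)
    (hB : ∀ x, |b x| ≤ B) {f : EuclideanSpace ℝ (Fin n) → ℝ} (hf : MemLp f 2)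
    {F : Set (EuclideanSpace ℝ (Fin n))} (hF : IsClosed F) (hFb : Bornology.IsBounded F)
    (h0 : ∀ x ∉ F, f x = 0) {t θ : ℝ} (ht : 0 < t) (hθ : 0 < θ) (hθ1 : θ ≤ 1) {N : ℝ≥0∞}
    (hN : ∀ s, 0 < s →
      volume {x | s < |opCommutator b T.onFun f x|} ≤ ENNReal.ofReal (1 / s ^ (2 : ℝ)) * N) :
    volume {x | (2 ^ n + 2) * t < |opCommutator b T.onFun f x|} ≤
      ENNReal.ofReal (5 ^ n * (A ^ 2 + 1) * oscConst n A δ β ^ 2 / (θ * t) ^ 2) *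
        (∫⁻ x, ‖f x‖ₑ ^ (2 : ℝ)) + ENNReal.ofReal (4 * θ / t ^ 2) * N := by
  have hA := hT.kernel.pos
  set C := oscConst n A δ β with hC
  have hC0 : 0 < C := oscConst_pos n hA δ hb.pos
  -- The height for the maximal functions is chosen so that the mean oscillation estimate returns
  -- exactly `θ * t`.
  set l := θ * t / C with hl
  have hl0 : 0 < l := by positivity
  have hCl : C * l = θ * t := by rw [hl]; field_simp
  set G := opCommutator b T.onFun f with hG
  have hG2 : MemLp G 2 := memLp_opCommutator T hb.locInt.aestronglyMeasurable hB
  obtain ⟨s, hs, S, hdisj, hlow, hup, hoff, hfin⟩ := exists_stopCubes_of_memLp_two hn hG2 ht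
  set Ω := ∑' q : S, volume (stopCube s q.1) with hΩ
  have hdisj' : Pairwise (Function.onFun Disjoint fun q : S => stopCube s q.1) :=
    fun q q' hqq => hdisj q.2 q'.2 fun h => hqq (Subtype.ext h)
  -- Kolmogorov at height `t / 2` bounds the integral over the stopping cubes; half of `t * Ω` is
  -- absorbed, which is legitimate because `Ω` is finite.
  have hΩN : Ω ≤ ENNReal.ofReal (4 / t ^ 2) * N := by
    set E := ⋃ q : S, stopCube s q.1 with hE
    have hEvol : volume E = Ω :=
      measure_iUnion hdisj' fun q => measurableSet_stopCube _ _
    have h1 : ENNReal.ofReal t * Ω ≤ ∫⁻ x in E, ‖G x‖ₑ := by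
      rw [hE, lintegral_iUnion (fun q => measurableSet_stopCube _ _) hdisj', hΩ,
        ← ENNReal.tsum_mul_left]
      exact ENNReal.tsum_le_tsum fun q => hlow q q.2
    have h2 := setLIntegral_enorm_le_of_weak hG2.1 (r := 2) (a := t / 2) (by norm_num)
      (by positivity) hN E
    rw [hEvol] at h2
    have h3 : ENNReal.ofReal t * Ω = ENNReal.ofReal (t / 2) * Ω + ENNReal.ofReal (t / 2) * Ω := by
      rw [← add_mul, ← ENNReal.ofReal_add (by positivity) (by positivity), add_halves]
    have h4 := h1.trans h2
    rw [h3, ENNReal.add_le_add_iff_left (ENNReal.mul_ne_top ENNReal.ofReal_ne_top hfin)] at h4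
    have h5 := mul_le_mul_right h4 (ENNReal.ofReal (2 / t))
    rw [← mul_assoc, ← mul_assoc, ← ENNReal.ofReal_mul (by positivity),
      ← ENNReal.ofReal_mul (by positivity)] at h5
    have e1 : 2 / t * (t / 2) = 1 := by field_simp
    have e2 : 2 / t * ((t / 2) ^ (1 - 2 : ℝ) / (2 - 1)) = 4 / t ^ 2 := by
      rw [show (1 - 2 : ℝ) = -1 by norm_num, Real.rpow_neg_one]; field_simp; norm_num
    rwa [e1, e2, ENNReal.ofReal_one, one_mul] at h5
  set M₁ := {x | ENNReal.ofReal (l ^ (2 : ℝ)) <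
    maximalOp (fun y => ‖T.onFun f y‖ₑ ^ (2 : ℝ)) x} with hM₁
  set M₂ := {x | ENNReal.ofReal (l ^ (2 : ℝ)) < maximalOp (fun y => ‖f y‖ₑ ^ (2 : ℝ)) x} with hM₂
  have hM₁m : MeasurableSet M₁ := measurableSet_lt measurable_const (measurable_maximalOp _)
  have hM₂m : MeasurableSet M₂ := measurableSet_lt measurable_const (measurable_maximalOp _)
  set L := {x | (2 ^ n + 2) * t < |G x|} with hL
  have hcube : ∀ q ∈ S, volume (stopCube s q ∩ L) ≤
      volume (stopCube s q ∩ (M₁ ∪ M₂)) + ENNReal.ofReal θ * volume (stopCube s q) := by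
    intro q hq
    have hr := stopRadius_pos hs q
    have hae := stopCube_ae_eq hs q
    -- Either the cube is swallowed by the sets where a maximal function is large, or one good point
    -- of it bounds the averages of |f|² and |Tf|² that the oscillation estimate uses.
    by_cases hall : ∀ x ∈ cube (stopCenter s q) (stopRadius s q), x ∈ M₁ ∪ M₂
    · refine le_add_right ?_
      calc volume (stopCube s q ∩ L) ≤ volume (stopCube s q) :=
            measure_mono Set.inter_subset_left
        _ = volume (cube (stopCenter s q) (stopRadius s q)) := measure_congr hae
        _ = volume (cube (stopCenter s q) (stopRadius s q) ∩ (M₁ ∪ M₂)) := by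
            rw [Set.inter_eq_left.2 hall]
        _ = _ := measure_congr (hae.symm.inter (ae_eq_refl _))
    · push Not at hall
      obtain ⟨x, hx, hxM⟩ := hall
      have hx1 : maximalOp (fun y => ‖T.onFun f y‖ₑ ^ (2 : ℝ)) x ≤ ENNReal.ofReal (l ^ (2 : ℝ)) :=
        not_lt.1 fun h => hxM (Or.inl h)
      have hx2 : maximalOp (fun y => ‖f y‖ₑ ^ (2 : ℝ)) x ≤ ENNReal.ofReal (l ^ (2 : ℝ)) :=
        not_lt.1 fun h => hxM (Or.inr h)
      obtain ⟨m, hm⟩ := hT.exists_lintegral_opCommutator_sub_le hn hb hB hf hF hFb h0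
        (stopCenter s q) hr hl0
        (by
          rw [mul_comm]
          exact (setLIntegral_le_volume_mul_maximalOp _ hr hx).trans (mul_le_mul_right hx1 _))
        (fun j => by
          rw [mul_comm (ENNReal.ofReal _)]
          refine (setLIntegral_le_volume_mul_maximalOp _ (by positivity)
            (cube_subset_cube _ ?_ hx)).trans (mul_le_mul_right hx2 _)
          exact le_mul_of_one_le_left hr.le (one_le_pow₀ (by norm_num)))
      refine le_add_left (volume_inter_le_of_lintegral_sub_le hG2.1 (volume_stopCube_ne_zero hs q)
        (volume_stopCube_ne_top hs q) (m := m) ht hθ.le hθ1 ?_ (hup q hq))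
      rw [setLIntegral_congr hae, measure_congr hae, ← hCl]
      exact hm
  have hsum : volume L ≤ volume (M₁ ∪ M₂) + ENNReal.ofReal θ * Ω := by
    calc volume L ≤ volume (⋃ q : S, (stopCube s q.1 ∩ L)) := by
          refine measure_mono_ae ?_
          filter_upwards [hoff] with x hx hxL
          by_contra hcon
          have hxS : x ∉ ⋃ q ∈ S, stopCube s q := fun h => by
            obtain ⟨q, hq, hxq⟩ := Set.mem_iUnion₂.1 h
            exact hcon (Set.mem_iUnion.2 ⟨⟨q, hq⟩, hxq, hxL⟩)
          have h1 := hx hxS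
          have h2 : (2 ^ n + 2) * t < |G x| := hxL
          have h3 : (0 : ℝ) < 2 ^ n := by positivity
          nlinarith
      _ ≤ ∑' q : S, volume (stopCube s q.1 ∩ L) := measure_iUnion_le _
      _ ≤ ∑' q : S, (volume (stopCube s q.1 ∩ (M₁ ∪ M₂)) +
            ENNReal.ofReal θ * volume (stopCube s q.1)) :=
          ENNReal.tsum_le_tsum fun q => hcube q q.2
      _ = ∑' q : S, volume (stopCube s q.1 ∩ (M₁ ∪ M₂)) + ENNReal.ofReal θ * Ω := by
          rw [ENNReal.tsum_add, ENNReal.tsum_mul_left]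
      _ ≤ _ := by
          gcongr
          rw [← measure_iUnion (fun q q' h => (hdisj' h).mono Set.inter_subset_left
            Set.inter_subset_left) fun q => (measurableSet_stopCube _ _).inter
            (hM₁m.union hM₂m)]
          exact measure_mono (Set.iUnion_subset fun q => Set.inter_subset_right)
  have hmax : ∀ g : EuclideanSpace ℝ (Fin n) → ℝ≥0∞,
      volume {x | ENNReal.ofReal (l ^ (2 : ℝ)) < maximalOp g x} ≤
        ENNReal.ofReal (5 ^ n / l ^ 2) * ∫⁻ x, g x := fun g => by
    have h1 := mul_le_mul_right (maximalOp_weak_one hn g (ENNReal.ofReal (l ^ (2 : ℝ))))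
      (ENNReal.ofReal (1 / l ^ (2 : ℝ)))
    rw [← mul_assoc, ← ENNReal.ofReal_mul (by positivity), one_div_mul_cancel (by positivity),
      ENNReal.ofReal_one, one_mul] at h1
    refine h1.trans (le_of_eq ?_)
    rw [← mul_assoc, show (5 : ℝ≥0∞) ^ n = ENNReal.ofReal (5 ^ n) by
      rw [ENNReal.ofReal_pow (by norm_num)]; simp, ← ENNReal.ofReal_mul (by positivity)]
    congr 2
    rw [Real.rpow_two]; ring
  set I := ∫⁻ x, ‖f x‖ₑ ^ (2 : ℝ) with hI
  have hMM : volume (M₁ ∪ M₂) ≤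
      ENNReal.ofReal (5 ^ n * (A ^ 2 + 1) * C ^ 2 / (θ * t) ^ 2) * I := by
    refine (measure_union_le _ _).trans ((add_le_add (hmax _) (hmax _)).trans ?_)
    refine (add_le_add (mul_le_mul_right (T.lintegral_onFun_le hT.norm_le hf) _)
      le_rfl).trans (le_of_eq ?_)
    rw [← mul_assoc, ← ENNReal.ofReal_mul (by positivity), ← add_mul,
      ← ENNReal.ofReal_add (by positivity) (by positivity)]
    congr 2
    rw [hl]; field_simp
  refine hsum.trans (add_le_add hMM ((mul_le_mul_right hΩN _).trans (le_of_eq ?_)))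
  rw [← mul_assoc, ← ENNReal.ofReal_mul hθ.le]
  congr 2; ring

/-- The constant in the weak type `(2, 2)` inequality for commutators. -/
def commTwoConst (n : ℕ) (A δ β : ℝ) : ℝ :=
  8 * (2 ^ n + 2) ^ 2 * (5 ^ n * (A ^ 2 + 1) * oscConst n A δ β ^ 2 * (8 * (2 ^ n + 2) ^ 2) ^ 2)

theorem commTwoConst_nonneg (n : ℕ) (A δ β : ℝ) : 0 ≤ commTwoConst n A δ β := by
  unfold commTwoConst; positivity

/-- `N` is the best constant in the weak (2, 2) inequality for this function. It is finite because
`b` is bounded, and the good-λ inequality bounds it by half of itself plus a term free of `B`. The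
quarter in the constant is spent when the support of `f` is localised by splitting `t` in two. -/
theorem CZBound.weak_two_opCommutator_of_bounded (hn : 1 ≤ n) {T : L2Operator n}
    {K : EuclideanSpace ℝ (Fin n) → EuclideanSpace ℝ (Fin n) → ℝ} {A δ : ℝ}
    (hT : CZBound T K A δ) {b : EuclideanSpace ℝ (Fin n) → ℝ} {β B : ℝ} (hb : BMOBound b β)
    (hB : ∀ x, |b x| ≤ B) {f : EuclideanSpace ℝ (Fin n) → ℝ} (hf : MemLp f 2)
    {F : Set (EuclideanSpace ℝ (Fin n))} (hF : IsClosed F) (hFb : Bornology.IsBounded F)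
    (h0 : ∀ x ∉ F, f x = 0) {t : ℝ} (ht : 0 < t) :
    volume {x | t < |opCommutator b T.onFun f x|} ≤
      ENNReal.ofReal (commTwoConst n A δ β / 4 / t ^ (2 : ℝ)) * ∫⁻ x, ‖f x‖ₑ ^ (2 : ℝ) := by
  set G := opCommutator b T.onFun f with hG
  have hG2 : MemLp G 2 := memLp_opCommutator T hb.locInt.aestronglyMeasurable hB
  set N : ℝ≥0∞ := ⨆ (s : ℝ) (_ : 0 < s), ENNReal.ofReal (s ^ (2 : ℝ)) * volume {x | s < |G x|}
    with hN
  have hNfin : N ≠ ∞ := by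
    refine ne_top_of_le_ne_top hG2.lintegral_rpow_two_ne_top (iSup₂_le fun s hs => ?_)
    refine (mul_le_mul_right (measure_lt_abs_le hG2.1 (p := 2) (by norm_num) hs) _).trans
      (le_of_eq ?_)
    rw [← mul_assoc, ← ENNReal.ofReal_mul (by positivity), mul_one_div_cancel (by positivity),
      ENNReal.ofReal_one, one_mul]
  have hNs : ∀ s, 0 < s → volume {x | s < |G x|} ≤ ENNReal.ofReal (1 / s ^ (2 : ℝ)) * N := by
    intro s hs
    have h1 : ENNReal.ofReal (s ^ (2 : ℝ)) * volume {x | s < |G x|} ≤ N :=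
      le_iSup₂_of_le s hs le_rfl
    have h2 := mul_le_mul_right h1 (ENNReal.ofReal (1 / s ^ (2 : ℝ)))
    rwa [← mul_assoc, ← ENNReal.ofReal_mul (by positivity), one_div_mul_cancel (by positivity),
      ENNReal.ofReal_one, one_mul] at h2
  set κ : ℝ := 2 ^ n + 2 with hκ
  have hκ1 : 1 ≤ κ := by
    have : (0 : ℝ) < 2 ^ n := by positivity
    linarith
  set I := ∫⁻ x, ‖f x‖ₑ ^ (2 : ℝ) with hI
  -- Chosen so that `4 * θ * κ ^ 2 = 1 / 2`, the coefficient to be absorbed.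
  set θ : ℝ := 1 / (8 * κ ^ 2) with hθ
  have hθ0 : 0 < θ := by positivity
  have hθ1 : θ ≤ 1 := by
    rw [hθ, div_le_one (by positivity)]
    nlinarith
  set D : ℝ := commTwoConst n A δ β / 4 with hD
  have hD0 : 0 ≤ D := by have := commTwoConst_nonneg n A δ β; positivity
  have hN2 : N ≤ ENNReal.ofReal (D / 2) * I + ENNReal.ofReal (1 / 2) * N := by
    refine iSup₂_le fun s hs => ?_
    have h1 := hT.volume_lt_opCommutator_le hn hb hB hf hF hFb h0 (t := s / κ) (by positivity)
      hθ0 hθ1 hNs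
    rw [← hκ, mul_div_cancel₀ _ (by positivity)] at h1
    refine (mul_le_mul_right h1 _).trans (le_of_eq ?_)
    rw [mul_add, ← mul_assoc, ← mul_assoc, ← ENNReal.ofReal_mul (by positivity),
      ← ENNReal.ofReal_mul (by positivity), Real.rpow_two]
    congr 3
    · rw [hD, commTwoConst, ← hκ, hθ]; field_simp; try ring
    · rw [hθ]; field_simp; try norm_num
  have hN3 : N ≤ ENNReal.ofReal D * I := by
    have h1 : N = ENNReal.ofReal (1 / 2) * N + ENNReal.ofReal (1 / 2) * N := by
      rw [← add_mul, ← ENNReal.ofReal_add (by norm_num) (by norm_num), add_halves,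
        ENNReal.ofReal_one, one_mul]
    have h2 : ENNReal.ofReal (1 / 2) * N ≤ ENNReal.ofReal (D / 2) * I := by
      have h3 := hN2
      rw [h1] at h3
      conv_rhs at h3 => rw [← h1]
      exact (ENNReal.add_le_add_iff_right (ENNReal.mul_ne_top ENNReal.ofReal_ne_top hNfin)).1 h3
    have h4 := mul_le_mul_right h2 (ENNReal.ofReal 2)
    rw [← mul_assoc, ← mul_assoc, ← ENNReal.ofReal_mul (by norm_num),
      ← ENNReal.ofReal_mul (by norm_num)] at h4
    rwa [mul_one_div_cancel (by norm_num), ENNReal.ofReal_one, one_mul,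
      mul_div_cancel₀ _ (by norm_num : (2 : ℝ) ≠ 0)] at h4
  refine (hNs t ht).trans ((mul_le_mul_right hN3 _).trans (le_of_eq ?_))
  rw [← mul_assoc, ← ENNReal.ofReal_mul (by positivity)]
  congr 2; ring

theorem eLpNorm_opCommutator_le (T : L2Operator n) {A : ℝ} (hA : ‖T‖ ≤ A)
    {b f : EuclideanSpace ℝ (Fin n) → ℝ} (hb : AEStronglyMeasurable b) {B : ℝ}
    (hB : ∀ x, |b x| ≤ B) (hf : MemLp f 2) :
    eLpNorm (opCommutator b T.onFun f) 2 ≤ ENNReal.ofReal (2 * B * A) * eLpNorm f 2 := by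
  have hB0 : 0 ≤ B := (abs_nonneg _).trans (hB 0)
  have hA0 : 0 ≤ A := (norm_nonneg T).trans hA
  have hmul : ∀ g : EuclideanSpace ℝ (Fin n) → ℝ,
      eLpNorm (fun x => b x * g x) 2 ≤ ENNReal.ofReal B * eLpNorm g 2 := fun g =>
    eLpNorm_le_mul_eLpNorm_of_ae_le_mul (ae_of_all _ fun x => by
      rw [norm_mul]; exact mul_le_mul_of_nonneg_right (hB x) (norm_nonneg _)) _
  have hTle : ∀ g : EuclideanSpace ℝ (Fin n) → ℝ, MemLp g 2 →
      eLpNorm (T.onFun g) 2 ≤ ENNReal.ofReal A * eLpNorm g 2 := fun g hg =>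
    (T.eLpNorm_onFun_le hg).trans (mul_le_mul_left (ENNReal.ofReal_le_ofReal hA) _)
  have hbf := hf.bdd_mul_two hb hB
  have h1 : eLpNorm (opCommutator b T.onFun f) 2 ≤
      eLpNorm (fun x => b x * T.onFun f x) 2 + eLpNorm (T.onFun fun y => b y * f y) 2 :=
    eLpNorm_sub_le ((T.memLp_onFun f).bdd_mul_two hb hB).1 (T.memLp_onFun _).1 (by norm_num)
  refine h1.trans ((add_le_add ((hmul _).trans (mul_le_mul_right (hTle f hf) _))
    ((hTle _ hbf).trans (mul_le_mul_right (hmul f) _))).trans (le_of_eq ?_))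
  rw [← mul_assoc, ← mul_assoc, ← ENNReal.ofReal_mul hB0, ← ENNReal.ofReal_mul hA0, ← add_mul,
    ← ENNReal.ofReal_add (by positivity) (by positivity)]
  congr 2; ring

theorem opCommutator_add_ae (T : L2Operator n) {b f g : EuclideanSpace ℝ (Fin n) → ℝ}
    (hf : MemLp f 2) (hg : MemLp g 2) (hbf : MemLp (fun x => b x * f x) 2)
    (hbg : MemLp (fun x => b x * g x) 2) :
    opCommutator b T.onFun (fun x => f x + g x) =ᵐ[volume] fun x =>
      opCommutator b T.onFun f x + opCommutator b T.onFun g x := by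
  have e : (fun y => b y * (f y + g y)) = fun y => b y * f y + b y * g y := by
    funext y; ring
  filter_upwards [T.onFun_add hf hg, T.onFun_add hbf hbg] with x a1 a2
  simp only [opCommutator, e, a1, a2]; ring

/-- The weak type `(2, 2)` inequality for commutators with bounded symbols; the constant does not
depend on the bound of the symbol. -/
theorem CZBound.weak_two_opCommutator (hn : 1 ≤ n) {T : L2Operator n}
    {K : EuclideanSpace ℝ (Fin n) → EuclideanSpace ℝ (Fin n) → ℝ} {A δ : ℝ}
    (hT : CZBound T K A δ) {b : EuclideanSpace ℝ (Fin n) → ℝ} {β B : ℝ} (hb : BMOBound b β)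
    (hB : ∀ x, |b x| ≤ B) {f : EuclideanSpace ℝ (Fin n) → ℝ} (hf : MemLp f 2)
    {t : ℝ} (ht : 0 < t) :
    volume {x | t < |opCommutator b T.onFun f x|} ≤
      ENNReal.ofReal (commTwoConst n A δ β / t ^ (2 : ℝ)) * ∫⁻ x, ‖f x‖ₑ ^ (2 : ℝ) := by
  have hbm : AEStronglyMeasurable b volume := hb.locInt.aestronglyMeasurable
  set F : ℕ → Set (EuclideanSpace ℝ (Fin n)) := fun k => Metric.closedBall 0 k with hF
  have hFm : ∀ k, MeasurableSet (F k) := fun k => Metric.isClosed_closedBall.measurableSet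
  have htail : Tendsto (fun k => ∫⁻ x in (F k)ᶜ, ‖f x‖ₑ ^ (2 : ℝ)) atTop (𝓝 0) := by
    refine tendsto_setLIntegral_antitone hf.lintegral_rpow_two_ne_top
      (fun k => (hFm k).compl.nullMeasurableSet) (fun j k hjk => Set.compl_subset_compl.2
        (Metric.closedBall_subset_closedBall (by exact_mod_cast hjk))) ?_
    rw [← Set.compl_iUnion, Set.compl_empty_iff]
    exact Metric.iUnion_closedBall_nat 0
  set a : ℝ := (2 * B * A) ^ 2 / (t / 2) ^ (2 : ℝ) with ha
  have hB0 : 0 ≤ B := (abs_nonneg _).trans (hB 0)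
  have ha0 : 0 ≤ a := by positivity
  set I := ∫⁻ x, ‖f x‖ₑ ^ (2 : ℝ) with hI
  -- The crude bound `2 * B * A` on `L²` is applied only to the tail of `f` outside a large ball, so
  -- `B` disappears in the limit.
  have hk : ∀ k, volume {x | t < |opCommutator b T.onFun f x|} ≤
      ENNReal.ofReal (commTwoConst n A δ β / t ^ (2 : ℝ)) * I +
        ENNReal.ofReal a * ∫⁻ x in (F k)ᶜ, ‖f x‖ₑ ^ (2 : ℝ) := by
    intro k
    have h1 : MemLp ((F k).indicator f) 2 := hf.indicator (hFm k)
    have h2 : MemLp ((F k)ᶜ.indicator f) 2 := hf.indicator (hFm k).compl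
    have e : f = fun x => (F k).indicator f x + (F k)ᶜ.indicator f x := by
      funext x; exact (Set.indicator_self_add_compl_apply _ _ _).symm
    have h3 := opCommutator_add_ae T h1 h2 (h1.bdd_mul_two hbm hB) (h2.bdd_mul_two hbm hB)
    rw [← e] at h3
    have h4 := measure_lt_abs_add_le h3 (t / 2) (t / 2)
    rw [add_halves] at h4
    refine h4.trans (add_le_add ?_ ?_)
    · refine (hT.weak_two_opCommutator_of_bounded hn hb hB h1 Metric.isClosed_closedBall
        Metric.isBounded_closedBall (fun x hx => Set.indicator_of_notMem hx _)
        (by positivity)).trans ?_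
      refine mul_le_mul' (le_of_eq ?_) (lintegral_mono fun x => ?_)
      · congr 1
        rw [Real.rpow_two, Real.rpow_two]; field_simp; try norm_num
      · exact ENNReal.rpow_le_rpow (enorm_indicator_le_enorm_self _ _) (by norm_num)
    · refine (measure_lt_abs_le (memLp_opCommutator T hbm hB).1 (p := 2) (by norm_num)
        (by positivity)).trans ?_
      rw [lintegral_enorm_rpow_two_eq]
      refine (mul_le_mul_right (ENNReal.rpow_le_rpow (eLpNorm_opCommutator_le T hT.norm_le hbm
        hB h2) (by norm_num)) _).trans (le_of_eq ?_)
      have hA := hT.kernel.pos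
      rw [ENNReal.mul_rpow_of_nonneg _ _ (by norm_num), ← lintegral_enorm_rpow_two_eq,
        ENNReal.ofReal_rpow_of_nonneg (by positivity) (by norm_num), ← mul_assoc,
        ← ENNReal.ofReal_mul (by positivity)]
      congr 1
      · congr 1; rw [ha, Real.rpow_two (2 * B * A)]; ring
      · rw [← lintegral_indicator (hFm k).compl]
        congr 1; funext x
        by_cases hx : x ∈ (F k)ᶜ
        · rw [Set.indicator_of_mem hx, Set.indicator_of_mem hx]
        · rw [Set.indicator_of_notMem hx, Set.indicator_of_notMem hx]; simp
  have hlim := (ENNReal.Tendsto.const_mul htail (a := ENNReal.ofReal a)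
    (Or.inr ENNReal.ofReal_ne_top)).const_add
    (ENNReal.ofReal (commTwoConst n A δ β / t ^ (2 : ℝ)) * I)
  rw [mul_zero, add_zero] at hlim
  exact ge_of_tendsto' hlim hk

end WeakTwo

/-! ### Weak type (p, p) of commutators, 1 < p ≤ 2, with constant p'. -/

section WeakCommutator

variable {n : ℕ}

theorem BMOBound.lintegral_shell_le {b : EuclideanSpace ℝ (Fin n) → ℝ} {β : ℝ}
    (hb : BMOBound b β) (c : EuclideanSpace ℝ (Fin n)) {r : ℝ} (hr : 0 < r) (j : ℕ) :
    ∫⁻ x in cube c (2 ^ (j + 1) * (2 ^ (n + 1) * r)), ‖b x - cubeAvg b c r‖ₑ ≤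
      ENNReal.ofReal (2 ^ (n + 7) * β * (n + 3) * 4 ^ n) *
        ENNReal.ofReal ((j + 1) * (2 ^ j * (2 ^ (n + 1) * r)) ^ n) := by
  have hβ := hb.pos
  have hj : 2 ^ (j + 1) * (2 ^ (n + 1) * r) = 2 ^ (j + n + 2) * r := by ring
  have hj0 : 0 < (2 : ℝ) ^ (j + n + 2) * r := by positivity
  have h := hb.lintegral_dilate_rpow_le c hr le_rfl (j + n + 2)
  simp only [ENNReal.rpow_one, Real.rpow_one, mul_one] at h
  rw [hj]
  refine h.trans ?_
  rw [volume_cube c hj0, ← ENNReal.ofReal_mul (by positivity),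
    ← ENNReal.ofReal_mul (by positivity)]
  apply ENNReal.ofReal_le_ofReal
  have h4 : (2 * (2 ^ (j + n + 2) * r)) ^ n = 4 ^ n * (2 ^ j * (2 ^ (n + 1) * r)) ^ n := by
    rw [← hj, ← mul_pow]; congr 1; ring
  rw [h4]
  have h5 : ((j + n + 2 : ℕ) : ℝ) + 1 ≤ (n + 3) * (j + 1) := by
    push_cast
    have : (0 : ℝ) ≤ n * j := by positivity
    have : (0 : ℝ) ≤ j := by positivity
    nlinarith
  calc 2 ^ (n + 7) * β * (((j + n + 2 : ℕ) : ℝ) + 1) * (4 ^ n * (2 ^ j * (2 ^ (n + 1) * r)) ^ n)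
      ≤ 2 ^ (n + 7) * β * ((n + 3) * (j + 1)) * (4 ^ n * (2 ^ j * (2 ^ (n + 1) * r)) ^ n) := by
        gcongr
    _ = _ := by ring

/-- Hölder with exponents p' and p on the cube: the `L^(p')` oscillation of `b` is of order p'. This
is the one place where p' enters the commutator bound. -/
theorem BMOBound.lintegral_mul_atom_le {b : EuclideanSpace ℝ (Fin n) → ℝ} {β : ℝ}
    (hb : BMOBound b β) {f : EuclideanSpace ℝ (Fin n) → ℝ} (hf : MemLp f 2) {s : ℝ}
    (hs : 0 < s) {q : ℕ × (Fin n → ℤ)} {m p t : ℝ} (hp : 1 < p) (ht : 0 < t)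
    (hm : |m| ≤ 2 ^ n * t)
    (h : ∫⁻ y in stopCube s q, ‖f y‖ₑ ^ p ≤
        ENNReal.ofReal (2 ^ n * t ^ p) * volume (stopCube s q)) :
    ∫⁻ x, ‖(b x - cubeAvg b (stopCenter s q) (stopRadius s q)) *
        (stopCube s q).indicator (fun y => f y - m) x‖ₑ ≤
      ENNReal.ofReal (2 ^ n * (2 ^ (n + 7) * β) * (p / (p - 1)) * t) * volume (stopCube s q) := by
  have hβ := hb.pos
  have hp0 : 0 < p := by linarith
  have hr := stopRadius_pos hs q
  have hae := stopCube_ae_eq hs q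
  set d := cubeAvg b (stopCenter s q) (stopRadius s q) with hd
  set p' := p / (p - 1) with hp'
  have hconj : p'.HolderConjugate p := (Real.HolderConjugate.conjExponent hp).symm
  have hp'1 : 1 < p' := hconj.lt
  have hwm : AEStronglyMeasurable (fun x => b x - d) volume :=
    hb.locInt.aestronglyMeasurable.sub aestronglyMeasurable_const
  have e1 : ∫⁻ x in stopCube s q, ‖b x - d‖ₑ * ‖f x‖ₑ ≤
      ENNReal.ofReal (2 ^ (n + 6) * p' * β * (2 ^ n * t)) * volume (stopCube s q) := by
    refine lintegral_mul_le_of_lintegral_rpow hwm.enorm.restrict hf.1.enorm.restrict hconj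
      (by positivity) (by positivity) ?_ (h.trans ?_)
    · rw [setLIntegral_congr hae, measure_congr hae]
      exact hb.lintegral_rpow_le _ hr hp'1.le
    · gcongr
      rw [Real.mul_rpow (by positivity) ht.le]
      gcongr
      exact Real.self_le_rpow_of_one_le (one_le_pow₀ (by norm_num)) hp.le
  have e2 : ∫⁻ x in stopCube s q, ‖b x - d‖ₑ ≤ ENNReal.ofReal β * volume (stopCube s q) := by
    rw [setLIntegral_congr hae, measure_congr hae]
    exact hb.osc _ _ hr
  have e3 : ∀ x, ‖(b x - d) * (stopCube s q).indicator (fun y => f y - m) x‖ₑ ≤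
      (stopCube s q).indicator
        (fun x => ‖b x - d‖ₑ * ‖f x‖ₑ + ENNReal.ofReal (2 ^ n * t) * ‖b x - d‖ₑ) x := by
    intro x
    by_cases hx : x ∈ stopCube s q
    · rw [Set.indicator_of_mem hx, Set.indicator_of_mem hx, enorm_mul,
        mul_comm (ENNReal.ofReal _), ← mul_add]
      refine mul_le_mul_right (enorm_sub_le.trans (add_le_add le_rfl ?_)) _
      rw [Real.enorm_eq_ofReal_abs]
      exact ENNReal.ofReal_le_ofReal hm
    · rw [Set.indicator_of_notMem hx, mul_zero, enorm_zero]; exact zero_le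
  refine (lintegral_mono e3).trans ?_
  rw [lintegral_indicator (measurableSet_stopCube s q),
    lintegral_add_right' _ (hwm.enorm.const_mul _).restrict,
    lintegral_const_mul' _ _ ENNReal.ofReal_ne_top]
  refine (add_le_add e1 (mul_le_mul_right e2 _)).trans ?_
  rw [← mul_assoc (ENNReal.ofReal (2 ^ n * t)), ← ENNReal.ofReal_mul (by positivity), ← add_mul,
    ← ENNReal.ofReal_add (by positivity) (by positivity)]
  refine mul_le_mul_left (ENNReal.ofReal_le_ofReal ?_) _
  have h6 : (1 : ℝ) ≤ 2 ^ (n + 6) * p' := by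
    have : (1 : ℝ) ≤ 2 ^ (n + 6) := one_le_pow₀ (by norm_num)
    nlinarith
  have h7 : (0 : ℝ) < 2 ^ n * t * β := by positivity
  have h8 : 2 ^ n * (2 ^ (n + 7) * β) * p' * t = 2 ^ n * t * β * (2 * (2 ^ (n + 6) * p')) := by ring
  rw [h8]
  nlinarith

/-- The constant in the weak type inequalities for commutators with bounded symbols. -/
def commConst (n : ℕ) (A δ β : ℝ) : ℝ :=
  16 * (commTwoConst n A δ β * (1 + 4 ^ n) + (2 ^ (n + 1)) ^ n +
    A * shellConst δ * (2 ^ (n + 7) * β * (n + 3) * 4 ^ n) * 2 ^ (n + 1) +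
    weakConst n A δ * (2 ^ n * (2 ^ (n + 7) * β)))

theorem commConst_nonneg (n : ℕ) {A β : ℝ} (hA : 0 ≤ A) (δ : ℝ) (hβ : 0 ≤ β) :
    0 ≤ commConst n A δ β := by
  have := shellConst_nonneg δ
  have := weakConst_nonneg n hA δ
  have := commTwoConst_nonneg n A δ β
  unfold commConst; positivity

/-- Each atom gets its own centring `d i`. The terms with `T` outside are collected under one `T`,
so that the weak (1, 1) inequality is used once: weak-type bounds do not add up over the atoms. -/
theorem opCommutator_finset_sum_ae (T : L2Operator n) {b : EuclideanSpace ℝ (Fin n) → ℝ}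
    (hb : AEStronglyMeasurable b) {B : ℝ} (hB : ∀ x, |b x| ≤ B) {ι : Type*} (J : Finset ι)
    {h : ι → EuclideanSpace ℝ (Fin n) → ℝ} (hh : ∀ i ∈ J, MemLp (h i) 2) (d : ι → ℝ) :
    opCommutator b T.onFun (fun x => ∑ i ∈ J, h i x) =ᵐ[volume] fun x =>
      (∑ i ∈ J, (b x - d i) * T.onFun (h i) x) +
        -T.onFun (fun x => ∑ i ∈ J, (b x - d i) * h i x) x := by
  have h1 : ∀ i ∈ J, MemLp (fun x => b x * h i x) 2 := fun i hi => (hh i hi).bdd_mul_two hb hB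
  have h2 : ∀ i ∈ J, MemLp (fun x => (b x - d i) * h i x) 2 := fun i hi =>
    (hh i hi).bdd_mul_two (hb.sub aestronglyMeasurable_const) (B := B + |d i|) fun x =>
      (abs_sub _ _).trans (by linarith [hB x])
  have e : (fun x => b x * ∑ i ∈ J, h i x) = fun x => ∑ i ∈ J, b x * h i x := by
    funext x; rw [Finset.mul_sum]
  have h3 : ∀ᵐ x, ∀ i ∈ J, opCommutator b T.onFun (h i) x =
      (b x - d i) * T.onFun (h i) x - T.onFun (fun y => (b y - d i) * h i y) x :=
    (ae_ball_iff J.countable_toSet).2 fun i hi => opCommutator_ae_eq T (hh i hi) (h1 i hi) (d i)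
  filter_upwards [T.onFun_finset_sum J hh, T.onFun_finset_sum J h1, T.onFun_finset_sum J h2, h3]
    with x a1 a2 a3 a4
  rw [opCommutator, e, a1, a2, a3, Finset.mul_sum, ← Finset.sum_sub_distrib, ← sub_eq_add_neg,
    ← Finset.sum_sub_distrib]
  exact Finset.sum_congr rfl fun i hi => a4 i hi

/-- Four pieces: the good part by weak (2, 2), the error by the crude `L²` bound, the terms (b - d)
T h by decay off the atoms, and T of the sum of (b - d) h by weak (1, 1). Only the last one carries
p'. -/
theorem CZBound.weak_type_opCommutator_of_bounded (hn : 1 ≤ n) {T : L2Operator n}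
    {K : EuclideanSpace ℝ (Fin n) → EuclideanSpace ℝ (Fin n) → ℝ} {A δ : ℝ}
    (hT : CZBound T K A δ) {b : EuclideanSpace ℝ (Fin n) → ℝ} {β B : ℝ} (hb : BMOBound b β)
    (hB : ∀ x, |b x| ≤ B) {f : EuclideanSpace ℝ (Fin n) → ℝ} (hf : MemLp f 2) {p : ℝ}
    (hp1 : 1 < p) (hp2 : p ≤ 2) {t : ℝ} (ht : 0 < t) :
    volume {x | t < |opCommutator b T.onFun f x|} ≤
      ENNReal.ofReal (commConst n A δ β * (p / (p - 1)) / t ^ p) * ∫⁻ x, ‖f x‖ₑ ^ p := by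
  have hA := hT.kernel.pos
  have hβ := hb.pos
  have hsh := shellConst_nonneg δ
  have hwc := weakConst_nonneg n hA.le δ
  have hc2 := commTwoConst_nonneg n A δ β
  have hp0 : 0 < p := by linarith
  have hp' : 1 ≤ p / (p - 1) := by rw [le_div_iff₀ (by linarith)]; linarith
  set p' := p / (p - 1) with hp'def
  have hbm : AEStronglyMeasurable b volume := hb.locInt.aestronglyMeasurable
  have hB0 : 0 ≤ B := (abs_nonneg _).trans (hB 0)
  set I := ∫⁻ x, ‖f x‖ₑ ^ p with hI
  set D : ℝ := 2 ^ (n + 7) * β * (n + 3) * 4 ^ n with hD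
  set C₁ : ℝ := commTwoConst n A δ β * (1 + 4 ^ n) + (2 ^ (n + 1)) ^ n +
    A * shellConst δ * D * 2 ^ (n + 1) with hC₁
  set C₂ : ℝ := weakConst n A δ * (2 ^ n * (2 ^ (n + 7) * β)) with hC₂
  have hD0 : 0 < D := by positivity
  have hC₁pos : 0 < C₁ := by positivity
  have hC₂pos : 0 ≤ C₂ := by positivity
  suffices h4 : ∀ t : ℝ, 0 < t → volume {x | 4 * t < |opCommutator b T.onFun f x|} ≤
      ENNReal.ofReal ((C₁ + C₂ * p') / t ^ p) * I by
    have h := h4 (t / 4) (by positivity)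
    rw [mul_div_cancel₀ _ (by norm_num : (4 : ℝ) ≠ 0)] at h
    refine h.trans (mul_le_mul_left (ENNReal.ofReal_le_ofReal ?_) _)
    have htp := Real.rpow_pos_of_pos ht p
    rw [Real.div_rpow ht.le (by norm_num), commConst, ← hD, ← hC₁, ← hC₂, div_div_eq_mul_div]
    refine div_le_div_of_nonneg_right ?_ htp.le
    have h16 : (4 : ℝ) ^ p ≤ 16 := by
      calc (4 : ℝ) ^ p ≤ 4 ^ (2 : ℝ) := Real.rpow_le_rpow_of_exponent_le (by norm_num) hp2
        _ = 16 := by norm_num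
    calc (C₁ + C₂ * p') * 4 ^ p ≤ (C₁ * p' + C₂ * p') * 16 := by
          gcongr
          exact le_mul_of_one_le_right hC₁pos.le hp'
      _ = _ := by ring
  clear ht t
  intro t ht
  have htp : 0 < t ^ p := by positivity
  rcases eq_or_ne I ∞ with hItop | hItop
  · rw [hItop, ENNReal.mul_top]
    · exact le_top
    · simp only [ne_eq, ENNReal.ofReal_eq_zero, not_le]; positivity
  refine ENNReal.le_of_forall_pos_le_add fun ε hε _ => ?_
  obtain ⟨s, hs, J, g, e, m, hdec, hg, he, hesm, hgn, hmean, hm, hJp, hJvol⟩ :=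
    exists_cz_decomposition hn hf hp1.le hp2 hItop ht
      -- The error is chosen small enough to beat the crude operator norm; `B` influences only this
      -- choice, not the final constant.
      (κ := ENNReal.ofReal ((2 * B * A) ^ 2 / t ^ (2 : ℝ))) ENNReal.ofReal_ne_top
      (ε := (ε : ℝ≥0∞)) (by simpa using hε.ne')
  set h : ℕ × (Fin n → ℤ) → EuclideanSpace ℝ (Fin n) → ℝ :=
    fun q => (stopCube s q).indicator fun y => f y - m q with hh
  set d : ℕ × (Fin n → ℤ) → ℝ := fun q => cubeAvg b (stopCenter s q) (stopRadius s q) with hd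
  have hhm : ∀ q, MemLp (h q) 2 := fun q => memLp_atom hf hs q (m q)
  have hsumm : MemLp (fun x => ∑ q ∈ J, h q x) 2 := memLp_finsetSum J fun q _ => hhm q
  have hwm : ∀ q, AEStronglyMeasurable (fun x => b x - d q) volume := fun q =>
    hbm.sub aestronglyMeasurable_const
  have hwh : ∀ q, MemLp (fun x => (b x - d q) * h q x) 2 := fun q =>
    (hhm q).bdd_mul_two (hwm q) (B := B + |d q|) fun x =>
      (abs_sub _ _).trans (by linarith [hB x])
  set V : EuclideanSpace ℝ (Fin n) → ℝ := fun x => ∑ q ∈ J, (b x - d q) * h q x with hV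
  have hVm : MemLp V 2 := memLp_finsetSum J fun q _ => hwh q
  have hTf : opCommutator b T.onFun f =ᵐ[volume] fun x => opCommutator b T.onFun g x +
      (opCommutator b T.onFun e x + ((∑ q ∈ J, (b x - d q) * T.onFun (h q) x) +
        -T.onFun V x)) := by
    have h1 : f = fun x => g x + (e x + ∑ q ∈ J, h q x) := by
      funext x; rw [hdec x]; ring
    have hes : MemLp (fun x => e x + ∑ q ∈ J, h q x) 2 := he.add hsumm
    have h2 := opCommutator_add_ae T hg hes (hg.bdd_mul_two hbm hB) (hes.bdd_mul_two hbm hB)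
    have h3 := opCommutator_add_ae T he hsumm (he.bdd_mul_two hbm hB) (hsumm.bdd_mul_two hbm hB)
    have h4 := opCommutator_finset_sum_ae T hbm hB J (fun q _ => hhm q) d
    rw [← h1] at h2
    filter_upwards [h2, h3, h4] with x a1 a2 a3
    rw [a1, a2, a3]
  have hlev : volume {x | 4 * t < |opCommutator b T.onFun f x|} ≤
      volume {x | t < |opCommutator b T.onFun g x|} +
      (volume {x | t < |opCommutator b T.onFun e x|} +
        (volume {x | t < |∑ q ∈ J, (b x - d q) * T.onFun (h q) x|} +
          volume {x | t < |-T.onFun V x|})) := by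
    rw [show 4 * t = t + (t + (t + t)) by ring]
    refine (measure_lt_abs_add_le hTf t (t + (t + t))).trans (add_le_add le_rfl ?_)
    refine (measure_lt_abs_add_le (ae_eq_refl _) t (t + t)).trans (add_le_add le_rfl ?_)
    exact measure_lt_abs_add_le (ae_eq_refl _) t t
  have hgood : volume {x | t < |opCommutator b T.onFun g x|} ≤
      ENNReal.ofReal (commTwoConst n A δ β * (1 + 4 ^ n) / t ^ p) * I := by
    refine (hT.weak_two_opCommutator hn hb hB hg ht).trans ?_
    refine (mul_le_mul_right hgn _).trans (le_of_eq ?_)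
    rw [← mul_assoc, ← ENNReal.ofReal_mul (by positivity)]
    congr 2
    rw [Real.rpow_sub ht]
    field_simp
  have herr : volume {x | t < |opCommutator b T.onFun e x|} ≤ ε := by
    refine (measure_lt_abs_le (memLp_opCommutator T hbm hB).1 (p := 2) (by norm_num) ht).trans
      (le_trans ?_ hesm)
    rw [lintegral_enorm_rpow_two_eq]
    refine (mul_le_mul_right (ENNReal.rpow_le_rpow (eLpNorm_opCommutator_le T hT.norm_le hbm
      hB he) (by norm_num)) _).trans (le_of_eq ?_)
    rw [ENNReal.mul_rpow_of_nonneg _ _ (by norm_num), ← lintegral_enorm_rpow_two_eq,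
      ENNReal.ofReal_rpow_of_nonneg (by positivity) (by norm_num), ← mul_assoc,
      ← ENNReal.ofReal_mul (by positivity)]
    congr 2
    rw [Real.rpow_two (2 * B * A)]; ring
  have hbad : volume {x | t < |∑ q ∈ J, (b x - d q) * T.onFun (h q) x|} ≤
      ENNReal.ofReal (((2 ^ (n + 1)) ^ n + A * shellConst δ * D * 2 ^ (n + 1)) / t ^ p) * I := by
    refine (measure_lt_abs_sum_le J (fun q _ => (hwm q).mul (T.memLp_onFun (h q)).1)
      (E := fun q => cube (stopCenter s q) (2 ^ (n + 1) * stopRadius s q))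
      (fun q _ => measurableSet_cube _ _) ht).trans ?_
    have h1 : ∀ q ∈ J, ∫⁻ x in (cube (stopCenter s q) (2 ^ (n + 1) * stopRadius s q))ᶜ,
        ‖(b x - d q) * T.onFun (h q) x‖ₑ ≤
          ENNReal.ofReal (A * shellConst δ * D * 2 ^ (n + 1) * t) * volume (stopCube s q) := by
      intro q hq
      have hr := stopRadius_pos hs q
      have h2 := lintegral_mul_enorm_onFun_le hT (hhm q) hr
        (fun x hx => atom_eq_zero hs q hx) (by
          rw [hh]; simp only
          rw [integral_indicator (measurableSet_stopCube s q)]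
          exact hmean q hq) (w := fun x => ‖b x - d q‖ₑ) (hwm q).enorm (D := ENNReal.ofReal D)
        (fun j => hb.lintegral_shell_le _ hr j)
      simp_rw [enorm_mul]
      refine h2.trans ?_
      refine (mul_le_mul_right (lintegral_atom_le hf hs hp1.le ht (hm q hq) (hJp q hq)) _).trans
        (le_of_eq ?_)
      rw [← mul_assoc, ← ENNReal.ofReal_mul (by positivity), ← ENNReal.ofReal_mul (by positivity)]
      congr 2
      ring
    calc _ ≤ ∑ q ∈ J, ENNReal.ofReal ((2 ^ (n + 1)) ^ n) * volume (stopCube s q) +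
          ENNReal.ofReal (1 / t) * ∑ q ∈ J,
            ENNReal.ofReal (A * shellConst δ * D * 2 ^ (n + 1) * t) * volume (stopCube s q) := by
          refine add_le_add (Finset.sum_le_sum fun q _ => (volume_cube_stop_le hs q).le) ?_
          gcongr with q hq
          exact h1 q hq
      _ = ENNReal.ofReal ((2 ^ (n + 1)) ^ n + A * shellConst δ * D * 2 ^ (n + 1)) *
          ∑ q ∈ J, volume (stopCube s q) := by
          rw [← Finset.mul_sum, ← Finset.mul_sum, ← mul_assoc, ← ENNReal.ofReal_mul (by positivity),
            ← add_mul, ← ENNReal.ofReal_add (by positivity) (by positivity)]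
          congr 3
          field_simp
      _ ≤ _ := by
          refine (mul_le_mul_right hJvol _).trans (le_of_eq ?_)
          rw [← mul_assoc, ← ENNReal.ofReal_mul (by positivity)]
          congr 2
          ring
  have hbad' : volume {x | t < |-T.onFun V x|} ≤
      ENNReal.ofReal (C₂ * p' / t ^ p) * I := by
    simp_rw [abs_neg]
    refine (hT.weak_type hn hVm le_rfl (by norm_num) ht).trans ?_
    simp_rw [ENNReal.rpow_one]
    have h1 : ∫⁻ x, ‖V x‖ₑ ≤
        ENNReal.ofReal (2 ^ n * (2 ^ (n + 7) * β) * p' * t) * ∑ q ∈ J, volume (stopCube s q) := by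
      calc ∫⁻ x, ‖V x‖ₑ ≤ ∫⁻ x, ∑ q ∈ J, ‖(b x - d q) * h q x‖ₑ :=
            lintegral_mono fun x => enorm_sum_le J _
        _ = ∑ q ∈ J, ∫⁻ x, ‖(b x - d q) * h q x‖ₑ :=
            lintegral_finsetSum' J fun q _ => (hwh q).1.enorm
        _ ≤ _ := by
            rw [Finset.mul_sum]
            exact Finset.sum_le_sum fun q hq =>
              hb.lintegral_mul_atom_le hf hs hp1 ht (hm q hq) (hJp q hq)
    refine (mul_le_mul_right (h1.trans (mul_le_mul_right hJvol _)) _).trans (le_of_eq ?_)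
    rw [← mul_assoc, ← mul_assoc, ← ENNReal.ofReal_mul (by positivity),
      ← ENNReal.ofReal_mul (by positivity)]
    congr 2
    rw [Real.rpow_one, hC₂]; field_simp
  calc _ ≤ _ := hlev
    _ ≤ _ := add_le_add hgood (add_le_add herr (add_le_add hbad hbad'))
    _ = ENNReal.ofReal ((C₁ + C₂ * p') / t ^ p) * I + ε := by
        rw [add_left_comm, add_comm, ← add_mul, ← ENNReal.ofReal_add (by positivity)
          (by positivity), ← add_mul, ← ENNReal.ofReal_add (by positivity) (by positivity)]
        congr 3
        rw [hC₁]; ring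

theorem abs_sub_truncAt_le {N : ℝ} (hN : 0 ≤ N) (b : EuclideanSpace ℝ (Fin n) → ℝ)
    (x : EuclideanSpace ℝ (Fin n)) : |b x - truncAt N b x| ≤ |b x| := by
  unfold truncAt
  rcases le_total N (b x) with h | h
  · rw [min_eq_left h, max_eq_right (by linarith), abs_of_nonneg (by linarith),
      abs_of_nonneg (by linarith)]
    linarith
  · rw [min_eq_right h]
    rcases le_total (-N) (b x) with h' | h'
    · rw [max_eq_right h']; simp
    · rw [max_eq_left h', abs_of_nonpos (by linarith), abs_of_nonpos (by linarith)]
      linarith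

/-- The weak type `(p, p)` inequality, `1 < p ≤ 2`, for commutators with symbols in `BMO`. -/
theorem CZBound.weak_type_opCommutator (hn : 1 ≤ n) {T : L2Operator n}
    {K : EuclideanSpace ℝ (Fin n) → EuclideanSpace ℝ (Fin n) → ℝ} {A δ : ℝ}
    (hT : CZBound T K A δ) {b : EuclideanSpace ℝ (Fin n) → ℝ} {β : ℝ} (hb : BMOBound b β)
    {f : EuclideanSpace ℝ (Fin n) → ℝ} (hf : MemLp f 2) (hbf : MemLp (fun x => b x * f x) 2)
    {p : ℝ} (hp1 : 1 < p) (hp2 : p ≤ 2) {t : ℝ} (ht : 0 < t) :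
    volume {x | t < |opCommutator b T.onFun f x|} ≤
      ENNReal.ofReal (4 * commConst n A δ (2 * β) * (p / (p - 1)) / t ^ p) *
        ∫⁻ x, ‖f x‖ₑ ^ p := by
  have hA := hT.kernel.pos
  have hβ := hb.pos
  have hcc := commConst_nonneg n hA.le δ (β := 2 * β) (by positivity)
  have hp' : 0 < p / (p - 1) := div_pos (by linarith) (by linarith)
  have hbm : AEStronglyMeasurable b volume := hb.locInt.aestronglyMeasurable
  set I := ∫⁻ x, ‖f x‖ₑ ^ p with hI
  set C : ℝ≥0∞ := ENNReal.ofReal (4 * commConst n A δ (2 * β) * (p / (p - 1)) / t ^ p) * I with hC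
  set E : ℕ → Set (EuclideanSpace ℝ (Fin n)) := fun N => {x | (N : ℝ) < |b x|} with hE
  have hEm : ∀ N, NullMeasurableSet (E N) := fun N =>
    nullMeasurableSet_lt aemeasurable_const hbm.aemeasurable.abs
  have hEanti : Antitone E := fun i j hij x hx => by
    have h1 : (j : ℝ) < |b x| := hx
    have h2 : (i : ℝ) ≤ j := by exact_mod_cast hij
    exact lt_of_le_of_lt h2 h1
  have hEempty : ⋂ N, E N = ∅ := by
    refine Set.eq_empty_of_forall_notMem fun x hx => ?_
    obtain ⟨N, hN⟩ := exists_nat_ge |b x|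
    have h1 : (N : ℝ) < |b x| := Set.mem_iInter.1 hx N
    linarith
  have htail := tendsto_setLIntegral_antitone hbf.lintegral_rpow_two_ne_top hEm hEanti hEempty
  set a : ℝ := A ^ 2 / (t / 2) ^ (2 : ℝ) with ha
  -- Where |b| ≤ M ≤ N, the symbol equals its truncation b_N, so [b, T]f = [b_N, T]f - T((b - b_N)
  -- f) there. The last term tends to 0 in `L²` as N → ∞ because b f is square integrable; M → ∞
  -- comes afterwards.
  have key : ∀ M N : ℕ, M ≤ N → volume ({x | t < |opCommutator b T.onFun f x|} ∩ (E M)ᶜ) ≤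
      C + ENNReal.ofReal a * ∫⁻ x in E N, ‖b x * f x‖ₑ ^ (2 : ℝ) := by
    intro M N hMN
    set bN := truncAt (N : ℝ) b with hbN
    have hN0 : (0 : ℝ) ≤ N := N.cast_nonneg
    have hbNb : BMOBound bN (2 * β) := hb.truncAt hN0
    have hbNB : ∀ x, |bN x| ≤ N := abs_truncAt_le hN0 b
    have hbNm : AEStronglyMeasurable bN volume := hbNb.locInt.aestronglyMeasurable
    have hbNf : MemLp (fun x => bN x * f x) 2 := hf.bdd_mul_two hbNm hbNB
    have hdiff : MemLp (fun x => b x * f x - bN x * f x) 2 := hbf.sub hbNf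
    have h1 := T.onFun_sub hbf hbNf
    set R : EuclideanSpace ℝ (Fin n) → ℝ := fun x => b x * f x - bN x * f x with hR
    have hsub : volume ({x | t < |opCommutator b T.onFun f x|} ∩ (E M)ᶜ) ≤
        volume {x | t / 2 < |opCommutator bN T.onFun f x|} +
          volume {x | t / 2 < |-T.onFun R x|} := by
      have h2 : ∀ᵐ x, x ∈ (E M)ᶜ → opCommutator b T.onFun f x =
          opCommutator bN T.onFun f x + -T.onFun R x := by
        filter_upwards [h1] with x hx hxM
        have h3 : |b x| ≤ N := by
          have h4 : ¬ ((M : ℝ) < |b x|) := hxM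
          have h5 : (M : ℝ) ≤ N := by exact_mod_cast hMN
          linarith
        have h6 : bN x = b x := truncAt_of_abs_le h3
        rw [hx, opCommutator, opCommutator, h6]; ring
      refine le_trans (measure_mono_ae ?_) (measure_union_le _ _)
      filter_upwards [h2] with x hx hlt
      have hlt' : t < |opCommutator b T.onFun f x| := hlt.1
      rw [hx hlt.2] at hlt'
      by_contra hcon
      have h3 : ¬ (t / 2 < |opCommutator bN T.onFun f x| ∨ t / 2 < |-T.onFun R x|) := hcon
      push Not at h3
      have := abs_add_le (opCommutator bN T.onFun f x) (-T.onFun R x)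
      linarith
    refine hsub.trans (add_le_add ?_ ?_)
    · refine (hT.weak_type_opCommutator_of_bounded hn hbNb hbNB hf hp1 hp2
        (by positivity : 0 < t / 2)).trans (mul_le_mul_left (ENNReal.ofReal_le_ofReal ?_) _)
      have htp := Real.rpow_pos_of_pos ht p
      rw [Real.div_rpow ht.le (by norm_num), div_div_eq_mul_div]
      refine div_le_div_of_nonneg_right ?_ htp.le
      have h4 : (2 : ℝ) ^ p ≤ 4 := by
        calc (2 : ℝ) ^ p ≤ 2 ^ (2 : ℝ) := Real.rpow_le_rpow_of_exponent_le (by norm_num) hp2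
          _ = 4 := by norm_num
      calc commConst n A δ (2 * β) * (p / (p - 1)) * 2 ^ p
          ≤ commConst n A δ (2 * β) * (p / (p - 1)) * 4 := by gcongr
        _ = _ := by ring
    · simp_rw [abs_neg]
      refine (T.volume_lt_onFun_le hT.norm_le hdiff (by positivity : 0 < t / 2)).trans
        (mul_le_mul_right ?_ _)
      rw [← lintegral_indicator₀ (hEm N)]
      refine lintegral_mono fun x => ?_
      by_cases hx : x ∈ E N
      · rw [Set.indicator_of_mem hx]
        refine ENNReal.rpow_le_rpow ?_ (by norm_num)
        rw [hR]; simp only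
        rw [← sub_mul, enorm_mul, enorm_mul, Real.enorm_eq_ofReal_abs (b x - bN x),
          Real.enorm_eq_ofReal_abs (b x)]
        exact mul_le_mul_left (ENNReal.ofReal_le_ofReal (abs_sub_truncAt_le hN0 b x)) _
      · have h3 : bN x = b x := truncAt_of_abs_le (not_lt.1 hx)
        rw [Set.indicator_of_notMem hx, hR]
        simp [h3]
  have key2 : ∀ M : ℕ, volume ({x | t < |opCommutator b T.onFun f x|} ∩ (E M)ᶜ) ≤ C := by
    intro M
    have hlim := (ENNReal.Tendsto.const_mul htail (a := ENNReal.ofReal a)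
      (Or.inr ENNReal.ofReal_ne_top)).const_add C
    rw [mul_zero, add_zero] at hlim
    exact ge_of_tendsto hlim ((eventually_ge_atTop M).mono fun N hN => key M N hN)
  have hmono : Monotone fun M => {x | t < |opCommutator b T.onFun f x|} ∩ (E M)ᶜ :=
    fun i j hij => Set.inter_subset_inter_right _ (Set.compl_subset_compl.2 (hEanti hij))
  have hU : ⋃ M, ({x | t < |opCommutator b T.onFun f x|} ∩ (E M)ᶜ) =
      {x | t < |opCommutator b T.onFun f x|} := by
    rw [← Set.inter_iUnion, ← Set.compl_iInter, hEempty, Set.compl_empty, Set.inter_univ]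
  rw [← hU]
  exact le_of_tendsto' (tendsto_measure_iUnion_atTop hmono) key2

end WeakCommutator

/-! ### From weak type on (1, 2] to all exponents, by duality and interpolation. -/

section Interpolation

variable {X : Type*} [MeasureSpace X]

/-- Weak type `(r, r)` bounds for `S` on `D`, with constant `C (r / (r - 1)) ^ k`, `1 < r ≤ 2`. -/
structure WeakTypeBounds (D : Set (X → ℝ)) (S : (X → ℝ) → X → ℝ) (C : ℝ) (k : ℕ) : Prop where
  one_le : 1 ≤ C
  meas : ∀ f ∈ D, AEStronglyMeasurable (S f)
  bound : ∀ f ∈ D, ∀ r : ℝ, 1 < r → r ≤ 2 → ∀ t : ℝ, 0 < t →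
    volume {x | t < |S f x|} ≤ ENNReal.ofReal (C * (r / (r - 1)) ^ k / t ^ r) * ∫⁻ x, ‖f x‖ₑ ^ r

/-- A solid space of functions that contains enough bounded functions. -/
structure IsSolidDomain (D : Set (X → ℝ)) : Prop where
  meas : ∀ f ∈ D, AEStronglyMeasurable f
  solid : ∀ f ∈ D, ∀ g : X → ℝ, AEStronglyMeasurable g → (∀ x, |g x| ≤ |f x|) → g ∈ D
  exhaust : ∃ G : ℕ → Set X, (∀ N, MeasurableSet (G N)) ∧ Monotone G ∧ ⋃ N, G N = Set.univ ∧
    (∀ N, volume (G N) ≠ ∞) ∧ ∀ N, ∀ g : X → ℝ, Measurable g → (∀ x, |g x| ≤ 1) →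
      (∀ x ∉ G N, g x = 0) → g ∈ D

theorem lintegral_Ioc_rpow {a : ℝ} (ha : -1 < a) :
    ∫⁻ s in Set.Ioc (0 : ℝ) 1, ENNReal.ofReal (s ^ a) = ENNReal.ofReal (1 / (a + 1)) := by
  rw [← ofReal_integral_eq_lintegral_ofReal]
  · rw [← intervalIntegral.integral_of_le zero_le_one, integral_rpow (Or.inl ha), Real.one_rpow,
      Real.zero_rpow (by linarith), sub_zero]
  · exact (intervalIntegrable_iff_integrableOn_Ioc_of_le zero_le_one).1
      (intervalIntegral.intervalIntegrable_rpow' ha)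
  · exact (ae_restrict_iff' measurableSet_Ioc).2 (ae_of_all _ fun s hs =>
      Real.rpow_nonneg hs.1.le _)

theorem lintegral_Ioi_rpow {a : ℝ} (ha : a < -1) :
    ∫⁻ s in Set.Ioi (1 : ℝ), ENNReal.ofReal (s ^ a) = ENNReal.ofReal (1 / (-a - 1)) := by
  rw [← ofReal_integral_eq_lintegral_ofReal (integrableOn_Ioi_rpow_of_lt ha one_pos)]
  · rw [integral_Ioi_rpow_of_lt ha one_pos, Real.one_rpow]
    congr 1
    rw [show -a - 1 = -(a + 1) by ring, div_neg, neg_div]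
  · exact (ae_restrict_iff' measurableSet_Ioi).2 (ae_of_all _ fun s hs =>
      Real.rpow_nonneg (one_pos.trans hs).le _)

/-- Marcinkiewicz interpolation on functions bounded by one. -/
theorem WeakTypeBounds.lintegral_rpow_le {D : Set (X → ℝ)} {S : (X → ℝ) → X → ℝ} {C : ℝ} {k : ℕ}
    (hS : WeakTypeBounds D S C k) {g : X → ℝ} (hg : g ∈ D) {E : Set X} (hE : MeasurableSet E)
    (hg1 : ∀ x, |g x| ≤ 1) (hgE : ∀ x ∉ E, g x = 0) {p : ℝ} (hp : 4 ≤ p) :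
    ∫⁻ x, ‖S g x‖ₑ ^ (p / (p - 1)) ≤
      ENNReal.ofReal (C * 2 ^ (k + 2) * p ^ (k + 1)) * volume E := by
  have hC : 0 < C := by linarith [hS.one_le]
  set q := p / (p - 1) with hq
  have hp1 : 0 < p - 1 := by linarith
  have hq1 : q - 1 = 1 / (p - 1) := by rw [hq]; field_simp; ring
  have hq1' : 1 < q := by have : 0 < 1 / (p - 1) := by positivity
                          linarith
  have hq2 : q ≤ 4 / 3 := by rw [hq, div_le_iff₀ hp1]; linarith
  set V := volume E with hV
  have hgr : ∀ r : ℝ, 1 < r → ∫⁻ x, ‖g x‖ₑ ^ r ≤ V := by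
    intro r hr
    rw [hV, ← setLIntegral_one, ← lintegral_indicator hE]
    refine lintegral_mono fun x => ?_
    by_cases hx : x ∈ E
    · rw [Set.indicator_of_mem hx, Real.enorm_eq_ofReal_abs]
      refine ENNReal.rpow_le_one ?_ (by linarith)
      rw [← ENNReal.ofReal_one]
      exact ENNReal.ofReal_le_ofReal (hg1 x)
    · rw [Set.indicator_of_notMem hx, hgE x hx, enorm_zero, ENNReal.zero_rpow_of_pos (by linarith)]
  have hw : ∀ r : ℝ, 1 < r → r ≤ 2 → ∀ s : ℝ, 0 < s →
      volume {x | s < |S g x|} * ENNReal.ofReal (s ^ (q - 1)) ≤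
        ENNReal.ofReal (C * (r / (r - 1)) ^ k) * V * ENNReal.ofReal (s ^ (q - 1 - r)) := by
    intro r hr hr2 s hs
    refine (mul_le_mul_left ((hS.bound g hg r hr hr2 s hs).trans (mul_le_mul_right (hgr r hr) _))
      _).trans (le_of_eq ?_)
    have hrk : 0 ≤ r / (r - 1) := div_nonneg (by linarith) (by linarith)
    rw [mul_right_comm, ← ENNReal.ofReal_mul (by positivity), mul_right_comm,
      ← ENNReal.ofReal_mul (by positivity), Real.rpow_sub hs (q - 1) r]
    congr 2; ring
  have hlc : ∫⁻ x, ‖S g x‖ₑ ^ q =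
      ENNReal.ofReal q * ∫⁻ s in Set.Ioi (0 : ℝ),
        volume {x | s < |S g x|} * ENNReal.ofReal (s ^ (q - 1)) := by
    rw [← lintegral_rpow_eq_lintegral_meas_lt_mul volume
      (Eventually.of_forall fun x => abs_nonneg _) (hS.meas g hg).aemeasurable.abs (by linarith)]
    refine lintegral_congr fun x => ?_
    rw [Real.enorm_eq_ofReal_abs, ENNReal.ofReal_rpow_of_nonneg (abs_nonneg _) (by linarith)]
  -- Halfway between 1 and `q`: below `q`, so that the integral near 0 converges with value `2 * (p
  -- - 1)`, and far enough from 1 that `r / (r - 1) ≤ 2 * p`.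
  set r := (1 + q) / 2 with hr
  have hr1 : 1 < r := by rw [hr]; linarith
  have hrr : r / (r - 1) ≤ 2 * p := by
    have h1 : r - 1 = 1 / (2 * (p - 1)) := by
      rw [hr, show (1 + q) / 2 - 1 = (q - 1) / 2 by ring, hq1]; field_simp
    rw [h1, div_div_eq_mul_div, div_one, hr]
    have h2 : q * (p - 1) = p := by rw [hq]; field_simp
    nlinarith
  have hr0 : 0 < r / (r - 1) := div_pos (by linarith) (by linarith)
  have hsmall : ∫⁻ s in Set.Ioc (0 : ℝ) 1,
      volume {x | s < |S g x|} * ENNReal.ofReal (s ^ (q - 1)) ≤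
        ENNReal.ofReal (C * (2 * p) ^ k * (2 * (p - 1))) * V := by
    calc _ ≤ ∫⁻ s in Set.Ioc (0 : ℝ) 1,
          ENNReal.ofReal (C * (r / (r - 1)) ^ k) * V * ENNReal.ofReal (s ^ (q - 1 - r)) :=
          setLIntegral_mono_ae' measurableSet_Ioc (ae_of_all _ fun s hs =>
            hw r hr1 (by rw [hr]; linarith) s hs.1)
      _ = ENNReal.ofReal (C * (r / (r - 1)) ^ k) * V * ENNReal.ofReal (1 / (q - 1 - r + 1)) := by
          rw [lintegral_const_mul _ (by fun_prop), lintegral_Ioc_rpow (by rw [hr]; linarith)]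
      _ = ENNReal.ofReal (C * (r / (r - 1)) ^ k * (2 * (p - 1))) * V := by
          rw [mul_right_comm, ← ENNReal.ofReal_mul (by positivity)]
          congr 3
          rw [show q - 1 - r + 1 = (q - 1) / 2 by rw [hr]; ring, hq1]; field_simp
      _ ≤ _ := by gcongr
  -- At large heights the exponent 2 serves; it stays away from `q ≤ 4 / 3`, so nothing grows with p
  -- beyond a constant.
  have hlarge : ∫⁻ s in Set.Ioi (1 : ℝ),
      volume {x | s < |S g x|} * ENNReal.ofReal (s ^ (q - 1)) ≤
        ENNReal.ofReal (C * 2 ^ k * (3 / 2)) * V := by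
    calc _ ≤ ∫⁻ s in Set.Ioi (1 : ℝ),
          ENNReal.ofReal (C * (2 / (2 - 1)) ^ k) * V * ENNReal.ofReal (s ^ (q - 1 - 2)) :=
          setLIntegral_mono_ae' measurableSet_Ioi (ae_of_all _ fun s hs =>
            hw 2 (by norm_num) le_rfl s (one_pos.trans hs))
      _ = ENNReal.ofReal (C * 2 ^ k) * V * ENNReal.ofReal (1 / (-(q - 1 - 2) - 1)) := by
          rw [lintegral_const_mul _ (by fun_prop), lintegral_Ioi_rpow (by linarith)]
          norm_num
      _ = ENNReal.ofReal (C * 2 ^ k * (1 / (2 - q))) * V := by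
          rw [mul_right_comm, ← ENNReal.ofReal_mul (by positivity)]
          congr 4; ring
      _ ≤ _ := by
          refine mul_le_mul_left (ENNReal.ofReal_le_ofReal
            (mul_le_mul_of_nonneg_left ?_ (by positivity))) _
          rw [div_le_iff₀ (by linarith)]; linarith
  rw [hlc, ← Set.Ioc_union_Ioi_eq_Ioi zero_le_one, lintegral_union measurableSet_Ioi
    (Set.disjoint_left.2 fun x hx hx' => not_lt.2 hx.2 hx')]
  refine (mul_le_mul_right (add_le_add hsmall hlarge) _).trans ?_
  rw [← add_mul, ← ENNReal.ofReal_add (by positivity) (by positivity), ← mul_assoc,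
    ← ENNReal.ofReal_mul (by linarith)]
  refine mul_le_mul_left (ENNReal.ofReal_le_ofReal ?_) _
  have hpk : (1 : ℝ) ≤ p ^ k := one_le_pow₀ (by linarith)
  have h2 : q * (p - 1) = p := by rw [hq]; field_simp
  have h3 : q * (C * (2 * p) ^ k * (2 * (p - 1)) + C * 2 ^ k * (3 / 2)) =
      C * 2 ^ k * (2 * p ^ k * (q * (p - 1)) + q * (3 / 2)) := by rw [mul_pow]; ring
  rw [h3, h2, show C * 2 ^ (k + 2) * p ^ (k + 1) = C * 2 ^ k * (4 * (p ^ k * p)) by ring]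
  refine mul_le_mul_of_nonneg_left ?_ (by positivity)
  nlinarith

/-- Weak type bounds for large exponents by duality. -/
theorem WeakTypeBounds.dual {D : Set (X → ℝ)} {S S' : (X → ℝ) → X → ℝ} {C : ℝ} {k : ℕ}
    (hD : IsSolidDomain D) (hSm : ∀ f ∈ D, AEStronglyMeasurable (S f))
    (hS' : WeakTypeBounds D S' C k)
    (hint : ∀ f ∈ D, ∀ g ∈ D, Integrable fun x => S f x * g x)
    (hdual : ∀ f ∈ D, ∀ g ∈ D, ∫ x, S f x * g x = ∫ x, f x * S' g x)
    {f : X → ℝ} (hf : f ∈ D) {p : ℝ} (hp : 4 ≤ p) (t : ℝ) :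
    ENNReal.ofReal t * volume {x | t < |S f x|} ^ (1 / p) ≤
      ENNReal.ofReal (C * 2 ^ (k + 2) * p ^ (k + 1)) * (∫⁻ x, ‖f x‖ₑ ^ p) ^ (1 / p) := by
  have hC : 0 < C := by linarith [hS'.one_le]
  have hp0 : 0 < p := by linarith
  set Ψ : ℝ := C * 2 ^ (k + 2) * p ^ (k + 1) with hΨ
  have hΨ1 : 1 ≤ Ψ := by
    have h1 : (1 : ℝ) ≤ 2 ^ (k + 2) := one_le_pow₀ (by norm_num)
    have h2 : (1 : ℝ) ≤ p ^ (k + 1) := one_le_pow₀ (by linarith)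
    have h3 := one_le_mul_of_one_le_of_one_le hS'.one_le h1
    exact one_le_mul_of_one_le_of_one_le h3 h2
  set q := p / (p - 1) with hq
  have hpq : p.HolderConjugate q := Real.HolderConjugate.conjExponent (by linarith)
  have hq0 : 0 < q := hpq.symm.pos
  obtain ⟨G, hGm, hGmono, hGU, hGfin, hGD⟩ := hD.exhaust
  -- A measurable representative is needed for the level set, and hence the test function, to be
  -- honestly measurable.
  set v := (hSm f hf).mk (S f) with hv
  have hvm : Measurable v := (hSm f hf).stronglyMeasurable_mk.measurable
  have hve : S f =ᵐ[volume] v := (hSm f hf).ae_eq_mk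
  have hvol : volume {x | t < |S f x|} = volume {x | t < |v x|} := by
    refine measure_congr ?_
    filter_upwards [hve] with x hx
    change (t < |S f x|) = (t < |v x|)
    rw [hx]
  set I := (∫⁻ x, ‖f x‖ₑ ^ p) ^ (1 / p) with hI
  have key : ∀ N, ENNReal.ofReal t * volume ({x | t < |v x|} ∩ G N) ^ (1 / p) ≤
      ENNReal.ofReal Ψ * I := by
    intro N
    set E := {x | t < |v x|} ∩ G N with hE
    have hEm : MeasurableSet E := (measurableSet_lt measurable_const hvm.abs).inter (hGm N)
    have hEfin : volume E ≠ ∞ :=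
      ne_top_of_le_ne_top (hGfin N) (measure_mono Set.inter_subset_right)
    -- Pairing with the sign of `S f` on the truncated level set recovers the integral of |S f|
    -- there. The truncation keeps `E` of finite measure and `g` in the domain.
    set g : X → ℝ := E.indicator fun x => if 0 ≤ v x then 1 else -1 with hg
    have hgm : Measurable g :=
      (Measurable.ite (measurableSet_le measurable_const hvm) measurable_const
        measurable_const).indicator hEm
    have hg1 : ∀ x, |g x| ≤ 1 := by
      intro x
      by_cases hx : x ∈ E
      · rw [hg, Set.indicator_of_mem hx]
        split_ifs <;> simp
      · rw [hg, Set.indicator_of_notMem hx]; simp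
    have hgE : ∀ x ∉ E, g x = 0 := fun x hx => Set.indicator_of_notMem hx _
    have hgD : g ∈ D := hGD N g hgm hg1 fun x hx => hgE x fun h => hx h.2
    have hlow : ENNReal.ofReal t * volume E ≤ ENNReal.ofReal (∫ x, S f x * g x) := by
      rw [ofReal_integral_eq_lintegral_ofReal (hint f hf g hgD), ← setLIntegral_const,
        ← lintegral_indicator hEm]
      · refine lintegral_mono_ae ?_
        filter_upwards [hve] with x hx
        by_cases hxE : x ∈ E
        · rw [Set.indicator_of_mem hxE, hx, hg, Set.indicator_of_mem hxE]
          apply ENNReal.ofReal_le_ofReal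
          have h1 : t < |v x| := hxE.1
          split_ifs with h0
          · rw [abs_of_nonneg h0] at h1; linarith
          · rw [abs_of_neg (not_le.1 h0)] at h1; linarith
        · rw [Set.indicator_of_notMem hxE]; exact zero_le
      · filter_upwards [hve] with x hx
        by_cases hxE : x ∈ E
        · rw [hx, hg, Set.indicator_of_mem hxE]
          split_ifs with h0
          · simpa using h0
          · simp only [Pi.zero_apply]; linarith [not_le.1 h0]
        · rw [hgE x hxE]; simp
    have hup : ENNReal.ofReal (∫ x, S f x * g x) ≤
        I * (ENNReal.ofReal Ψ * volume E) ^ (1 / q) := by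
      rw [hdual f hf g hgD]
      calc _ ≤ ‖∫ x, f x * S' g x‖ₑ := by
            rw [Real.enorm_eq_ofReal_abs]; exact ENNReal.ofReal_le_ofReal (le_abs_self _)
        _ ≤ ∫⁻ x, ‖f x‖ₑ * ‖S' g x‖ₑ := by
            refine (enorm_integral_le_lintegral_enorm _).trans (le_of_eq ?_)
            simp_rw [enorm_mul]
        _ ≤ I * (∫⁻ x, ‖S' g x‖ₑ ^ q) ^ (1 / q) :=
            ENNReal.lintegral_mul_le_Lp_mul_Lq volume hpq (hD.meas f hf).enorm
              (hS'.meas g hgD).enorm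
        _ ≤ _ := by
            refine mul_le_mul_right (ENNReal.rpow_le_rpow ?_ (by positivity)) _
            exact hS'.lintegral_rpow_le hgD hEm hg1 hgE hp
    rcases eq_or_ne (volume E) 0 with h0 | h0
    · rw [h0, ENNReal.zero_rpow_of_pos (by positivity), mul_zero]; exact zero_le
    have h1 := hlow.trans hup
    have hsplit : volume E = volume E ^ (1 / p) * volume E ^ (1 / q) := by
      rw [← ENNReal.rpow_add_of_nonneg _ _ (by positivity) (by positivity), one_div, one_div,
        hpq.inv_add_inv_eq_one, ENNReal.rpow_one]
    have hc0 : volume E ^ (1 / q) ≠ 0 := by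
      rw [ne_eq, ENNReal.rpow_eq_zero_iff]
      push Not
      exact ⟨fun h => absurd h h0, fun h => absurd h hEfin⟩
    have hct : volume E ^ (1 / q) ≠ ∞ := ENNReal.rpow_ne_top_of_nonneg (by positivity) hEfin
    rw [ENNReal.mul_rpow_of_nonneg _ _ (by positivity)] at h1
    conv_lhs at h1 => rw [hsplit]
    rw [← mul_assoc, ← mul_assoc] at h1
    have h2 := (ENNReal.mul_le_mul_iff_left hc0 hct).1 h1
    refine h2.trans ?_
    rw [mul_comm]
    refine mul_le_mul_left ?_ _
    calc ENNReal.ofReal Ψ ^ (1 / q) ≤ ENNReal.ofReal Ψ ^ (1 : ℝ) := by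
          refine ENNReal.rpow_le_rpow_of_exponent_le ?_ ?_
          · rw [← ENNReal.ofReal_one]; exact ENNReal.ofReal_le_ofReal hΨ1
          · rw [div_le_one hq0]; exact hpq.symm.lt.le
      _ = _ := ENNReal.rpow_one _
  have hmono : Monotone fun N => {x | t < |v x|} ∩ G N :=
    fun i j hij => Set.inter_subset_inter_right _ (hGmono hij)
  have hU : ⋃ N, ({x | t < |v x|} ∩ G N) = {x | t < |v x|} := by
    rw [← Set.inter_iUnion, hGU, Set.inter_univ]
  have hlim := tendsto_measure_iUnion_atTop (μ := volume) hmono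
  rw [hU] at hlim
  rw [hvol]
  have hlim2 := ENNReal.Tendsto.const_mul (a := ENNReal.ofReal t)
    ((ENNReal.continuous_rpow_const (y := 1 / p)).continuousAt.tendsto.comp hlim)
    (Or.inr ENNReal.ofReal_ne_top)
  exact le_of_tendsto' hlim2 key

/-- Constants at least 1 only shrink under the p-th root; hence the normalisation `one_le` in
`WeakTypeBounds`. -/
theorem mul_rpow_le_of_le_div {p t a : ℝ} (hp : 1 < p) (ht : 0 < t) (ha : 1 ≤ a) {V J : ℝ≥0∞}
    (h : V ≤ ENNReal.ofReal (a / t ^ p) * J) :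
    ENNReal.ofReal t * V ^ (1 / p) ≤ ENNReal.ofReal a * J ^ (1 / p) := by
  have hp0 : 0 < p := by linarith
  have htp : 0 < t ^ p := by positivity
  have h1 : V ^ (1 / p) ≤ ENNReal.ofReal ((a / t ^ p) ^ (1 / p)) * J ^ (1 / p) := by
    refine (ENNReal.rpow_le_rpow h (by positivity)).trans (le_of_eq ?_)
    rw [ENNReal.mul_rpow_of_nonneg _ _ (by positivity),
      ENNReal.ofReal_rpow_of_nonneg (by positivity) (by positivity)]
  refine (mul_le_mul_right h1 _).trans ?_
  rw [← mul_assoc, ← ENNReal.ofReal_mul ht.le]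
  refine mul_le_mul_left (ENNReal.ofReal_le_ofReal ?_) _
  rw [Real.div_rpow (by linarith) htp.le, ← Real.rpow_mul ht.le, mul_one_div_cancel hp0.ne',
    Real.rpow_one, mul_div_cancel₀ _ ht.ne']
  calc a ^ (1 / p) ≤ a ^ (1 : ℝ) :=
        Real.rpow_le_rpow_of_exponent_le ha ((div_le_one hp0).2 hp.le)
    _ = a := Real.rpow_one a

/-- Weak type bounds on `(1, 2]` for an operator and its adjoint control the weak type operator
norm of the operator for all exponents. -/
theorem weakOpNorm_le_of_weakTypeBounds {D : Set (X → ℝ)} {S S' : (X → ℝ) → X → ℝ} {C : ℝ} {k : ℕ}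
    (hD : IsSolidDomain D) (hS : WeakTypeBounds D S C k) (hS' : WeakTypeBounds D S' C k)
    (hadd : ∀ f ∈ D, ∀ g ∈ D, S (fun x => f x + g x) =ᵐ[volume] fun x => S f x + S g x)
    (hint : ∀ f ∈ D, ∀ g ∈ D, Integrable fun x => S f x * g x)
    (hdual : ∀ f ∈ D, ∀ g ∈ D, ∫ x, S f x * g x = ∫ x, f x * S' g x) :
    ∃ c : ℝ, 0 < c ∧ ∀ p : ℝ, 1 < p →
      weakOpNorm D S p ≤ ENNReal.ofReal (c * (p / (p - 1)) ^ k * p ^ (k + 1)) := by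
  have hC1 := hS.one_le
  have hC : 0 < C := by linarith
  set C₄ : ℝ := C * 2 ^ (k + 2) * 4 ^ (k + 1) with hC₄
  have hC₄0 : 0 < C₄ := by positivity
  set C₃ : ℝ := 2 * (C * 2 ^ k + C₄ ^ 4) with hC₃
  set c : ℝ := C * 2 ^ (k + 2) + C₃ with hc
  have hc0 : 0 < c := by positivity
  refine ⟨c, hc0, fun p hp => weakOpNorm_le fun f hf hfp => weakLpNorm_le fun t ht0 => ?_⟩
  have hp0 : 0 < p := by linarith
  have ht : 0 < (t : ℝ) := by positivity
  have hφ : 1 ≤ p / (p - 1) := by rw [le_div_iff₀ (by linarith)]; linarith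
  have hφk : 1 ≤ (p / (p - 1)) ^ k := one_le_pow₀ hφ
  have hpk : 1 ≤ p ^ (k + 1) := one_le_pow₀ hp.le
  have hset : {x | (t : ℝ≥0∞) < ‖S f x‖ₑ} = {x | (t : ℝ) < |S f x|} := by
    ext x
    rw [Set.mem_ofPred_eq, Set.mem_ofPred_eq, Real.enorm_eq_ofReal_abs,
      ← ENNReal.ofReal_coe_nnreal, ENNReal.ofReal_lt_ofReal_iff_of_nonneg t.coe_nonneg]
  rw [hset, ← ENNReal.ofReal_coe_nnreal, eLpNorm_eq_lintegral_rpow_enorm_toReal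
    (by simpa using hp0) ENNReal.ofReal_ne_top, ENNReal.toReal_ofReal hp0.le]
  set J := ∫⁻ x, ‖f x‖ₑ ^ p with hJ
  have hfin : ∀ a : ℝ, a ≤ c * (p / (p - 1)) ^ k * p ^ (k + 1) →
      ENNReal.ofReal a * J ^ (1 / p) ≤
        ENNReal.ofReal (c * (p / (p - 1)) ^ k * p ^ (k + 1)) * J ^ (1 / p) := fun a ha =>
    mul_le_mul_left (ENNReal.ofReal_le_ofReal ha) _
  rcases le_or_gt p 2 with hp2 | hp2
  · refine (mul_rpow_le_of_le_div hp ht (one_le_mul_of_one_le_of_one_le hC1 hφk)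
      (hS.bound f hf p hp hp2 t ht)).trans (hfin _ ?_)
    have h1 : C ≤ c := by
      have : (1 : ℝ) ≤ 2 ^ (k + 2) := one_le_pow₀ (by norm_num)
      rw [hc]; nlinarith [(by positivity : 0 < C₃)]
    calc C * (p / (p - 1)) ^ k ≤ c * (p / (p - 1)) ^ k := by gcongr
      _ ≤ _ := le_mul_of_one_le_right (by positivity) hpk
  rcases le_or_gt 4 p with hp4 | hp4
  · refine (hS'.dual hD hS.meas hint hdual hf hp4 t).trans (hfin _ ?_)
    refine mul_le_mul_of_nonneg_right ?_ (by positivity)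
    refine le_trans ?_ (le_mul_of_one_le_right hc0.le hφk)
    rw [hc]; linarith [(by positivity : 0 < C₃)]
  have hfm := hD.meas f hf
  -- Now 2 < p < 4: `f` is cut at height `s`, the large values going through the weak type at 2 and
  -- the small ones through the dual bound at 4. Solidity keeps both pieces in the domain.
  have hlev : ∀ s : ℝ, 0 < s → volume {x | 2 * s < |S f x|} ≤
      ENNReal.ofReal ((C * 2 ^ k + C₄ ^ 4) / s ^ p) * J := by
    intro s hs
    set E := {x | s < |f x|} with hE
    have hEm : NullMeasurableSet E := nullMeasurableSet_lt aemeasurable_const hfm.aemeasurable.abs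
    set f₁ := E.indicator f with hf₁
    set f₂ := Eᶜ.indicator f with hf₂
    have habs : ∀ (F : Set X) x, |F.indicator f x| ≤ |f x| := fun F x => by
      by_cases hx : x ∈ F
      · rw [Set.indicator_of_mem hx]
      · rw [Set.indicator_of_notMem hx]; simp
    have h₁ : f₁ ∈ D := hD.solid f hf _ (hfm.indicator₀ hEm) (habs _)
    have h₂ : f₂ ∈ D := hD.solid f hf _ (hfm.indicator₀ hEm.compl) (habs _)
    have e : f = fun x => f₁ x + f₂ x := by
      funext x; exact (Set.indicator_self_add_compl_apply _ _ _).symm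
    have h3 := hadd f₁ h₁ f₂ h₂
    rw [← e] at h3
    have h4 := measure_lt_abs_add_le h3 s s
    rw [← two_mul] at h4
    have hsp := Real.rpow_pos_of_pos hs p
    have hi1 : ∫⁻ x, ‖f₁ x‖ₑ ^ (2 : ℝ) ≤ ENNReal.ofReal (s ^ (2 - p)) * J := by
      rw [hJ, ← lintegral_const_mul' _ _ ENNReal.ofReal_ne_top]
      refine lintegral_mono fun x => ?_
      by_cases hx : x ∈ E
      · have hx' : s < |f x| := hx
        have hx0 : 0 < |f x| := hs.trans hx'
        rw [hf₁, Set.indicator_of_mem hx, Real.enorm_eq_ofReal_abs,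
          ENNReal.ofReal_rpow_of_nonneg (abs_nonneg _) (by norm_num),
          ENNReal.ofReal_rpow_of_nonneg (abs_nonneg _) hp0.le, ← ENNReal.ofReal_mul (by positivity)]
        apply ENNReal.ofReal_le_ofReal
        have h5 : |f x| ^ (2 : ℝ) = |f x| ^ (2 - p) * |f x| ^ p := by
          rw [← Real.rpow_add hx0]; congr 1; ring
        rw [h5]
        refine mul_le_mul_of_nonneg_right ?_ (by positivity)
        exact Real.rpow_le_rpow_of_nonpos hs hx'.le (by linarith)
      · rw [hf₁, Set.indicator_of_notMem hx]; simp
    have hi2 : ∫⁻ x, ‖f₂ x‖ₑ ^ (4 : ℝ) ≤ ENNReal.ofReal (s ^ (4 - p)) * J := by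
      rw [hJ, ← lintegral_const_mul' _ _ ENNReal.ofReal_ne_top]
      refine lintegral_mono fun x => ?_
      by_cases hx : x ∈ Eᶜ
      · have hx' : |f x| ≤ s := not_lt.1 hx
        rw [hf₂, Set.indicator_of_mem hx, Real.enorm_eq_ofReal_abs,
          ENNReal.ofReal_rpow_of_nonneg (abs_nonneg _) (by norm_num),
          ENNReal.ofReal_rpow_of_nonneg (abs_nonneg _) hp0.le, ← ENNReal.ofReal_mul (by positivity)]
        apply ENNReal.ofReal_le_ofReal
        have h5 : |f x| ^ (4 : ℝ) = |f x| ^ (4 - p) * |f x| ^ p := by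
          rw [← Real.rpow_add_of_nonneg (abs_nonneg _) (by linarith) hp0.le]; congr 1; ring
        rw [h5]
        refine mul_le_mul_of_nonneg_right ?_ (by positivity)
        exact Real.rpow_le_rpow (abs_nonneg _) hx' (by linarith)
      · rw [hf₂, Set.indicator_of_notMem hx]; simp
    have hb1 : volume {x | s < |S f₁ x|} ≤ ENNReal.ofReal (C * 2 ^ k / s ^ p) * J := by
      refine (hS.bound f₁ h₁ 2 (by norm_num) le_rfl s hs).trans
        ((mul_le_mul_right hi1 _).trans (le_of_eq ?_))
      rw [← mul_assoc, ← ENNReal.ofReal_mul (by positivity)]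
      congr 2
      rw [Real.rpow_sub hs]
      norm_num
      field_simp
    have hb2 : volume {x | s < |S f₂ x|} ≤ ENNReal.ofReal (C₄ ^ 4 / s ^ p) * J := by
      have h5 := hS'.dual hD hS.meas hint hdual h₂ (p := 4) le_rfl s
      rw [← hC₄] at h5
      have h6 := ENNReal.rpow_le_rpow h5 (z := 4) (by norm_num)
      rw [ENNReal.mul_rpow_of_nonneg _ _ (by norm_num), ENNReal.mul_rpow_of_nonneg _ _ (by norm_num),
        ← ENNReal.rpow_mul, ← ENNReal.rpow_mul, ENNReal.ofReal_rpow_of_nonneg hs.le (by norm_num),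
        ENNReal.ofReal_rpow_of_nonneg hC₄0.le (by norm_num), one_div_mul_cancel (by norm_num),
        ENNReal.rpow_one, ENNReal.rpow_one] at h6
      have h7 := mul_le_mul_right (h6.trans (mul_le_mul_right hi2 _))
        (ENNReal.ofReal (1 / s ^ (4 : ℝ)))
      rw [← mul_assoc, ← mul_assoc, ← mul_assoc, ← ENNReal.ofReal_mul (by positivity),
        ← ENNReal.ofReal_mul (by positivity), ← ENNReal.ofReal_mul (by positivity),
        one_div_mul_cancel (by positivity), ENNReal.ofReal_one, one_mul] at h7
      refine h7.trans (le_of_eq ?_)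
      congr 2
      have h8 : C₄ ^ (4 : ℝ) = C₄ ^ 4 := by exact_mod_cast Real.rpow_natCast C₄ 4
      rw [h8, Real.rpow_sub hs]
      field_simp
    refine h4.trans ((add_le_add hb1 hb2).trans (le_of_eq ?_))
    rw [← add_mul, ← ENNReal.ofReal_add (by positivity) (by positivity), ← add_div]
  have ha1 : 1 ≤ C * 2 ^ k + C₄ ^ 4 := by
    have h1 : (1 : ℝ) ≤ 2 ^ k := one_le_pow₀ (by norm_num)
    have h2 := one_le_mul_of_one_le_of_one_le hC1 h1
    have : 0 ≤ C₄ ^ 4 := by positivity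
    linarith
  have h5 := mul_rpow_le_of_le_div hp (by positivity : 0 < (t : ℝ) / 2) ha1
    (hlev (t / 2) (by positivity))
  rw [mul_div_cancel₀ _ (by norm_num : (2 : ℝ) ≠ 0)] at h5
  have h6 := mul_le_mul_right h5 (ENNReal.ofReal 2)
  rw [← mul_assoc, ← mul_assoc, ← ENNReal.ofReal_mul (by norm_num),
    ← ENNReal.ofReal_mul (by norm_num), mul_div_cancel₀ _ (by norm_num : (2 : ℝ) ≠ 0), ← hC₃] at h6
  refine h6.trans (hfin _ ?_)
  have h7 : C₃ ≤ c := by rw [hc]; linarith [(by positivity : 0 < C * 2 ^ (k + 2))]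
  calc C₃ ≤ c := h7
    _ ≤ c * (p / (p - 1)) ^ k := le_mul_of_one_le_right hc0.le hφk
    _ ≤ _ := le_mul_of_one_le_right (by positivity) hpk

end Interpolation

/-! ### The upper bounds for Calderón–Zygmund operators and their commutators. -/

section UpperBounds

variable {n : ℕ}

/-- The exhaustion consists of balls intersected with {|b| ≤ N}, where multiplication by `b`
preserves `L²`. A measurable version of `b` defines these sets. -/
theorem isSolidDomain_domCommutator {b : EuclideanSpace ℝ (Fin n) → ℝ}
    (hb : AEStronglyMeasurable b) : IsSolidDomain (domCommutator b) where
  meas _ hf := hf.1.1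
  solid f hf g hg hgf := ⟨hf.1.of_le hg (ae_of_all _ hgf),
    hf.2.of_le (hb.mul hg) (ae_of_all _ fun x => by
      rw [norm_mul, norm_mul]
      exact mul_le_mul_of_nonneg_left (hgf x) (norm_nonneg _))⟩
  exhaust := by
    have hm : Measurable (hb.mk b) := hb.stronglyMeasurable_mk.measurable
    have hfin : ∀ N : ℕ, volume (Metric.closedBall (0 : EuclideanSpace ℝ (Fin n)) N ∩
        {x | |hb.mk b x| ≤ N}) ≠ ∞ := fun N =>
      ne_top_of_le_ne_top Metric.isBounded_closedBall.measure_lt_top.ne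
        (measure_mono Set.inter_subset_left)
    have hmeas : ∀ N : ℕ, MeasurableSet (Metric.closedBall (0 : EuclideanSpace ℝ (Fin n)) N ∩
        {x | |hb.mk b x| ≤ N}) := fun N =>
      Metric.isClosed_closedBall.measurableSet.inter (measurableSet_le hm.abs measurable_const)
    refine ⟨fun N => Metric.closedBall 0 N ∩ {x | |hb.mk b x| ≤ N}, hmeas,
      fun i j hij => ?_, ?_, hfin, fun N g hg hg1 hg0 => ?_⟩
    · have hij' : (i : ℝ) ≤ j := by exact_mod_cast hij
      exact Set.inter_subset_inter (Metric.closedBall_subset_closedBall hij')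
        fun x (hx : |hb.mk b x| ≤ i) => le_trans hx hij'
    · refine Set.eq_univ_of_forall fun x => ?_
      obtain ⟨N, hN⟩ := exists_nat_ge (max ‖x‖ |hb.mk b x|)
      refine Set.mem_iUnion.2 ⟨N, ?_, (le_max_right _ _).trans hN⟩
      rw [mem_closedBall_zero_iff]
      exact (le_max_left _ _).trans hN
    · have hg2 : MemLp g 2 := by
        refine (memLp_indicator_const 2 (hmeas N) (1 : ℝ) (Or.inr (hfin N))).of_le
          hg.aestronglyMeasurable (ae_of_all _ fun x => ?_)
        by_cases hx : x ∈ Metric.closedBall (0 : EuclideanSpace ℝ (Fin n)) N ∩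
            {x | |hb.mk b x| ≤ N}
        · rw [Set.indicator_of_mem hx, norm_one]; exact hg1 x
        · rw [Set.indicator_of_notMem hx, hg0 x hx]
      refine ⟨hg2, hg2.of_le_mul (c := N) (hb.mul hg2.1) ?_⟩
      filter_upwards [hb.ae_eq_mk] with x hx
      by_cases hxG : x ∈ Metric.closedBall (0 : EuclideanSpace ℝ (Fin n)) N ∩
          {x | |hb.mk b x| ≤ N}
      · rw [norm_mul, hx]
        exact mul_le_mul_of_nonneg_right hxG.2 (norm_nonneg _)
      · rw [hg0 x hxG]; simp

theorem isSolidDomain_domL2 : IsSolidDomain (domL2 (EuclideanSpace ℝ (Fin n))) := by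
  have h := isSolidDomain_domCommutator (n := n) (b := fun _ => 0) aestronglyMeasurable_const
  have e : domCommutator (fun _ : EuclideanSpace ℝ (Fin n) => (0 : ℝ)) =
      domL2 (EuclideanSpace ℝ (Fin n)) := by
    ext f; simp [domCommutator, domL2]
  rwa [e] at h

theorem CZBound.weakTypeBounds (hn : 1 ≤ n) {T : L2Operator n}
    {K : EuclideanSpace ℝ (Fin n) → EuclideanSpace ℝ (Fin n) → ℝ} {A δ : ℝ}
    (hT : CZBound T K A δ) :
    WeakTypeBounds (domL2 (EuclideanSpace ℝ (Fin n))) T.onFun (max 1 (weakConst n A δ)) 0 where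
  one_le := le_max_left _ _
  meas f _ := (T.memLp_onFun f).1
  bound f hf r hr1 hr2 t ht := by
    refine (hT.weak_type hn hf hr1.le hr2 ht).trans (mul_le_mul_left (ENNReal.ofReal_le_ofReal ?_) _)
    rw [pow_zero, mul_one]
    exact div_le_div_of_nonneg_right (le_max_right _ _) (Real.rpow_nonneg ht.le _)

theorem CZBound.weakTypeBounds_opCommutator (hn : 1 ≤ n) {T : L2Operator n}
    {K : EuclideanSpace ℝ (Fin n) → EuclideanSpace ℝ (Fin n) → ℝ} {A δ : ℝ}
    (hT : CZBound T K A δ) {b : EuclideanSpace ℝ (Fin n) → ℝ} {β : ℝ} (hb : BMOBound b β) :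
    WeakTypeBounds (domCommutator b) (opCommutator b T.onFun)
      (max 1 (4 * commConst n A δ (2 * β))) 1 where
  one_le := le_max_left _ _
  meas f _ := (hb.locInt.aestronglyMeasurable.mul (T.memLp_onFun f).1).sub (T.memLp_onFun _).1
  bound f hf r hr1 hr2 t ht := by
    refine (hT.weak_type_opCommutator hn hb hf.1 hf.2 hr1 hr2 ht).trans
      (mul_le_mul_left (ENNReal.ofReal_le_ofReal ?_) _)
    rw [pow_one]
    have h1 : 0 ≤ r / (r - 1) := div_nonneg (by linarith) (by linarith)
    exact div_le_div_of_nonneg_right (mul_le_mul_of_nonneg_right (le_max_right _ _) h1)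
      (Real.rpow_nonneg ht.le _)

theorem WeakTypeBounds.neg {X : Type*} [MeasureSpace X] {D : Set (X → ℝ)}
    {S : (X → ℝ) → X → ℝ} {C : ℝ} {k : ℕ} (h : WeakTypeBounds D S C k) :
    WeakTypeBounds D (fun f x => -S f x) C k where
  one_le := h.one_le
  meas f hf := (h.meas f hf).neg
  bound f hf r hr1 hr2 t ht := by
    simp_rw [abs_neg]; exact h.bound f hf r hr1 hr2 t ht

theorem IsCalderonZygmund.exists_weakOpNorm_le (hn : 1 ≤ n) {T : L2Operator n}
    (hT : IsCalderonZygmund T) : ∃ c : ℝ, 0 < c ∧ ∀ p : ℝ, 1 < p →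
      weakOpNorm (domL2 (EuclideanSpace ℝ (Fin n))) T.onFun p ≤ ENNReal.ofReal (c * p) := by
  obtain ⟨K, A, δ, h⟩ := hT.exists_bound
  obtain ⟨c, hc, hle⟩ := weakOpNorm_le_of_weakTypeBounds isSolidDomain_domL2 (h.weakTypeBounds hn)
    (h.adj.weakTypeBounds hn) (fun f hf g hg => T.onFun_add hf hg)
    (fun f _ g hg => (T.memLp_onFun f).integrable_mul hg)
    (fun f hf g hg => T.integral_onFun_mul hf hg)
  exact ⟨c, hc, fun p hp => by simpa using hle p hp⟩

/-- The dual operator is -[b, T*], and T* obeys the same kernel bounds. Pairings are split into two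
integrals, each convergent because f, g, bf and bg are all in `L²`. -/
theorem IsCalderonZygmund.exists_weakOpNorm_opCommutator_le (hn : 1 ≤ n) {T : L2Operator n}
    (hT : IsCalderonZygmund T) {b : EuclideanSpace ℝ (Fin n) → ℝ} (hb : MemBMO b) :
    ∃ c : ℝ, 0 < c ∧ ∀ p : ℝ, 1 < p →
      weakOpNorm (domCommutator b) (opCommutator b T.onFun) p ≤
        ENNReal.ofReal (c * (p / (p - 1)) * p ^ 2) := by
  obtain ⟨K, A, δ, h⟩ := hT.exists_bound
  obtain ⟨β, hβ⟩ := hb.exists_bound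
  have hsplit : ∀ f g : EuclideanSpace ℝ (Fin n) → ℝ,
      (fun x => opCommutator b T.onFun f x * g x) =
        fun x => T.onFun f x * (b x * g x) - T.onFun (fun y => b y * f y) x * g x := by
    intro f g; funext x; rw [opCommutator]; ring
  have hi1 : ∀ f g : EuclideanSpace ℝ (Fin n) → ℝ, MemLp g 2 →
      Integrable fun x => T.onFun f x * g x := fun f g hg =>
    (T.memLp_onFun f).integrable_mul hg
  have hi2 : ∀ f g : EuclideanSpace ℝ (Fin n) → ℝ, MemLp f 2 →
      Integrable fun x => f x * T.adj.onFun g x := fun f g hf =>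
    hf.integrable_mul (T.adj.memLp_onFun g)
  obtain ⟨c, hc, hle⟩ := weakOpNorm_le_of_weakTypeBounds
    (isSolidDomain_domCommutator hβ.locInt.aestronglyMeasurable)
    (h.weakTypeBounds_opCommutator hn hβ) (h.adj.weakTypeBounds_opCommutator hn hβ).neg
    (fun f hf g hg => opCommutator_add_ae T hf.1 hg.1 hf.2 hg.2)
    (fun f hf g hg => by
      rw [hsplit]
      exact (hi1 f _ hg.2).sub (hi1 _ g hg.1))
    (fun f hf g hg => by
      rw [hsplit, integral_sub (hi1 f _ hg.2) (hi1 _ g hg.1), T.integral_onFun_mul hf.1 hg.2,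
        T.integral_onFun_mul hf.2 hg.1, ← integral_sub (hi2 f _ hf.1) (hi2 _ g hf.2)]
      congr 1; funext x
      rw [opCommutator]; ring)
  exact ⟨c, hc, fun p hp => by simpa using hle p hp⟩

end UpperBounds

/-! ### Assembly of the estimates. -/

theorem lemma1p2 :
    (∀ n : ℕ, 1 ≤ n →
      (∀ T : L2Operator n, IsCalderonZygmund T →
        (∃ c₁ : ℝ, 0 < c₁ ∧ ∀ p : ℝ, 1 < p →
          weakOpNorm (domL2 (EuclideanSpace ℝ (Fin n))) T.onFun p ≤ ENNReal.ofReal (c₁ * p)) ∧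
        (∀ b : EuclideanSpace ℝ (Fin n) → ℝ, MemBMO b →
          ∃ c₂ : ℝ, 0 < c₂ ∧ ∀ p : ℝ, 1 < p →
            weakOpNorm (domCommutator b) (opCommutator b T.onFun) p ≤
              ENNReal.ofReal (c₂ * (p / (p - 1)) * p ^ 2))) ∧
      (∀ k : ℕ, 1 ≤ k → ∃ c₃ c₄ : ℝ, 0 < c₃ ∧ 0 < c₄ ∧ ∀ p : ℝ, 1 < p →
        ENNReal.ofReal (c₃ * (p / (p - 1)) ^ (k - 1)) ≤
          weakOpNorm Set.univ (iterMaximal (n := n) k) p ∧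
        weakOpNorm Set.univ (iterMaximal (n := n) k) p ≤
          ENNReal.ofReal (c₄ * (p / (p - 1)) ^ (k - 1)))) ∧
    (∃ c₅ : ℝ, 0 < c₅ ∧ ∀ p : ℝ, 1 < p →
      ENNReal.ofReal (c₅ * p) ≤ weakOpNorm (domL2 ℝ) hilbertTransform p) ∧
    (∃ c₆ : ℝ, 0 < c₆ ∧ ∀ p : ℝ, 1 < p →
      ENNReal.ofReal (c₆ * max (p / (p - 1)) (p ^ 2)) ≤
        weakOpNorm (domCommutator fun x : ℝ => Real.log |x|)
          (opCommutator (fun x : ℝ => Real.log |x|) hilbertTransform) p) := by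
  refine ⟨fun n hn => ⟨fun T hT => ⟨hT.exists_weakOpNorm_le hn, fun b hb =>
    hT.exists_weakOpNorm_opCommutator_le hn hb⟩, fun k hk => ?_⟩,
    ⟨Real.exp (-1), by positivity, fun p hp => le_weakOpNorm_hilbertTransform hp⟩,
    ⟨Real.exp (-1) / 16, by positivity, fun p hp =>
      le_weakOpNorm_commutator_hilbertTransform hp⟩⟩
  obtain ⟨c, hc, hle⟩ := exists_le_weakOpNorm_iterMaximal hn hk
  exact ⟨c, 5 ^ n * (4 * 5 ^ n) ^ (k - 1), hc, by positivity, fun p hp =>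
    ⟨hle p hp, weakOpNorm_iterMaximal_le hn hk hp⟩⟩
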